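/- **Setting.** The Engel group $G$ is $\mathbb R^4$ with coordinates $(x,y,z,v)$ (coordinates of the first kind), identity $e=0$ and multiplication $$(x_1,y_1,z_1,v_1)(x_2,y_2,z_2,v_2)=\Big(x_1+x_2,\;y_1+y_2,\;z_1+z_2+\tfrac12(x_1y_2-x_2y_1),\;v_1+v_2+\tfrac12(x_1z_2-x_2z_1)+\tfrac1{12}(x_1^2y_2-x_1x_2y_2-x_1x_2y_1+x_2^2y_1)\Big).$$ Let $D(e)=\{(u_1,u_2,0,0)\}\cong\mathbb R^2$, let $F$ be an arbitrary norm on $D(e)$ with closed unit ball $U$, and let $d$ be the left-invariant sub-Finsler metric defined by $F$ (infimum of the $F$-lengths of horizontal curves). With $l_g(h)=gh$, consider $\dot g=dl_g(u)$ with measurable $u(t)\in U$, and $\mathcal H(g,\psi,u)=\psi(dl_g(u))$. A *normal extremal* is a locally absolutely continuous curve $g:\mathbb R\to G$ for which there are such a control $u:\mathbb R\to U$, a nowhere vanishing locally absolutely continuous covector function $\psi$ and a constant $M>0$ with, for almost all $t$, $\dot g=dl_g(u)$, $\dot\psi_i=-\partial\mathcal H/\partial g_i$, and $\mathcal H(g,\psi,u(t))=\max_{w\in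 U}\mathcal H(g,\psi,w)=M$. Multiplying $\psi$ by a constant, normalize $M=1$. Put $\varphi_i=\psi_i(0)$, $g(0)=e$, $h_1=\psi(X)$, $h_2=\psi(Y)$, where $X,Y$ are the left-invariant fields with $X(e)=(1,0,0,0)$, $Y(e)=(0,1,0,0)$. Let $F_U(h)=\max_{u\in U}h\cdot u$, $U^*=\{F_U\le1\}$, and let $r=r(\theta)$ be the polar equation of $F_U=1$; $h_2(\theta)=r(\theta)\sin\theta$. The symbol $r'(\theta)$ stands for any number between the two one-sided derivatives of $r$ at $\theta$. Put $\mathcal E=\varphi_3^2/2-\varphi_2\varphi_4$, $\mathcal E_0=\max_{h\in U^*}(-\varphi_4h_2)$, $\mathcal E_{-1}=\min_{h\in U^*}(-\varphi_4h_2)$, and $$R(\theta)=\frac{\varphi_3^2+2\varphi_4(r(\theta)\sin\theta-\varphi_2)}{r^4(\theta)} .$$ **Theorem.** Let $\varphi_4\ne0$. For every normal extremal starting at $e$ with these $\varphi_i$ there is a continuous $\theta(t)$ with $(h_1,h_2)(t)=r(\theta(t))(\cos\theta(t),\sin\theta(t))$. Moreover, a curve $g=(x,y,z,v)$ is such an extremal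 with such a function $\theta$ if and only if $\theta$ is continuously differentiable, $r(\theta(0))(\cos\theta(0),\sin\theta(0))=(\varphi_1,\varphi_2)$, $r^2(\theta)\dot\theta=\varphi_3+\varphi_4x$, $\dot\theta^2=R(\theta)$, and, for some measurable choice of the values $r'(\theta(\tau))$, $$x(t)=\int_0^t\frac{r'(\theta)\sin\theta+r(\theta)\cos\theta}{r^2(\theta)}\,d\tau,\qquad y(t)=\int_0^t\frac{r(\theta)\sin\theta-r'(\theta)\cos\theta}{r^2(\theta)}\,d\tau\qquad(\theta=\theta(\tau)),$$ $$z(t)=-\tfrac1{\varphi_4}\Big(r(\theta(t))\cos\theta(t)-\varphi_1+(\varphi_3+\tfrac12\varphi_4x(t))y(t)\Big),$$ $$v(t)=\tfrac1{3\varphi_4}\Big(t-\varphi_1x(t)-\varphi_2y(t)-(2\varphi_3+\tfrac12\varphi_4x(t))z(t)\Big).$$ For every such extremal, with $\theta_0=\theta(0)$ (so $r(\theta_0)\sin\theta_0=\varphi_2$), at least one of the following cases 1–5 occurs, and the stated conclusions hold. Put $$(\mathrm A)\quad t(\theta)=\int_{\theta_0}^{\theta}\frac{r^2(\xi)\,d\xi}{\varphi_3\sqrt{1+(2\varphi_4/\varphi_3^2)(r(\xi)\sin\xi-\varphi_2)}},\qquad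 (\mathrm B)\quad t(\theta)=\int_{\theta_0}^{\theta}\frac{r^2(\xi)\,d\xi}{\sqrt{2\varphi_4(r(\xi)\sin\xi-\varphi_2)}} .$$ Call (L) the assertion that $\theta(t)\equiv\theta_0$ and the extremal is one of the two curves $x\equiv0$, $y=\pm t/F(0,1)$, $z\equiv0$, $v\equiv0$, and that it is a metric straight line: $d(g(s),g(t))=|t-s|$ for all $s,t$. 1. $\varphi_3\ne0$, $\mathcal E>\mathcal E_0$. Then $\theta:\mathbb R\to\mathbb R$ is the inverse of the function (A). 2. $\varphi_3=0$, $\mathcal E=\mathcal E_{-1}$. Then (L) holds. 3. $\mathcal E_{-1}<\mathcal E<\mathcal E_0$. Then for some $t_1\ne t_2$, all $t\in\mathbb R$, $k\in\mathbb Z$ and $i=1,2$: $$(\mathrm C)\quad \theta(t+2k(t_2-t_1))=\theta(t),\quad \dot\theta(t_i+t)=-\dot\theta(t_i-t),\quad \theta(t_i+t)=\theta(t_i-t).$$ 3.1. If $\varphi_3\ne0$, one can take $t_i=t(\theta_i)$ from (A), the integrals being finite, where $\theta_1,\theta_2$ are the zeros of $R$ nearest to $\theta_0$ on its two sides, labelled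 so that $\varphi_3(\theta_2-\theta_1)>0$; and $\theta(t(\eta))=\eta$ for $\eta$ between $\theta_1$ and $\theta_2$. 3.2. If $\varphi_3=0$, there is $\theta_2\ne\theta_0$ with $h_2(\theta_2)=h_2(\theta_0)$ and $\varphi_4(h_2(\theta)-h_2(\theta_0))>0$ for all $\theta$ strictly between $\theta_0$ and $\theta_2$; the integral (B) is finite at $\theta_2$, and (C) holds with $t_1=0$ and $t_2=\pm t(\theta_2)$, with $t(\theta)$ from (B) and the sign that of $\varphi_4(\theta_2-\theta_0)$; with the same sign, $\theta(\pm t(\eta))=\eta$ for $\eta$ between $\theta_0$ and $\theta_2$. 4. $\varphi_3\ne0$, $\mathcal E=\mathcal E_0$. Then there are zeros $\theta_1<\theta_0<\theta_2$ of $R$ nearest to $\theta_0$. If the improper integral (A) diverges at both $\theta_1$ and $\theta_2$, then $\theta(t)\in(\theta_1,\theta_2)$ for all $t\in\mathbb R$ and $\theta$ is the inverse of the function (A) on $(\theta_1,\theta_2)$. If (A) is finite for at least one of $\theta_1,\theta_2$, then $\theta(t)$ is not unique (two normal extremals with the same $\varphi_1,\dots,\varphi_4$ and $\theta_0$ have different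 functions $\theta$), and for each $\theta_i$ at which it is finite and each $\ell>0$ there is a normal extremal with the same $\varphi_1,\dots,\varphi_4,\theta_0$ for which $\theta$ has a maximal closed interval of constancy of length $\ell$, with value $\theta_i$. On every non-degenerate closed interval $J$ where $\theta$ is constant, for all $t_0,t\in J$, $$x(t)=-\frac{\varphi_3}{\varphi_4},\quad y(t)=y(t_0)+\frac{2\varphi_4(t-t_0)}{2\varphi_2\varphi_4-\varphi_3^2},\quad z(t)=z(t_0)+\frac{\varphi_3(t-t_0)}{\varphi_3^2-2\varphi_2\varphi_4},\quad v(t)=v(t_0)+\frac{\varphi_3^2(t-t_0)}{6\varphi_4(2\varphi_2\varphi_4-\varphi_3^2)}.$$ 5. $\varphi_3=0$, $\mathcal E=\mathcal E_0$. Then there is a largest segment $[\theta_1,\theta_2]\ni\theta_0$, $\theta_1\le\theta_2$, on which $h_2(\theta)=\varphi_2$. Say that (B) diverges on the right (left) of $\theta_0$ if it is infinite for every $\theta\in(\theta_0,\theta_1+2\pi)$ (respectively $\theta\in(\theta_2-2\pi,\theta_0)$). The assertion (L) holds in each of the cases 5.1. $\theta_1=\theta_0=\theta_2$ and (B) diverges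 on both sides of $\theta_0$; 5.2. $\theta_1<\theta_0<\theta_2$; 5.3. $\theta_0=\theta_1<\theta_2$ and (B) diverges on the left of $\theta_0$; 5.4. $\theta_0=\theta_2>\theta_1$ and (B) diverges on the right of $\theta_0$. In all other cases $\theta(t)$ is not unique, and for each $\ell>0$ there is a normal extremal with the same $\varphi_1,\dots,\varphi_4,\theta_0$ for which $\theta$ has a maximal closed interval of constancy of length $\ell$, with value $\theta_0$. On every non-degenerate closed interval $J$ where $\theta$ is constant, for all $t_0,t\in J$, $$x(t)=0,\quad y(t)=y(t_0)+\frac{t-t_0}{\varphi_2},\quad z(t)=z(t_0),\quad v(t)=v(t_0)=\frac{t_0-\varphi_2y(t_0)}{3\varphi_4}.$$ -/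

import Mathlib

open MeasureTheory Set Filter Topology

/-! ### The Engel group in coordinates of the first kind -/

/-- The Engel group is `ℝ⁴` with this multiplication. -/
noncomputable def engelMul (p q : Fin 4 → ℝ) : Fin 4 → ℝ :=
  ![p 0 + q 0,
    p 1 + q 1,
    p 2 + q 2 + (1 / 2) * (p 0 * q 1 - q 0 * p 1),
    p 3 + q 3 + (1 / 2) * (p 0 * q 2 - q 0 * p 2)
      + (1 / 12) * ((p 0) ^ 2 * q 1 - p 0 * q 0 * q 1 - p 0 * q 0 * p 1 + (q 0) ^ 2 * p 1)]

/-- The identity of the Engel group is the origin. -/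
theorem engelMul_zero (p : Fin 4 → ℝ) : engelMul p 0 = p := by
  ext i; fin_cases i <;> simp [engelMul]

theorem zero_engelMul (p : Fin 4 → ℝ) : engelMul 0 p = p := by
  ext i; fin_cases i <;> simp [engelMul]

theorem neg_engelMul (p : Fin 4 → ℝ) : engelMul (-p) p = 0 := by
  ext i; fin_cases i <;> simp [engelMul]

theorem engelMul_assoc (p q s : Fin 4 → ℝ) :
    engelMul (engelMul p q) s = engelMul p (engelMul q s) := by
  ext i; fin_cases i <;> simp [engelMul] <;> ring

/-- The differential at the identity of the left translation by `p`. -/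
noncomputable def leftDifferential (p : Fin 4 → ℝ) : (Fin 4 → ℝ) →L[ℝ] (Fin 4 → ℝ) :=
  fderiv ℝ (engelMul p) 0

/-- The vector `w₁ X(e) + w₂ Y(e)` of the plane `D(e)`, with `w = (w₁, w₂)`. -/
def horizontalVector (w : ℝ × ℝ) : Fin 4 → ℝ := ![w.1, w.2, 0, 0]

/-- The left-invariant horizontal field in coordinates. -/
theorem leftDifferential_horizontalVector (p : Fin 4 → ℝ) (w : ℝ × ℝ) :
    leftDifferential p (horizontalVector w) =
      ![w.1, w.2, (1 / 2) * (p 0 * w.2 - p 1 * w.1),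
        -(1 / 2) * (p 2 + (1 / 6) * (p 0 * p 1)) * w.1 + (1 / 12) * (p 0) ^ 2 * w.2] := by
  have hd : DifferentiableAt ℝ (engelMul p) 0 := by
    rw [differentiableAt_pi]
    intro i
    fin_cases i <;> simp [engelMul] <;> fun_prop
  rw [leftDifferential, ← hd.lineDeriv_eq_fderiv, lineDeriv]
  refine HasDerivAt.deriv ?_
  rw [hasDerivAt_pi]
  have h1 : HasDerivAt (fun s : ℝ => s) 1 0 := hasDerivAt_id 0
  intro i
  fin_cases i
  · simpa [engelMul, horizontalVector] using (h1.mul_const w.1).const_add (p 0)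
  · simpa [engelMul, horizontalVector] using (h1.mul_const w.2).const_add (p 1)
  · have := (h1.mul_const (2⁻¹ * (p 0 * w.2 - w.1 * p 1))).const_add (p 2)
    simp only [one_mul] at this
    simp only [engelMul, horizontalVector]
    convert this using 1
    · ext s; simp; ring
    · simp; ring
  · have := (((h1.mul_const (-(1 / 2) * (p 2 + (1 / 6) * (p 0 * p 1)) * w.1
      + (1 / 12) * (p 0) ^ 2 * w.2)).const_add (p 3)).add
      ((h1.pow 2).mul_const ((1 / 12) * (w.1 ^ 2 * p 1 - p 0 * w.1 * w.2))))
    simp only [engelMul, horizontalVector]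
    convert this using 1
    · ext s; simp; ring
    · simp

/-- The Hamiltonian `ψ(dl_p(w))` of a covector `ψ` at `p` and of `w` in `D(e)`. -/
noncomputable def pmpHamiltonian (p ψ : Fin 4 → ℝ) (w : ℝ × ℝ) : ℝ :=
  ∑ i, ψ i * leftDifferential p (horizontalVector w) i

/-- The right-hand side of the conjugate system: minus the gradient of the Hamiltonian with
respect to the point of the group. -/
noncomputable def adjointField (p ψ : Fin 4 → ℝ) (w : ℝ × ℝ) : Fin 4 → ℝ :=
  fun i => -(fderiv ℝ (fun q => pmpHamiltonian q ψ w) p (Pi.single i 1))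

/-- The conjugate system in coordinates. -/
theorem adjointField_eq (p ψ : Fin 4 → ℝ) (w : ℝ × ℝ) :
    adjointField p ψ w =
      ![(1 / 12) * ψ 3 * p 1 * w.1 - ((1 / 2) * ψ 2 + (1 / 6) * ψ 3 * p 0) * w.2,
        ((1 / 2) * ψ 2 + (1 / 12) * ψ 3 * p 0) * w.1,
        (1 / 2) * ψ 3 * w.1,
        0] := by
  have hH : (fun q => pmpHamiltonian q ψ w) = fun q : Fin 4 → ℝ =>
      ψ 0 * w.1 + ψ 1 * w.2 + ψ 2 * ((1 / 2) * (q 0 * w.2 - q 1 * w.1))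
      + ψ 3 * (-(1 / 2) * (q 2 + (1 / 6) * (q 0 * q 1)) * w.1 + (1 / 12) * (q 0) ^ 2 * w.2) := by
    funext q
    simp only [pmpHamiltonian, leftDifferential_horizontalVector, Fin.sum_univ_four]
    simp
  have key : ∀ v : Fin 4 → ℝ, fderiv ℝ (fun q => pmpHamiltonian q ψ w) p v =
      (ψ 2 * ((1 / 2) * (v 0 * w.2 - v 1 * w.1))
        + ψ 3 * (-(1 / 2) * (v 2 + (1 / 6) * (v 0 * p 1 + p 0 * v 1)) * w.1
          + (1 / 6) * p 0 * v 0 * w.2)) := by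
    intro v
    rw [hH, ← DifferentiableAt.lineDeriv_eq_fderiv (by fun_prop), lineDeriv]
    refine HasDerivAt.deriv ?_
    have h1 : HasDerivAt (fun s : ℝ => s) 1 0 := hasDerivAt_id 0
    have := ((h1.mul_const (ψ 2 * ((1 / 2) * (v 0 * w.2 - v 1 * w.1))
        + ψ 3 * (-(1 / 2) * (v 2 + (1 / 6) * (v 0 * p 1 + p 0 * v 1)) * w.1
          + (1 / 6) * p 0 * v 0 * w.2))).const_add (pmpHamiltonian p ψ w)).add
      ((h1.pow 2).mul_const (ψ 3 * (-(1 / 12) * (v 0 * v 1) * w.1 + (1 / 12) * (v 0) ^ 2 * w.2)))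
    rw [congrFun hH p] at this
    convert this using 1
    · ext s; simp; ring
    · simp
  ext i
  simp only [adjointField, key]
  fin_cases i <;> simp <;> ring

/-! ### Norms on the plane `D(e)`, polar figure, polar equation -/

/-- The unit ball `U` of `F`. -/
def unitBallOf (F : Seminorm ℝ (ℝ × ℝ)) : Set (ℝ × ℝ) := {w | F w ≤ 1}

/-- The support function `F_U(h) = max_{w ∈ U} h · w`, i.e. the dual norm of `F`. -/
noncomputable def supportNorm (F : Seminorm ℝ (ℝ × ℝ)) (h : ℝ × ℝ) : ℝ :=
  sSup ((fun w : ℝ × ℝ => h.1 * w.1 + h.2 * w.2) '' unitBallOf F)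

/-- The polar figure `U*`. -/
def polarFigure (F : Seminorm ℝ (ℝ × ℝ)) : Set (ℝ × ℝ) := {h | supportNorm F h ≤ 1}

/-- The polar equation `r = r(θ)` of the curve `F_U = 1`. -/
noncomputable def polarRadius (F : Seminorm ℝ (ℝ × ℝ)) (θ : ℝ) : ℝ :=
  (supportNorm F (Real.cos θ, Real.sin θ))⁻¹

/-- `h₂(θ) = r(θ) sin θ`. -/
noncomputable def polarH2 (F : Seminorm ℝ (ℝ × ℝ)) (θ : ℝ) : ℝ :=
  polarRadius F θ * Real.sin θ

/-- `ρ` lies between the one-sided derivatives of the polar radius at `θ`: it is an admissible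
value of `r'(θ)`. -/
def IsRadiusDerivValue (F : Seminorm ℝ (ℝ × ℝ)) (θ ρ : ℝ) : Prop :=
  ∃ a b : ℝ, HasDerivWithinAt (polarRadius F) a (Iic θ) θ ∧
    HasDerivWithinAt (polarRadius F) b (Ici θ) θ ∧ ρ ∈ uIcc a b

/-- The integrand `(r' sin θ + r cos θ) / r²` with `ρ` in place of `r'`. -/
noncomputable def controlX (F : Seminorm ℝ (ℝ × ℝ)) (θ ρ : ℝ) : ℝ :=
  (ρ * Real.sin θ + polarRadius F θ * Real.cos θ) / polarRadius F θ ^ 2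

/-- The integrand `(r sin θ - r' cos θ) / r²` with `ρ` in place of `r'`. -/
noncomputable def controlY (F : Seminorm ℝ (ℝ × ℝ)) (θ ρ : ℝ) : ℝ :=
  (polarRadius F θ * Real.sin θ - ρ * Real.cos θ) / polarRadius F θ ^ 2

/-! ### Extremals -/

/-- The control `u`, the trajectory `g` and the covector function `ψ`, defined on `ℝ`, satisfy the
Pontryagin Maximum Principle for the time-optimal problem `ġ = dl_g(u)`, `u ∈ U`, with constant
maximum `M ≥ 0`. -/
structure IsExtremal (F : Seminorm ℝ (ℝ × ℝ)) (u : ℝ → ℝ × ℝ) (g ψ : ℝ → Fin 4 → ℝ)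
    (M : ℝ) : Prop where
  measurable_control : Measurable u
  control_mem : ∀ t, u t ∈ unitBallOf F
  trajectory_ac : ∀ a b : ℝ, AbsolutelyContinuousOnInterval g a b
  covector_ac : ∀ a b : ℝ, AbsolutelyContinuousOnInterval ψ a b
  covector_ne_zero : ∀ t, ψ t ≠ 0
  state_eq : ∀ᵐ t, HasDerivAt g (leftDifferential (g t) (horizontalVector (u t))) t
  adjoint_eq : ∀ᵐ t, HasDerivAt ψ (adjointField (g t) (ψ t) (u t)) t
  nonneg : 0 ≤ M
  maximum_eq : ∀ᵐ t, pmpHamiltonian (g t) (ψ t) (u t) = M ∧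
    ∀ w ∈ unitBallOf F, pmpHamiltonian (g t) (ψ t) w ≤ M

/-- `θ` is a continuous polar angle of the covector `(h₁, h₂) / M`, where `h₁ = ψ(X)` and
`h₂ = ψ(Y)`, on the curve `r = r(θ)`. -/
def IsPolarAngle (F : Seminorm ℝ (ℝ × ℝ)) (g ψ : ℝ → Fin 4 → ℝ) (M : ℝ) (θ : ℝ → ℝ) : Prop :=
  Continuous θ ∧ ∀ t,
    pmpHamiltonian (g t) (ψ t) (1, 0) / M = polarRadius F (θ t) * Real.cos (θ t) ∧
    pmpHamiltonian (g t) (ψ t) (0, 1) / M = polarRadius F (θ t) * Real.sin (θ t)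

/-- `g` is a normal extremal issuing from the identity whose covector function, divided by
`M > 0`, has the initial value `(φ₁, φ₂, φ₃, φ₄)`, and `θ` is its polar angle. -/
def IsNormalExtremal (F : Seminorm ℝ (ℝ × ℝ)) (φ₁ φ₂ φ₃ φ₄ : ℝ) (g : ℝ → Fin 4 → ℝ)
    (θ : ℝ → ℝ) : Prop :=
  ∃ (u : ℝ → ℝ × ℝ) (ψ : ℝ → Fin 4 → ℝ) (M : ℝ), IsExtremal F u g ψ M ∧ 0 < M ∧ g 0 = 0 ∧
    ψ 0 = M • ![φ₁, φ₂, φ₃, φ₄] ∧ IsPolarAngle F g ψ M θ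

/-- The right-hand side of the equation for the square of `θ̇`. -/
noncomputable def angularSpeedSq (F : Seminorm ℝ (ℝ × ℝ)) (φ₂ φ₃ φ₄ θ : ℝ) : ℝ :=
  (φ₃ ^ 2 + 2 * φ₄ * (polarRadius F θ * Real.sin θ - φ₂)) / polarRadius F θ ^ 4

/-- The explicit description of the trajectory `g` through a continuously differentiable function
`θ` and a measurable choice `ρ` of the values `r'(θ(t))`. -/
structure IsGivenBy (F : Seminorm ℝ (ℝ × ℝ)) (φ₁ φ₂ φ₃ φ₄ : ℝ) (g : ℝ → Fin 4 → ℝ)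
    (θ ρ : ℝ → ℝ) : Prop where
  angle_contDiff : ContDiff ℝ 1 θ
  initial₁ : polarRadius F (θ 0) * Real.cos (θ 0) = φ₁
  initial₂ : polarRadius F (θ 0) * Real.sin (θ 0) = φ₂
  choice_measurable : Measurable ρ
  choice_mem : ∀ t, IsRadiusDerivValue F (θ t) (ρ t)
  angle_eq : ∀ t, polarRadius F (θ t) ^ 2 * deriv θ t = φ₃ + φ₄ * g t 0
  angle_sq_eq : ∀ t, deriv θ t ^ 2 = angularSpeedSq F φ₂ φ₃ φ₄ (θ t)
  x_eq : ∀ t, g t 0 = ∫ τ in (0 : ℝ)..t, controlX F (θ τ) (ρ τ)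
  y_eq : ∀ t, g t 1 = ∫ τ in (0 : ℝ)..t, controlY F (θ τ) (ρ τ)
  z_eq : ∀ t, g t 2 = -(1 / φ₄) *
    (polarRadius F (θ t) * Real.cos (θ t) - φ₁ + (φ₃ + (1 / 2) * φ₄ * g t 0) * g t 1)
  v_eq : ∀ t, g t 3 = (1 / (3 * φ₄)) *
    (t - φ₁ * g t 0 - φ₂ * g t 1 - (2 * φ₃ + (1 / 2) * φ₄ * g t 0) * g t 2)

/-! ### Energy levels and times -/

/-- The value of the Casimir function `𝓔 = h₃²/2 - h₂h₄`. -/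
noncomputable def casimirEnergy (φ₂ φ₃ φ₄ : ℝ) : ℝ := φ₃ ^ 2 / 2 - φ₂ * φ₄

/-- `𝓔₀`, the maximum of `-φ₄h₂` over `U*`. -/
noncomputable def energyMax (F : Seminorm ℝ (ℝ × ℝ)) (φ₄ : ℝ) : ℝ :=
  sSup ((fun h : ℝ × ℝ => -φ₄ * h.2) '' polarFigure F)

/-- `𝓔₋₁`, the minimum of `-φ₄h₂` over `U*`. -/
noncomputable def energyMin (F : Seminorm ℝ (ℝ × ℝ)) (φ₄ : ℝ) : ℝ :=
  sInf ((fun h : ℝ × ℝ => -φ₄ * h.2) '' polarFigure F)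

/-- The integrand of `t(θ)` for `φ₃ ≠ 0`. -/
noncomputable def timeIntegrand (F : Seminorm ℝ (ℝ × ℝ)) (φ₂ φ₃ φ₄ ξ : ℝ) : ℝ :=
  polarRadius F ξ ^ 2 /
    (φ₃ * √(1 + (2 * φ₄ / φ₃ ^ 2) * (polarRadius F ξ * Real.sin ξ - φ₂)))

/-- The integrand of `t(θ)` for `φ₃ = 0`, without sign. -/
noncomputable def timeIntegrandZero (F : Seminorm ℝ (ℝ × ℝ)) (φ₂ φ₄ ξ : ℝ) : ℝ :=
  polarRadius F ξ ^ 2 / √(2 * φ₄ * (polarRadius F ξ * Real.sin ξ - φ₂))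

/-- The function `t(θ)` for `φ₃ ≠ 0`. -/
noncomputable def timeOf (F : Seminorm ℝ (ℝ × ℝ)) (φ₂ φ₃ φ₄ θ₀ θ : ℝ) : ℝ :=
  ∫ ξ in θ₀..θ, timeIntegrand F φ₂ φ₃ φ₄ ξ

/-- The function `t(θ)` for `φ₃ = 0`, without sign. -/
noncomputable def timeOfZero (F : Seminorm ℝ (ℝ × ℝ)) (φ₂ φ₄ θ₀ θ : ℝ) : ℝ :=
  ∫ ξ in θ₀..θ, timeIntegrandZero F φ₂ φ₄ ξ

/-- The (possibly improper) integral `t(θ)` for `φ₃ ≠ 0` is finite. -/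
def TimeFinite (F : Seminorm ℝ (ℝ × ℝ)) (φ₂ φ₃ φ₄ θ₀ θ : ℝ) : Prop :=
  IntervalIntegrable (timeIntegrand F φ₂ φ₃ φ₄) volume θ₀ θ

/-- The (possibly improper) integral `t(θ)` for `φ₃ = 0` is finite. -/
def TimeZeroFinite (F : Seminorm ℝ (ℝ × ℝ)) (φ₂ φ₄ θ₀ θ : ℝ) : Prop :=
  IntervalIntegrable (timeIntegrandZero F φ₂ φ₄) volume θ₀ θ

/-- `θ` is periodic with period `2(t₂ - t₁)` and symmetric about `t₁` and about `t₂`. -/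
def IsReflectionPeriodic (θ : ℝ → ℝ) (t₁ t₂ : ℝ) : Prop :=
  (∀ (t : ℝ) (k : ℤ), θ (t + 2 * k * (t₂ - t₁)) = θ t) ∧
  (∀ t, deriv θ (t₁ + t) = -deriv θ (t₁ - t) ∧ θ (t₁ + t) = θ (t₁ - t)) ∧
  (∀ t, deriv θ (t₂ + t) = -deriv θ (t₂ - t) ∧ θ (t₂ + t) = θ (t₂ - t))

/-! ### Metric straight lines -/

/-- The lengths of the horizontal curves joining `p` to `q`. -/
def horizontalLengths (F : Seminorm ℝ (ℝ × ℝ)) (p q : Fin 4 → ℝ) : Set ℝ :=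
  {ℓ | ∃ (w : ℝ → ℝ × ℝ) (c : ℝ → Fin 4 → ℝ), AbsolutelyContinuousOnInterval c 0 1 ∧
    (∀ᵐ t ∂volume.restrict (Icc (0 : ℝ) 1),
      HasDerivAt c (leftDifferential (c t) (horizontalVector (w t))) t) ∧
    c 0 = p ∧ c 1 = q ∧ ℓ = ∫ t in (0 : ℝ)..1, F (w t)}

/-- The left-invariant sub-Finsler metric defined by `F`. -/
noncomputable def subFinslerDist (F : Seminorm ℝ (ℝ × ℝ)) (p q : Fin 4 → ℝ) : ℝ :=
  sInf (horizontalLengths F p q)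

/-- `g` is one of the two curves `x = 0`, `y = ± t / F(0,1)`, `z = 0`, `v = 0`, and it is a metric
straight line: every arc of it is a shortest arc parametrized by arc length. -/
def IsVerticalMetricLine (F : Seminorm ℝ (ℝ × ℝ)) (g : ℝ → Fin 4 → ℝ) : Prop :=
  ((∀ t, g t = ![0, t / F (0, 1), 0, 0]) ∨ (∀ t, g t = ![0, -(t / F (0, 1)), 0, 0])) ∧
  ∀ s t, subFinslerDist F (g s) (g t) = |t - s|

/-! ### Intervals of constancy and non-uniqueness of the angle -/

/-- The form of `g` on every non-degenerate closed interval on which `θ` is constant. -/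
def ConstancyFormulas (φ₂ φ₃ φ₄ : ℝ) (g : ℝ → Fin 4 → ℝ) (θ : ℝ → ℝ) : Prop :=
  ∀ a b : ℝ, a < b → (∀ t ∈ Icc a b, θ t = θ a) → ∀ t₀ ∈ Icc a b, ∀ t ∈ Icc a b,
    g t 0 = -(φ₃ / φ₄) ∧
    g t 1 = g t₀ 1 + 2 * φ₄ * (t - t₀) / (2 * φ₂ * φ₄ - φ₃ ^ 2) ∧
    g t 2 = g t₀ 2 + φ₃ * (t - t₀) / (φ₃ ^ 2 - 2 * φ₂ * φ₄) ∧
    g t 3 = g t₀ 3 + φ₃ ^ 2 * (t - t₀) / (6 * φ₄ * (2 * φ₂ * φ₄ - φ₃ ^ 2))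

/-- The form of `g` on every non-degenerate closed interval on which `θ` is constant, when
`φ₃ = 0`. -/
def ConstancyFormulasZero (φ₂ φ₄ : ℝ) (g : ℝ → Fin 4 → ℝ) (θ : ℝ → ℝ) : Prop :=
  ∀ a b : ℝ, a < b → (∀ t ∈ Icc a b, θ t = θ a) → ∀ t₀ ∈ Icc a b, ∀ t ∈ Icc a b,
    g t 0 = 0 ∧
    g t 1 = g t₀ 1 + (t - t₀) / φ₂ ∧
    g t 2 = g t₀ 2 ∧
    g t 3 = g t₀ 3 ∧ g t₀ 3 = (t₀ - φ₂ * g t₀ 1) / (3 * φ₄)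

/-- For the given `φ` and `θ₀` the angle of a normal extremal is not unique. -/
def AngleNotUnique (F : Seminorm ℝ (ℝ × ℝ)) (φ₁ φ₂ φ₃ φ₄ θ₀ : ℝ) : Prop :=
  ∃ (g g' : ℝ → Fin 4 → ℝ) (θ θ' : ℝ → ℝ),
    IsNormalExtremal F φ₁ φ₂ φ₃ φ₄ g θ ∧ IsNormalExtremal F φ₁ φ₂ φ₃ φ₄ g' θ' ∧
    θ 0 = θ₀ ∧ θ' 0 = θ₀ ∧ θ ≠ θ'

/-- For the given `φ` and `θ₀` and for every length `ℓ > 0` the angle of some normal extremal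
has a maximal interval of constancy of length `ℓ`, with the value `η` on it. -/
def HasConstancyIntervals (F : Seminorm ℝ (ℝ × ℝ)) (φ₁ φ₂ φ₃ φ₄ θ₀ η : ℝ) : Prop :=
  ∀ ℓ : ℝ, 0 < ℓ → ∃ (g : ℝ → Fin 4 → ℝ) (θ : ℝ → ℝ) (a b : ℝ),
    IsNormalExtremal F φ₁ φ₂ φ₃ φ₄ g θ ∧ θ 0 = θ₀ ∧ b - a = ℓ ∧
    (∀ t ∈ Icc a b, θ t = η) ∧ (∀ᶠ t in 𝓝[<] a, θ t ≠ η) ∧ (∀ᶠ t in 𝓝[>] b, θ t ≠ η)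

/-! ### The norm, its dual norm and the polar figure -/

section PlaneNorm

variable {F : Seminorm ℝ (ℝ × ℝ)}

/-! In left-invariant coordinates the adjoint equation is triangular: `h₄ = φ₄` is constant, `h₃ =
φ₃ + φ₄ x`, `ḣ₁ = -h₃ u₂`, `ḣ₂ = h₃ u₁`. After normalization the maximum condition says that `h =
(h₁, h₂)` runs on the boundary of the polar figure and that `u` supports the figure at `h`, `h · u =
1`. Hence `h₁ḣ₂ - h₂ḣ₁ = h₃`, that is `r²θ̇ = h₃`, while `h₃²/2 - φ₄h₂` is conserved. So `θ` is a
motion with one degree of freedom, `(r²θ̇)² = 2(E + φ₄h₂(θ))`, whose momentum `r²θ̇` has the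
derivative `φ₄u₁`. The formulas for `z` and `v` are two further first integrals
(`IsReducedExtremal.isGivenBy`). Conversely, the admissible values of `r'` parametrize exactly the
vectors of `U` that support the polar figure at `h(θ)` (`isRadiusDerivValue_of_support`,
`control_support`), and the covector is rebuilt from `h` and the trajectory
(`IsGivenBy.isNormalExtremal`).

The potential `-φ₄h₂` ranges over `[-|φ₄|F(0,1), |φ₄|F(0,1)]`, and the cases are the positions of
the energy relative to this interval. Above it the velocity never vanishes, and the change of
variable `ξ = θ(t)` gives the time as an integral of `1/√R`. At its lower end the velocity is
identically zero. Strictly inside, a turning point is neither a highest nor a lowest point of the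
polar figure, so `u₁` has a definite sign and is bounded away from zero near it: the momentum
crosses zero transversally (`exists_crossing_direction`). Hence turning points are reached in finite
time (`IsAngularMotion.exists_deriv_eq_zero`), the motion cannot rest there and is determined by its
initial data (`IsAngularMotion.eq_of_initial`). Comparison with the time-reversed motion gives the
symmetry about every zero of the velocity, and two such symmetries give the period.

At the upper end the zeros of `R` are angles with `|h₂| = F(0,1)`, where a vertical control is
admissible, so `θ` may rest there for any length of time. There every continuously differentiable
solution of `θ̇² = R(θ)` is the angle of an extremal (`exists_choice_of_deriv_sq`), and everything
depends on whether a zero of `R` can be reached or left in finite time. Convergence of the time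
integral allows pauses (`IsSpeedMotion.hasPauses`, `IsDeparture.hasPauses`); divergence forbids
arrival or departure. A motion that does not leave its initial rest is vertical, and a covector
supporting `U` in the direction `(0,1)` calibrates it, which makes it a metric straight line
(`abs_le_of_mem_horizontalLengths`). -/

theorem seminorm_plane_le (F : Seminorm ℝ (ℝ × ℝ)) (w : ℝ × ℝ) :
    F w ≤ (F (1, 0) + F (0, 1)) * ‖w‖ := by
  have h1 : w = w.1 • ((1 : ℝ), (0 : ℝ)) + w.2 • ((0 : ℝ), (1 : ℝ)) := by ext <;> simp
  calc F w = F (w.1 • ((1 : ℝ), (0 : ℝ)) + w.2 • ((0 : ℝ), (1 : ℝ))) := by rw [← h1]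
    _ ≤ F (w.1 • ((1 : ℝ), (0 : ℝ))) + F (w.2 • ((0 : ℝ), (1 : ℝ))) := map_add_le_add F _ _
    _ = ‖w.1‖ * F (1, 0) + ‖w.2‖ * F (0, 1) := by rw [map_smul_eq_mul, map_smul_eq_mul]
    _ ≤ ‖w‖ * F (1, 0) + ‖w‖ * F (0, 1) := by
        have := apply_nonneg F (1, 0)
        have := apply_nonneg F (0, 1)
        gcongr
        · exact norm_fst_le w
        · exact norm_snd_le w
    _ = _ := by ring

theorem continuous_seminorm_plane (F : Seminorm ℝ (ℝ × ℝ)) : Continuous F := by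
  have h0 : 0 ≤ F (1, 0) + F (0, 1) := add_nonneg (apply_nonneg _ _) (apply_nonneg _ _)
  refine (LipschitzWith.of_dist_le_mul (K := ⟨_, h0⟩) fun x y => ?_).continuous
  rw [dist_eq_norm, dist_eq_norm, Real.norm_eq_abs]
  exact (abs_sub_map_le_sub F x y).trans (seminorm_plane_le F _)

theorem exists_pos_mul_norm_le (hF : ∀ w, F w = 0 → w = 0) :
    ∃ c > 0, ∀ w : ℝ × ℝ, c * ‖w‖ ≤ F w := by
  obtain ⟨w₀, hw₀, hmin⟩ := (isCompact_sphere (0 : ℝ × ℝ) 1).exists_isMinOn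
    (NormedSpace.sphere_nonempty.2 zero_le_one) (continuous_seminorm_plane F).continuousOn
  have hw₀' : w₀ ≠ 0 := by
    rintro rfl
    simp at hw₀
  have hpos : 0 < F w₀ := lt_of_le_of_ne (apply_nonneg _ _) fun h => hw₀' (hF _ h.symm)
  refine ⟨F w₀, hpos, fun w => ?_⟩
  rcases eq_or_ne w 0 with rfl | hw
  · simp
  have hn : 0 < ‖w‖ := norm_pos_iff.2 hw
  have h1 : ‖w‖⁻¹ • w ∈ Metric.sphere (0 : ℝ × ℝ) 1 := by
    simp [norm_smul, hn.ne']
  have h2 := hmin h1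
  simp only [mem_ofPred_eq] at h2
  rw [map_smul_eq_mul, norm_inv, norm_norm] at h2
  calc F w₀ * ‖w‖ ≤ ‖w‖⁻¹ * F w * ‖w‖ := by gcongr
    _ = F w := by field_simp

theorem zero_mem_unitBallOf (F : Seminorm ℝ (ℝ × ℝ)) : (0 : ℝ × ℝ) ∈ unitBallOf F := by
  simp [unitBallOf]

theorem isCompact_unitBallOf (hF : ∀ w, F w = 0 → w = 0) : IsCompact (unitBallOf F) := by
  obtain ⟨c, hc, h⟩ := exists_pos_mul_norm_le hF
  refine Metric.isCompact_of_isClosed_isBounded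
    (isClosed_le (continuous_seminorm_plane F) continuous_const)
    ((Metric.isBounded_closedBall (x := (0 : ℝ × ℝ)) (r := c⁻¹)).subset fun w hw => ?_)
  have h1 : c * ‖w‖ ≤ 1 := (h w).trans hw
  rw [mem_closedBall_zero_iff, ← one_div, le_div_iff₀' hc]
  exact h1

theorem exists_norm_le_of_mem_unitBallOf (hF : ∀ w, F w = 0 → w = 0) :
    ∃ C > 0, ∀ w ∈ unitBallOf F, |w.1| ≤ C ∧ |w.2| ≤ C := by
  obtain ⟨c, hc, h⟩ := exists_pos_mul_norm_le hF
  refine ⟨c⁻¹, inv_pos.2 hc, fun w hw => ?_⟩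
  have h1 : c * ‖w‖ ≤ 1 := (h w).trans hw
  have h2 : ‖w‖ ≤ c⁻¹ := by rwa [← one_div, le_div_iff₀' hc]
  exact ⟨(norm_fst_le w).trans h2, (norm_snd_le w).trans h2⟩

theorem exists_supportNorm_eq (hF : ∀ w, F w = 0 → w = 0) (h : ℝ × ℝ) :
    ∃ w ∈ unitBallOf F, h.1 * w.1 + h.2 * w.2 = supportNorm F h := by
  obtain ⟨w, hw, he⟩ := ((isCompact_unitBallOf hF).image
    (f := fun w : ℝ × ℝ => h.1 * w.1 + h.2 * w.2) (by fun_prop)).sSup_mem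
    ⟨_, mem_image_of_mem _ (zero_mem_unitBallOf F)⟩
  exact ⟨w, hw, he⟩

theorem dot_le_supportNorm (hF : ∀ w, F w = 0 → w = 0) (h : ℝ × ℝ) {w : ℝ × ℝ}
    (hw : w ∈ unitBallOf F) : h.1 * w.1 + h.2 * w.2 ≤ supportNorm F h :=
  le_csSup ((isCompact_unitBallOf hF).image
    (f := fun w : ℝ × ℝ => h.1 * w.1 + h.2 * w.2) (by fun_prop)).bddAbove
    (mem_image_of_mem _ hw)

theorem supportNorm_le_iff (hF : ∀ w, F w = 0 → w = 0) {h : ℝ × ℝ} {c : ℝ} :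
    supportNorm F h ≤ c ↔ ∀ w ∈ unitBallOf F, h.1 * w.1 + h.2 * w.2 ≤ c := by
  refine ⟨fun hc w hw => (dot_le_supportNorm hF h hw).trans hc, fun hc => ?_⟩
  obtain ⟨w, hw, he⟩ := exists_supportNorm_eq hF h
  exact he ▸ hc w hw

theorem supportNorm_add_le (hF : ∀ w, F w = 0 → w = 0) (h k : ℝ × ℝ) :
    supportNorm F (h + k) ≤ supportNorm F h + supportNorm F k := by
  refine (supportNorm_le_iff hF).2 fun w hw => ?_
  have h1 := dot_le_supportNorm hF h hw
  have h2 := dot_le_supportNorm hF k hw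
  simp only [Prod.fst_add, Prod.snd_add]
  linarith

theorem supportNorm_smul (hF : ∀ w, F w = 0 → w = 0) {c : ℝ} (hc : 0 ≤ c) (h : ℝ × ℝ) :
    supportNorm F (c • h) = c * supportNorm F h := by
  refine le_antisymm ((supportNorm_le_iff hF).2 fun w hw => ?_) ?_
  · have h1 := mul_le_mul_of_nonneg_left (dot_le_supportNorm hF h hw) hc
    simp only [Prod.smul_fst, Prod.smul_snd, smul_eq_mul]
    linarith
  · obtain ⟨w, hw, he⟩ := exists_supportNorm_eq hF h
    have h1 := dot_le_supportNorm hF (c • h) hw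
    simp only [Prod.smul_fst, Prod.smul_snd, smul_eq_mul] at h1
    rw [← he]
    linarith

theorem supportNorm_neg (hF : ∀ w, F w = 0 → w = 0) (h : ℝ × ℝ) :
    supportNorm F (-h) = supportNorm F h := by
  have key : ∀ k, supportNorm F (-k) ≤ supportNorm F k := fun k =>
    (supportNorm_le_iff hF).2 fun w hw => by
      have h1 := dot_le_supportNorm hF k (w := -w) (by simpa [unitBallOf] using hw)
      simp only [Prod.fst_neg, Prod.snd_neg] at h1 ⊢
      linarith
  exact le_antisymm (key h) (by simpa using key (-h))

theorem supportNorm_nonneg (hF : ∀ w, F w = 0 → w = 0) (h : ℝ × ℝ) : 0 ≤ supportNorm F h := by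
  simpa using dot_le_supportNorm hF h (zero_mem_unitBallOf F)

theorem dot_le_supportNorm_mul (hF : ∀ w, F w = 0 → w = 0) (h w : ℝ × ℝ) :
    h.1 * w.1 + h.2 * w.2 ≤ supportNorm F h * F w := by
  rcases eq_or_ne (F w) 0 with h0 | h0
  · obtain rfl := hF w h0
    simp
  have hp : 0 < F w := lt_of_le_of_ne (apply_nonneg _ _) h0.symm
  have h1 := dot_le_supportNorm hF h (w := (F w)⁻¹ • w) (by
    simp [unitBallOf, map_smul_eq_mul, abs_of_pos hp, h0])
  simp only [Prod.smul_fst, Prod.smul_snd, smul_eq_mul] at h1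
  have h2 := mul_le_mul_of_nonneg_right h1 hp.le
  have h3 : (h.1 * ((F w)⁻¹ * w.1) + h.2 * ((F w)⁻¹ * w.2)) * F w = h.1 * w.1 + h.2 * w.2 := by
    field_simp
  linarith

theorem supportNorm_pos (hF : ∀ w, F w = 0 → w = 0) {h : ℝ × ℝ} (hh : h ≠ 0) :
    0 < supportNorm F h := by
  have h1 := dot_le_supportNorm_mul hF h h
  have h2 : 0 < h.1 * h.1 + h.2 * h.2 := by
    rcases not_and_or.1 (mt Prod.ext_iff.2 hh) with h3 | h3
    · have := mul_self_pos.2 h3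
      nlinarith [mul_self_nonneg h.2]
    · have := mul_self_pos.2 h3
      nlinarith [mul_self_nonneg h.1]
  by_contra hc
  have : supportNorm F h = 0 := le_antisymm (not_lt.1 hc) (supportNorm_nonneg hF h)
  rw [this] at h1
  linarith

theorem lipschitz_supportNorm (hF : ∀ w, F w = 0 → w = 0) :
    ∃ K : NNReal, LipschitzWith K (supportNorm F) := by
  obtain ⟨C, hC, hU⟩ := exists_norm_le_of_mem_unitBallOf hF
  have hb : ∀ h : ℝ × ℝ, supportNorm F h ≤ 2 * C * ‖h‖ := fun h =>
    (supportNorm_le_iff hF).2 fun w hw => by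
      obtain ⟨h1, h2⟩ := hU w hw
      calc h.1 * w.1 + h.2 * w.2 ≤ |h.1| * |w.1| + |h.2| * |w.2| := by
            rw [← abs_mul, ← abs_mul]
            exact add_le_add (le_abs_self _) (le_abs_self _)
        _ ≤ ‖h‖ * C + ‖h‖ * C := by
            gcongr
            · exact norm_fst_le h
            · exact norm_snd_le h
        _ = 2 * C * ‖h‖ := by ring
  refine ⟨⟨2 * C, by positivity⟩, LipschitzWith.of_le_add_mul _ fun x y => ?_⟩
  have h1 := supportNorm_add_le hF y (x - y)
  rw [add_sub_cancel] at h1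
  rw [dist_eq_norm]
  exact h1.trans (add_le_add_right (hb _) _)

theorem continuous_supportNorm (hF : ∀ w, F w = 0 → w = 0) : Continuous (supportNorm F) :=
  (lipschitz_supportNorm hF).choose_spec.continuous

/-- Hahn–Banach: the functional `c • w₀ ↦ c F(w₀)` on a line is dominated by `F` and extends with
the same bound. Biduality of `F` and `supportNorm F`, the height of the polar figure and the lower
bound for lengths all come from here. -/
theorem exists_supporting_covector (hF : ∀ w, F w = 0 → w = 0) (w₀ : ℝ × ℝ) :
    ∃ h : ℝ × ℝ, supportNorm F h ≤ 1 ∧ h.1 * w₀.1 + h.2 * w₀.2 = F w₀ := by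
  suffices H : ∃ g : (ℝ × ℝ) →ₗ[ℝ] ℝ, g w₀ = F w₀ ∧ ∀ w, g w ≤ F w by
    obtain ⟨g, hg, hle⟩ := H
    have hgw : ∀ w : ℝ × ℝ, g w = g (1, 0) * w.1 + g (0, 1) * w.2 := fun w => by
      have h1 : w = w.1 • ((1 : ℝ), (0 : ℝ)) + w.2 • ((0 : ℝ), (1 : ℝ)) := by ext <;> simp
      calc g w = g (w.1 • ((1 : ℝ), (0 : ℝ)) + w.2 • ((0 : ℝ), (1 : ℝ))) := by rw [← h1]
        _ = _ := by rw [map_add, map_smul, map_smul, smul_eq_mul, smul_eq_mul]; ring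
    exact ⟨(g (1, 0), g (0, 1)), (supportNorm_le_iff hF).2 fun w hw => by
      rw [← hgw]; exact (hle w).trans hw, by rw [← hgw, hg]⟩
  rcases eq_or_ne w₀ 0 with rfl | h0
  · exact ⟨0, by simp, fun w => by simp⟩
  obtain ⟨g, hg, hle⟩ := exists_extension_of_le_sublinear
    (LinearPMap.mkSpanSingleton (K := ℝ) w₀ (F w₀) h0) F
    (fun c hc x => by rw [map_smul_eq_mul, Real.norm_of_nonneg hc.le])
    (fun x y => map_add_le_add F x y) (by
      rintro ⟨x, hx⟩
      obtain ⟨c, rfl⟩ := Submodule.mem_span_singleton.1 hx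
      rw [LinearPMap.mkSpanSingleton'_apply, map_smul_eq_mul, RingHom.id_apply, smul_eq_mul]
      exact mul_le_mul_of_nonneg_right (le_abs_self c) (apply_nonneg _ _))
  exact ⟨g, (hg ⟨w₀, Submodule.mem_span_singleton_self w₀⟩).trans
    (LinearPMap.mkSpanSingleton_apply ℝ ℝ h0 (F w₀)), hle⟩

/-- The bipolar theorem for `U`. It is what certifies that the vectors built from `r'` are
admissible controls. -/
theorem mem_unitBallOf_of_forall_dot_le (hF : ∀ w, F w = 0 → w = 0) {u : ℝ × ℝ}
    (hu : ∀ h : ℝ × ℝ, h.1 * u.1 + h.2 * u.2 ≤ supportNorm F h) : u ∈ unitBallOf F := by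
  obtain ⟨h, h1, h2⟩ := exists_supporting_covector hF u
  change F u ≤ 1
  rw [← h2]
  exact (hu h).trans h1

theorem seminorm_vertical_pos (hF : ∀ w, F w = 0 → w = 0) : 0 < F (0, 1) :=
  lt_of_le_of_ne (apply_nonneg _ _) fun h => by simpa using hF _ h.symm

theorem abs_snd_le_of_mem_polarFigure (hF : ∀ w, F w = 0 → w = 0) {h : ℝ × ℝ}
    (hh : h ∈ polarFigure F) : |h.2| ≤ F (0, 1) := by
  have key : ∀ k ∈ polarFigure F, k.2 ≤ F (0, 1) := fun k hk => by
    have h1 := dot_le_supportNorm_mul hF k (0, 1)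
    have h2 := mul_le_mul_of_nonneg_right hk (apply_nonneg F (0, 1))
    simp only [mul_zero, mul_one, zero_add] at h1
    linarith
  refine abs_le.2 ⟨?_, key h hh⟩
  have h3 := key (-h) (by simpa [polarFigure, supportNorm_neg hF] using hh)
  simp only [Prod.snd_neg] at h3
  linarith

theorem exists_mem_polarFigure_top (hF : ∀ w, F w = 0 → w = 0) :
    ∃ a : ℝ, (a, F (0, 1)) ∈ polarFigure F := by
  obtain ⟨h, h1, h2⟩ := exists_supporting_covector hF (0, 1)
  simp only [mul_zero, mul_one, zero_add] at h2
  exact ⟨h.1, by rw [← h2]; exact h1⟩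

/-- The polar figure is centrally symmetric, so both extreme values of `-φ₄h₂` are attained, at a
highest point and at its opposite. -/
theorem abs_mul_mem_image (hF : ∀ w, F w = 0 → w = 0) (φ₄ : ℝ) {s : ℝ} (hs : |s| = |φ₄|) :
    s * F (0, 1) ∈ (fun h : ℝ × ℝ => -φ₄ * h.2) '' polarFigure F := by
  obtain ⟨a, ha⟩ := exists_mem_polarFigure_top hF
  rcases abs_eq_abs.1 hs with rfl | rfl
  · refine ⟨-(a, F (0, 1)), ?_, ?_⟩
    · simpa only [polarFigure, mem_ofPred_eq, supportNorm_neg hF] using ha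
    · simp
  · exact ⟨(a, F (0, 1)), ha, by simp⟩

theorem abs_neg_mul_snd_le (hF : ∀ w, F w = 0 → w = 0) (φ₄ : ℝ) {h : ℝ × ℝ}
    (hh : h ∈ polarFigure F) : |-φ₄ * h.2| ≤ |φ₄| * F (0, 1) := by
  rw [abs_mul, abs_neg]
  exact mul_le_mul_of_nonneg_left (abs_snd_le_of_mem_polarFigure hF hh) (abs_nonneg _)

theorem energyMax_eq (hF : ∀ w, F w = 0 → w = 0) (φ₄ : ℝ) :
    energyMax F φ₄ = |φ₄| * F (0, 1) := by
  refine IsGreatest.csSup_eq ⟨abs_mul_mem_image hF φ₄ (abs_abs _), ?_⟩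
  rintro _ ⟨h, hh, rfl⟩
  exact (abs_le.1 (abs_neg_mul_snd_le hF φ₄ hh)).2

theorem energyMin_eq (hF : ∀ w, F w = 0 → w = 0) (φ₄ : ℝ) :
    energyMin F φ₄ = -(|φ₄| * F (0, 1)) := by
  refine IsLeast.csInf_eq ⟨?_, ?_⟩
  · rw [← neg_mul]
    exact abs_mul_mem_image hF φ₄ (by rw [abs_neg, abs_abs])
  · rintro _ ⟨h, hh, rfl⟩
    exact (abs_le.1 (abs_neg_mul_snd_le hF φ₄ hh)).1

/-- If `u` supports the polar figure at `h`, then the sign of `u₁` is that of `h₁ - (a / m) h₂`,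
where `(a, m)` is a highest point of the polar figure. -/
theorem one_sub_abs_div_le (hF : ∀ w, F w = 0 → w = 0) {a : ℝ}
    (ha : (a, F (0, 1)) ∈ polarFigure F) {h u : ℝ × ℝ} (hu : u ∈ unitBallOf F)
    (hhu : h.1 * u.1 + h.2 * u.2 = 1) :
    1 - |h.2| / F (0, 1) ≤ (h.1 - a / F (0, 1) * h.2) * u.1 := by
  have hm := seminorm_vertical_pos hF
  have h1 : a * u.1 + F (0, 1) * u.2 ≤ 1 := (dot_le_supportNorm hF (a, F (0, 1)) hu).trans ha
  have h2 : -(a * u.1 + F (0, 1) * u.2) ≤ 1 := by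
    have := (dot_le_supportNorm hF (-(a, F (0, 1))) hu).trans ((supportNorm_neg hF _).le.trans ha)
    simp only [Prod.fst_neg, Prod.snd_neg] at this
    linarith
  -- Write `h = (h₂/m)(a, m) + (h₁ - (a/m)h₂, 0)` with `m = F(0,1)`. The pairing of `u` with the
  -- first summand is at most `|h₂|/m`, because both `±(a, m)` lie in the polar figure; the rest of
  -- `h · u = 1` falls to the second.
  have h3 : h.2 / F (0, 1) * (a * u.1 + F (0, 1) * u.2) ≤ |h.2| / F (0, 1) := by
    calc h.2 / F (0, 1) * (a * u.1 + F (0, 1) * u.2)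
        ≤ |h.2 / F (0, 1)| * |a * u.1 + F (0, 1) * u.2| := by
          rw [← abs_mul]; exact le_abs_self _
      _ ≤ |h.2 / F (0, 1)| * 1 := by
          gcongr
          exact abs_le.2 ⟨by linarith, h1⟩
      _ = |h.2| / F (0, 1) := by rw [mul_one, abs_div, abs_of_pos hm]
  have h4 : h.2 / F (0, 1) * (a * u.1 + F (0, 1) * u.2) =
      a / F (0, 1) * h.2 * u.1 + h.2 * u.2 := by field_simp
  rw [h4] at h3
  linarith [sub_mul h.1 (a / F (0, 1) * h.2) u.1]

end PlaneNorm

/-! ### The polar curve -/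

section PolarCurve

variable {F : Seminorm ℝ (ℝ × ℝ)}

theorem cos_sin_ne_zero (θ : ℝ) : (Real.cos θ, Real.sin θ) ≠ ((0 : ℝ × ℝ)) := fun h => by
  have h1 : Real.cos θ = 0 := congrArg Prod.fst h
  have h2 : Real.sin θ = 0 := congrArg Prod.snd h
  have := Real.sin_sq_add_cos_sq θ
  rw [h1, h2] at this
  norm_num at this

theorem supportNorm_cos_sin_pos (hF : ∀ w, F w = 0 → w = 0) (θ : ℝ) :
    0 < supportNorm F (Real.cos θ, Real.sin θ) :=
  supportNorm_pos hF (cos_sin_ne_zero θ)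

theorem polarRadius_pos (hF : ∀ w, F w = 0 → w = 0) (θ : ℝ) : 0 < polarRadius F θ :=
  inv_pos.2 (supportNorm_cos_sin_pos hF θ)

theorem polarRadius_add_pi (hF : ∀ w, F w = 0 → w = 0) (θ : ℝ) :
    polarRadius F (θ + Real.pi) = polarRadius F θ := by
  have : (Real.cos (θ + Real.pi), Real.sin (θ + Real.pi)) = -(Real.cos θ, Real.sin θ) := by
    ext <;> simp
  rw [polarRadius, this, supportNorm_neg hF, polarRadius]

theorem polarH2_add_pi (hF : ∀ w, F w = 0 → w = 0) (θ : ℝ) :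
    polarH2 F (θ + Real.pi) = -polarH2 F θ := by
  rw [polarH2, polarRadius_add_pi hF, Real.sin_add_pi, polarH2, mul_neg]

theorem polarRadius_periodic (F : Seminorm ℝ (ℝ × ℝ)) :
    Function.Periodic (polarRadius F) (2 * Real.pi) := fun θ => by
  rw [polarRadius, Real.cos_add_two_pi, Real.sin_add_two_pi, polarRadius]

theorem polarH2_periodic (F : Seminorm ℝ (ℝ × ℝ)) :
    Function.Periodic (polarH2 F) (2 * Real.pi) := fun θ => by
  rw [polarH2, polarRadius_periodic, Real.sin_add_two_pi, polarH2]

theorem supportNorm_polar (hF : ∀ w, F w = 0 → w = 0) (θ : ℝ) :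
    supportNorm F (polarRadius F θ * Real.cos θ, polarRadius F θ * Real.sin θ) = 1 := by
  have h := supportNorm_smul hF (polarRadius_pos hF θ).le (Real.cos θ, Real.sin θ)
  simp only [Prod.smul_mk, smul_eq_mul] at h
  rw [h, polarRadius, inv_mul_cancel₀ (supportNorm_cos_sin_pos hF θ).ne']

theorem eq_polarRadius_of_supportNorm_eq_one (hF : ∀ w, F w = 0 → w = 0) {ρ θ : ℝ} (hρ : 0 ≤ ρ)
    (h : supportNorm F (ρ * Real.cos θ, ρ * Real.sin θ) = 1) : ρ = polarRadius F θ := by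
  have h1 := supportNorm_smul hF hρ (Real.cos θ, Real.sin θ)
  simp only [Prod.smul_mk, smul_eq_mul] at h1
  rw [polarRadius]
  exact eq_inv_of_mul_eq_one_left (h1.symm.trans h)

theorem polar_mem_polarFigure (hF : ∀ w, F w = 0 → w = 0) (θ : ℝ) :
    (polarRadius F θ * Real.cos θ, polarRadius F θ * Real.sin θ) ∈ polarFigure F :=
  (supportNorm_polar hF θ).le

theorem le_polarRadius (hF : ∀ w, F w = 0 → w = 0) {ρ θ : ℝ} (hρ : 0 ≤ ρ)
    (h : (ρ * Real.cos θ, ρ * Real.sin θ) ∈ polarFigure F) : ρ ≤ polarRadius F θ := by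
  have h1 := supportNorm_smul hF hρ (Real.cos θ, Real.sin θ)
  simp only [Prod.smul_mk, smul_eq_mul] at h1
  rw [polarFigure, mem_ofPred_eq, h1] at h
  rw [polarRadius, ← one_div, le_div_iff₀ (supportNorm_cos_sin_pos hF θ)]
  exact h

theorem abs_polarH2_le (hF : ∀ w, F w = 0 → w = 0) (θ : ℝ) : |polarH2 F θ| ≤ F (0, 1) :=
  abs_snd_le_of_mem_polarFigure hF (polar_mem_polarFigure hF θ)

/-- The radius is the inverse of a Lipschitz function that is bounded below on the circle by
compactness. The Lipschitz bound makes `r ∘ θ` absolutely continuous for every `C¹` angle `θ`,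
although `r` itself may have corners. -/
theorem lipschitz_polarRadius (hF : ∀ w, F w = 0 → w = 0) :
    ∃ K : NNReal, LipschitzWith K (polarRadius F) := by
  obtain ⟨K, hK⟩ := lipschitz_supportNorm hF
  obtain ⟨w, -, hw⟩ := isCompact_Icc.exists_isMinOn (s := Icc (0 : ℝ) (2 * Real.pi))
    (nonempty_Icc.2 (by positivity))
    (f := fun θ => supportNorm F (Real.cos θ, Real.sin θ))
    ((continuous_supportNorm hF).comp (by fun_prop)).continuousOn
  set c := supportNorm F (Real.cos w, Real.sin w) with hc
  have hcpos : 0 < c := supportNorm_cos_sin_pos hF w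
  have hlow : ∀ θ, c ≤ supportNorm F (Real.cos θ, Real.sin θ) := fun θ => by
    have hper : Function.Periodic (fun θ => supportNorm F (Real.cos θ, Real.sin θ))
        (2 * Real.pi) := fun θ => by simp only [Real.cos_add_two_pi, Real.sin_add_two_pi]
    obtain ⟨y, hy, he⟩ := hper.exists_mem_Ico₀ Real.two_pi_pos θ
    rw [show supportNorm F (Real.cos θ, Real.sin θ) =
      supportNorm F (Real.cos y, Real.sin y) from he]
    exact hw ⟨hy.1, hy.2.le⟩
  have hr : ∀ θ, polarRadius F θ ≤ c⁻¹ := fun θ => by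
    rw [polarRadius]
    exact inv_anti₀ hcpos (hlow θ)
  refine ⟨⟨c⁻¹ * c⁻¹ * K, by positivity⟩, LipschitzWith.of_dist_le_mul fun x y => ?_⟩
  have h1 := hK.dist_le_mul (Real.cos x, Real.sin x) (Real.cos y, Real.sin y)
  have h2 : dist ((Real.cos x, Real.sin x) : ℝ × ℝ) (Real.cos y, Real.sin y) ≤ dist x y := by
    rw [Prod.dist_eq]
    refine max_le ?_ ?_
    · simpa using Real.lipschitzWith_cos.dist_le_mul x y
    · simpa using Real.lipschitzWith_sin.dist_le_mul x y
  have hx := supportNorm_cos_sin_pos hF x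
  have hy := supportNorm_cos_sin_pos hF y
  have h3 : dist (polarRadius F x) (polarRadius F y) = polarRadius F x * polarRadius F y *
      dist (supportNorm F (Real.cos x, Real.sin x)) (supportNorm F (Real.cos y, Real.sin y)) := by
    rw [Real.dist_eq, Real.dist_eq, abs_sub_comm,
      ← abs_of_pos (mul_pos (polarRadius_pos hF x) (polarRadius_pos hF y)), ← abs_mul,
      abs_sub_comm, ← abs_neg]
    congr 1
    rw [polarRadius, polarRadius]
    field_simp
    ring
  rw [h3]
  calc _ ≤ c⁻¹ * c⁻¹ * (K * dist x y) := by
        have := (polarRadius_pos hF x).le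
        have := (polarRadius_pos hF y).le
        gcongr
        · exact hr x
        · exact hr y
        · exact h1.trans (mul_le_mul_of_nonneg_left h2 K.2)
    _ = _ := by
        change _ = c⁻¹ * c⁻¹ * (K : ℝ) * dist x y
        ring

theorem continuous_polarRadius (hF : ∀ w, F w = 0 → w = 0) : Continuous (polarRadius F) :=
  (lipschitz_polarRadius hF).choose_spec.continuous

theorem continuous_polarH2 (hF : ∀ w, F w = 0 → w = 0) : Continuous (polarH2 F) :=
  (continuous_polarRadius hF).mul Real.continuous_sin

/-- The dual norm on the tangent line of the unit circle at the angle `θ`. -/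
noncomputable def tangentSection (F : Seminorm ℝ (ℝ × ℝ)) (θ s : ℝ) : ℝ :=
  supportNorm F (Real.cos θ - s * Real.sin θ, Real.sin θ + s * Real.cos θ)

theorem convexOn_tangentSection (hF : ∀ w, F w = 0 → w = 0) (θ : ℝ) :
    ConvexOn ℝ univ (tangentSection F θ) := by
  refine ⟨convex_univ, fun x _ y _ a b ha hb hab => ?_⟩
  have h1 : (Real.cos θ - (a • x + b • y) * Real.sin θ,
      Real.sin θ + (a • x + b • y) * Real.cos θ) =
      a • (Real.cos θ - x * Real.sin θ, Real.sin θ + x * Real.cos θ) +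
      b • (Real.cos θ - y * Real.sin θ, Real.sin θ + y * Real.cos θ) := by
    obtain rfl : a = 1 - b := by linarith
    ext <;> simp <;> ring
  rw [tangentSection, h1]
  refine (supportNorm_add_le hF _ _).trans ?_
  rw [supportNorm_smul hF ha, supportNorm_smul hF hb]
  rfl

/-- Central projection of the circle onto its tangent line at `θ`, by homogeneity. It turns
questions about one-sided derivatives in the angle into questions about a convex function of one
variable. -/
theorem supportNorm_cos_sin_eq (hF : ∀ w, F w = 0 → w = 0) {θ ξ : ℝ}
    (h : 0 < Real.cos (ξ - θ)) :
    supportNorm F (Real.cos ξ, Real.sin ξ) =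
      Real.cos (ξ - θ) * tangentSection F θ (Real.tan (ξ - θ)) := by
  rw [tangentSection, ← supportNorm_smul hF h.le]
  congr 1
  have h1 : Real.cos (ξ - θ) * Real.tan (ξ - θ) = Real.sin (ξ - θ) := by
    rw [mul_comm, Real.tan_mul_cos h.ne']
  have h2 : ξ = (ξ - θ) + θ := by ring
  ext
  · simp only [Prod.smul_mk, smul_eq_mul, mul_sub, ← mul_assoc, h1]
    conv_lhs => rw [h2, Real.cos_add]
  · simp only [Prod.smul_mk, smul_eq_mul, mul_add, ← mul_assoc, h1]
    conv_lhs => rw [h2, Real.sin_add]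
    ring

/-- At zero `tan` has derivative 1 and `cos` has derivative 0, so the angular derivative equals that
of the tangent section. The condition relating `s` and `t` says that the projection respects the
side, so that one-sided derivatives are transported separately. -/
theorem hasDerivWithinAt_supportNorm_cos_sin (hF : ∀ w, F w = 0 → w = 0) {θ q : ℝ}
    {s t : Set ℝ} (hk : HasDerivWithinAt (tangentSection F θ) q s 0) (hst : ∀ ξ ∈ t,
      ξ ∈ Ioo (θ - Real.pi / 2) (θ + Real.pi / 2) → Real.tan (ξ - θ) ∈ s) :
    HasDerivWithinAt (fun ξ => supportNorm F (Real.cos ξ, Real.sin ξ)) q t θ := by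
  have hI : Ioo (θ - Real.pi / 2) (θ + Real.pi / 2) ∈ 𝓝 θ :=
    Ioo_mem_nhds (by linarith [Real.pi_pos]) (by linarith [Real.pi_pos])
  have hcos : ∀ ξ ∈ Ioo (θ - Real.pi / 2) (θ + Real.pi / 2), 0 < Real.cos (ξ - θ) :=
    fun ξ hξ => Real.cos_pos_of_mem_Ioo ⟨by linarith [hξ.1], by linarith [hξ.2]⟩
  rw [← hasDerivWithinAt_inter hI]
  have hsub : HasDerivAt (fun ξ : ℝ => ξ - θ) 1 θ := (hasDerivAt_id θ).sub_const θ
  have htan : HasDerivAt (fun ξ : ℝ => Real.tan (ξ - θ)) 1 θ := by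
    have h1 : HasDerivAt Real.tan (1 / Real.cos (θ - θ) ^ 2) (θ - θ) :=
      Real.hasDerivAt_tan (by simp)
    simpa [Function.comp_def] using HasDerivAt.comp (h := fun ξ : ℝ => ξ - θ) θ h1 hsub
  have hcos' : HasDerivAt (fun ξ : ℝ => Real.cos (ξ - θ)) 0 θ := by
    simpa [Function.comp_def] using
      HasDerivAt.comp (h := fun ξ : ℝ => ξ - θ) θ (Real.hasDerivAt_cos (θ - θ)) hsub
  have hk' : HasDerivWithinAt (tangentSection F θ) q s (Real.tan (θ - θ)) := by simpa using hk
  have h2 := hcos'.hasDerivWithinAt.mul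
    (hk'.comp θ (htan.hasDerivWithinAt (s := t ∩ Ioo (θ - Real.pi / 2) (θ + Real.pi / 2)))
      fun ξ hξ => hst ξ hξ.1 hξ.2)
  refine HasDerivWithinAt.congr_deriv (h2.congr (fun ξ hξ => ?_) ?_) (by simp)
  · exact supportNorm_cos_sin_eq hF (hcos ξ hξ.2)
  · exact supportNorm_cos_sin_eq hF (by simp)

theorem hasDerivWithinAt_polarRadius (hF : ∀ w, F w = 0 → w = 0) {θ q : ℝ} {t : Set ℝ}
    (h : HasDerivWithinAt (fun ξ => supportNorm F (Real.cos ξ, Real.sin ξ)) q t θ) :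
    HasDerivWithinAt (polarRadius F) (-(polarRadius F θ ^ 2 * q)) t θ := by
  refine (h.inv (supportNorm_cos_sin_pos hF θ).ne').congr_deriv ?_
  rw [polarRadius]
  field_simp

/-- The one-sided derivatives of the polar radius, and the subgradients of the dual norm. -/
theorem exists_oneSided_derivs (hF : ∀ w, F w = 0 → w = 0) (θ : ℝ) :
    ∃ p q : ℝ, HasDerivWithinAt (polarRadius F) (-(polarRadius F θ ^ 2 * p)) (Iic θ) θ ∧
      HasDerivWithinAt (polarRadius F) (-(polarRadius F θ ^ 2 * q)) (Ici θ) θ ∧ p ≤ q ∧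
      ∀ c, c ∈ Icc p q ↔
        ∀ s, tangentSection F θ 0 + c * s ≤ tangentSection F θ s := by
  have hc := convexOn_tangentSection hF θ
  have hi : (0 : ℝ) ∈ interior (univ : Set ℝ) := by simp
  have hL := hc.hasDerivWithinAt_leftDeriv_of_mem_interior hi
  have hR := hc.hasDerivWithinAt_rightDeriv_of_mem_interior hi
  refine ⟨_, _, hasDerivWithinAt_polarRadius hF
    (hasDerivWithinAt_supportNorm_cos_sin hF hL.Iic_of_Iio fun ξ h1 h2 => ?_),
    hasDerivWithinAt_polarRadius hF
    (hasDerivWithinAt_supportNorm_cos_sin hF hR.Ici_of_Ioi fun ξ h1 h2 => ?_),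
    hc.leftDeriv_le_rightDeriv_of_mem_interior hi, fun c => ⟨fun h s => ?_, fun h => ⟨?_, ?_⟩⟩⟩
  · exact Real.tan_nonpos_of_nonpos_of_neg_pi_div_two_le (sub_nonpos.2 h1)
      (by linarith [h2.1])
  · exact Real.tan_nonneg_of_nonneg_of_le_pi_div_two (sub_nonneg.2 h1) (by linarith [h2.2])
  · rcases lt_trichotomy s 0 with hs | rfl | hs
    · have h1 := (hc.slope_le_leftDeriv_of_mem_interior (mem_univ s) hi hs).trans h.1
      rw [slope_def_field, div_le_iff₀ (by linarith)] at h1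
      linarith
    · simp
    · have h1 := h.2.trans (hc.rightDeriv_le_slope_of_mem_interior hi (mem_univ s) hs)
      rw [slope_def_field, le_div_iff₀ (by linarith)] at h1
      linarith
  · refine le_of_tendsto ((hasDerivWithinAt_iff_tendsto_slope' self_notMem_Iio).1 hL) ?_
    filter_upwards [self_mem_nhdsWithin] with s hs
    rw [slope_def_field, div_le_iff_of_neg (by simpa using hs)]
    linarith [h s]
  · refine ge_of_tendsto ((hasDerivWithinAt_iff_tendsto_slope' self_notMem_Ioi).1 hR) ?_
    filter_upwards [self_mem_nhdsWithin] with s hs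
    rw [slope_def_field, le_div_iff₀ (by simpa using hs)]
    linarith [h s]

theorem tangentSection_zero (F : Seminorm ℝ (ℝ × ℝ)) (θ : ℝ) :
    tangentSection F θ 0 = (polarRadius F θ)⁻¹ := by
  simp [tangentSection, polarRadius]

/-- For a convex function the numbers between the one-sided derivatives are exactly the slopes of
the supporting lines; since `r` is the inverse of the dual norm on the circle, such a slope `c`
corresponds to `r' = -r²c`. -/
theorem isRadiusDerivValue_iff (hF : ∀ w, F w = 0 → w = 0) {θ c : ℝ} :
    IsRadiusDerivValue F θ (-(polarRadius F θ ^ 2 * c)) ↔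
      ∀ s, tangentSection F θ 0 + c * s ≤ tangentSection F θ s := by
  obtain ⟨p, q, hp, hq, hpq, H⟩ := exists_oneSided_derivs hF θ
  have hr : 0 < polarRadius F θ ^ 2 := pow_pos (polarRadius_pos hF θ) 2
  have key : -(polarRadius F θ ^ 2 * c) ∈
      uIcc (-(polarRadius F θ ^ 2 * p)) (-(polarRadius F θ ^ 2 * q)) ↔ c ∈ Icc p q := by
    rw [uIcc_of_ge (by gcongr), mem_Icc, mem_Icc, neg_le_neg_iff, neg_le_neg_iff,
      mul_le_mul_iff_right₀ hr, mul_le_mul_iff_right₀ hr, and_comm]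
  rw [← H c, ← key]
  refine ⟨?_, fun h => ⟨_, _, hp, hq, h⟩⟩
  rintro ⟨a, b, ha, hb, h⟩
  rwa [(uniqueDiffWithinAt_Iic θ).eq_deriv _ ha hp,
    (uniqueDiffWithinAt_Ici θ).eq_deriv _ hb hq] at h

theorem isRadiusDerivValue_derivWithin_Ici (hF : ∀ w, F w = 0 → w = 0) (θ : ℝ) :
    IsRadiusDerivValue F θ (derivWithin (polarRadius F) (Ici θ) θ) := by
  obtain ⟨p, q, hp, hq, -, -⟩ := exists_oneSided_derivs hF θ
  exact ⟨_, _, hp, hq, by rw [hq.derivWithin (uniqueDiffWithinAt_Ici θ)]; exact right_mem_uIcc⟩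

/-- A vector of `U` supporting the polar figure at `h(θ)` gives an admissible value of `r'`. -/
theorem isRadiusDerivValue_of_support (hF : ∀ w, F w = 0 → w = 0) {θ : ℝ} {u : ℝ × ℝ}
    (hu : u ∈ unitBallOf F)
    (h1 : polarRadius F θ * Real.cos θ * u.1 + polarRadius F θ * Real.sin θ * u.2 = 1) :
    IsRadiusDerivValue F θ (polarRadius F θ ^ 2 * (u.1 * Real.sin θ - u.2 * Real.cos θ)) ∧
      controlX F θ (polarRadius F θ ^ 2 * (u.1 * Real.sin θ - u.2 * Real.cos θ)) = u.1 ∧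
      controlY F θ (polarRadius F θ ^ 2 * (u.1 * Real.sin θ - u.2 * Real.cos θ)) = u.2 := by
  have hr := polarRadius_pos hF θ
  have hcs := Real.sin_sq_add_cos_sq θ
  refine ⟨?_, ?_, ?_⟩
  · have h2 : polarRadius F θ ^ 2 * (u.1 * Real.sin θ - u.2 * Real.cos θ) =
      -(polarRadius F θ ^ 2 * (u.2 * Real.cos θ - u.1 * Real.sin θ)) := by ring
    rw [h2, isRadiusDerivValue_iff hF]
    intro s
    -- On the tangent line the linear function given by `u` is affine with slope `u₂ cos θ - u₁ sin
    -- θ`; it lies below the dual norm and touches it at the point of tangency.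
    have h3 := dot_le_supportNorm hF
      (Real.cos θ - s * Real.sin θ, Real.sin θ + s * Real.cos θ) hu
    have h4 : (polarRadius F θ)⁻¹ = Real.cos θ * u.1 + Real.sin θ * u.2 := by
      field_simp
      linarith
    rw [tangentSection_zero, h4, tangentSection]
    simp only at h3
    linarith
  · rw [controlX]
    field_simp
    linear_combination (polarRadius F θ) * u.1 * hcs - Real.cos θ * h1
  · rw [controlY]
    field_simp
    linear_combination (polarRadius F θ) * u.2 * hcs - Real.sin θ * h1

/-- An admissible value of `r'` gives a vector of `U` supporting the polar figure at `h(θ)`. -/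
theorem control_support (hF : ∀ w, F w = 0 → w = 0) {θ ρ : ℝ} (hρ : IsRadiusDerivValue F θ ρ) :
    (controlX F θ ρ, controlY F θ ρ) ∈ unitBallOf F ∧
      polarRadius F θ * Real.cos θ * controlX F θ ρ +
        polarRadius F θ * Real.sin θ * controlY F θ ρ = 1 := by
  have hr := polarRadius_pos hF θ
  have hcs := Real.sin_sq_add_cos_sq θ
  set r := polarRadius F θ with hrdef
  -- In the frame rotated by `θ` the vector has the components `1/r` and `-ρ/r²`: the value of the
  -- tangent section at its base point, and the slope of a supporting line there.
  have hdot : Real.cos θ * controlX F θ ρ + Real.sin θ * controlY F θ ρ = r⁻¹ := by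
    rw [controlX, controlY, ← hrdef]
    field_simp
    linear_combination r * hcs
  have hdot' : -Real.sin θ * controlX F θ ρ + Real.cos θ * controlY F θ ρ = -(ρ / r ^ 2) := by
    rw [controlX, controlY, ← hrdef]
    field_simp
    linear_combination -ρ * hcs
  refine ⟨mem_unitBallOf_of_forall_dot_le hF fun w => ?_, ?_⟩
  · have h1 : ∀ s, r⁻¹ + -(ρ / r ^ 2) * s ≤ tangentSection F θ s := fun s => by
      rw [show r⁻¹ = tangentSection F θ 0 from (tangentSection_zero F θ).symm]
      refine (isRadiusDerivValue_iff hF).1 ?_ s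
      rw [← hrdef]
      convert hρ using 1
      field_simp
    set e : ℝ × ℝ := (Real.cos θ, Real.sin θ) with he
    set a := Real.cos θ * w.1 + Real.sin θ * w.2 with ha
    set b := -Real.sin θ * w.1 + Real.cos θ * w.2 with hb
    set c := w.1 * controlX F θ ρ + w.2 * controlY F θ ρ with hc
    have hcab : c = a * r⁻¹ + b * -(ρ / r ^ 2) := by
      rw [← hdot, ← hdot', hc, ha, hb]
      linear_combination (-(w.1 * controlX F θ ρ) - w.2 * controlY F θ ρ) * hcs
    -- The supporting inequality is known only for covectors that project to the tangent line, an
    -- open half-plane. A small step `e + ε w` from its base point `e` stays there for every `w`;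
    -- subadditivity removes `e`, and `ε` cancels.
    obtain ⟨ε, hε, hεa⟩ : ∃ ε : ℝ, 0 < ε ∧ 0 < 1 + ε * a := by
      refine ⟨(1 + |a|)⁻¹, by positivity, ?_⟩
      have h2 := neg_abs_le a
      have h3 : 0 < 1 + |a| := by positivity
      have : 1 + (1 + |a|)⁻¹ * a = (1 + |a| + a) * (1 + |a|)⁻¹ := by field_simp
      rw [this]
      exact mul_pos (by linarith) (by positivity)
    have h2 : e + ε • w = (1 + ε * a) • (Real.cos θ - ε * b / (1 + ε * a) * Real.sin θ,
        Real.sin θ + ε * b / (1 + ε * a) * Real.cos θ) := by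
      ext
      · simp only [he, Prod.fst_add, Prod.smul_fst, smul_eq_mul]
        field_simp
        rw [ha, hb]
        linear_combination (-ε * w.1) * hcs
      · simp only [he, Prod.snd_add, Prod.smul_snd, smul_eq_mul]
        field_simp
        rw [ha, hb]
        linear_combination (-ε * w.2) * hcs
    have h3 := supportNorm_add_le hF e (ε • w)
    rw [h2, supportNorm_smul hF hεa.le, supportNorm_smul hF hε.le] at h3
    have h4 := mul_le_mul_of_nonneg_left (h1 (ε * b / (1 + ε * a))) hεa.le
    have h5 : (1 + ε * a) * (r⁻¹ + -(ρ / r ^ 2) * (ε * b / (1 + ε * a))) = r⁻¹ + ε * c := by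
      rw [hcab]
      field_simp
      ring
    have h6 : supportNorm F e = r⁻¹ := by rw [hrdef, polarRadius, inv_inv]
    rw [h5] at h4
    rw [h6] at h3
    have h7 : ε * c ≤ ε * supportNorm F w := by
      have := h4.trans h3
      linarith
    exact le_of_mul_le_mul_left h7 hε
  · have := congrArg (r * ·) hdot
    simp only [mul_inv_cancel₀ hr.ne'] at this
    linarith

end PolarCurve

/-! ### Absolutely continuous functions on the line -/

section AbsolutelyContinuous

theorem absolutelyContinuousOnInterval_apply {ι : Type*} [Fintype ι] {g : ℝ → ι → ℝ} {a b : ℝ}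
    (h : AbsolutelyContinuousOnInterval g a b) (i : ι) :
    AbsolutelyContinuousOnInterval (fun t => g t i) a b :=
  squeeze_zero (fun _ => Finset.sum_nonneg fun _ _ => dist_nonneg)
    (fun _ => Finset.sum_le_sum fun _ _ => dist_le_pi_dist _ _ i) h

theorem absolutelyContinuousOnInterval_pi {ι : Type*} [Fintype ι] {g : ℝ → ι → ℝ} {a b : ℝ}
    (h : ∀ i, AbsolutelyContinuousOnInterval (fun t => g t i) a b) :
    AbsolutelyContinuousOnInterval g a b := by
  have h1 := tendsto_finsetSum Finset.univ fun i _ => h i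
  simp only [Finset.sum_const_zero] at h1
  refine squeeze_zero (fun _ => Finset.sum_nonneg fun _ _ => dist_nonneg) (fun E => ?_) h1
  rw [Finset.sum_comm]
  refine Finset.sum_le_sum fun k _ => ?_
  refine (dist_pi_le_iff (Finset.sum_nonneg fun _ _ => dist_nonneg)).2 fun i => ?_
  exact Finset.single_le_sum (f := fun i => dist (g (E.2 k).1 i) (g (E.2 k).2 i))
    (fun _ _ => dist_nonneg) (Finset.mem_univ i)

theorem continuous_of_forall_absolutelyContinuousOnInterval {f : ℝ → ℝ}
    (hf : ∀ a b, AbsolutelyContinuousOnInterval f a b) : Continuous f :=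
  continuous_iff_continuousAt.2 fun t =>
    (hf (t - 1) (t + 1)).continuousOn.continuousAt (by
      rw [uIcc_of_le (by linarith)]
      exact Icc_mem_nhds (by linarith) (by linarith))

/-- Every first integral of the system is obtained through this statement, since the equations hold
only almost everywhere. -/
theorem eq_of_ae_hasDerivAt_zero {f : ℝ → ℝ} (hf : ∀ a b, AbsolutelyContinuousOnInterval f a b)
    (h : ∀ᵐ t, HasDerivAt f 0 t) (s t : ℝ) : f s = f t := by
  obtain ⟨C, hC⟩ := (hf s t).const_of_ae_hasDerivAt_zero (h.mono fun _ hx _ => hx)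
  rw [hC s left_mem_uIcc, hC t right_mem_uIcc]

theorem sub_eq_integral_of_ae_hasDerivAt {f φ : ℝ → ℝ}
    (hf : ∀ a b, AbsolutelyContinuousOnInterval f a b) (h : ∀ᵐ t, HasDerivAt f (φ t) t)
    (a b : ℝ) : f b - f a = ∫ t in a..b, φ t := by
  rw [← (hf a b).integral_deriv_eq_sub]
  exact intervalIntegral.integral_congr_ae (h.mono fun t ht _ => ht.deriv)

theorem intervalIntegrable_of_abs_le {f : ℝ → ℝ} (hf : Measurable f) {C : ℝ}
    (hC : ∀ t, |f t| ≤ C) (a b : ℝ) : IntervalIntegrable f volume a b :=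
  (intervalIntegrable_const (c := C)).mono_fun hf.aestronglyMeasurable
    (Eventually.of_forall fun t => (hC t).trans (le_abs_self C))

end AbsolutelyContinuous

/-! ### From extremals to the explicit description -/

section Extremal

variable {F : Seminorm ℝ (ℝ × ℝ)} {φ₁ φ₂ φ₃ φ₄ : ℝ}

/-- The Hamiltonian system in the left-invariant coordinates `H₁ = ψ(X)`, `H₂ = ψ(Y)` of the
covector, normalized to `M = 1`. -/
structure IsReducedExtremal (F : Seminorm ℝ (ℝ × ℝ)) (φ₁ φ₂ φ₃ φ₄ : ℝ) (u : ℝ → ℝ × ℝ)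
    (g : ℝ → Fin 4 → ℝ) (H₁ H₂ : ℝ → ℝ) : Prop where
  measurable_control : Measurable u
  control_mem : ∀ t, u t ∈ unitBallOf F
  trajectory_ac : ∀ i a b, AbsolutelyContinuousOnInterval (fun t => g t i) a b
  initial : g 0 = 0
  hasDerivAt_x : ∀ᵐ t, HasDerivAt (fun t => g t 0) (u t).1 t
  hasDerivAt_y : ∀ᵐ t, HasDerivAt (fun t => g t 1) (u t).2 t
  hasDerivAt_z : ∀ᵐ t, HasDerivAt (fun t => g t 2)
    ((1 / 2) * (g t 0 * (u t).2 - g t 1 * (u t).1)) t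
  hasDerivAt_v : ∀ᵐ t, HasDerivAt (fun t => g t 3)
    (-(1 / 2) * (g t 2 + (1 / 6) * (g t 0 * g t 1)) * (u t).1
      + (1 / 12) * (g t 0) ^ 2 * (u t).2) t
  ac₁ : ∀ a b, AbsolutelyContinuousOnInterval H₁ a b
  ac₂ : ∀ a b, AbsolutelyContinuousOnInterval H₂ a b
  initial₁ : H₁ 0 = φ₁
  initial₂ : H₂ 0 = φ₂
  hasDerivAt₁ : ∀ᵐ t, HasDerivAt H₁ (-(φ₃ + φ₄ * g t 0) * (u t).2) t
  hasDerivAt₂ : ∀ᵐ t, HasDerivAt H₂ ((φ₃ + φ₄ * g t 0) * (u t).1) t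
  dot_eq : ∀ᵐ t, H₁ t * (u t).1 + H₂ t * (u t).2 = 1
  norm_eq : ∀ t, supportNorm F (H₁ t, H₂ t) = 1

theorem pmpHamiltonian_eq (p ψ : Fin 4 → ℝ) (w : ℝ × ℝ) :
    pmpHamiltonian p ψ w =
      (ψ 0 - (1 / 2) * (p 1 * ψ 2) - (1 / 2) * (p 2 * ψ 3) - (1 / 12) * (p 0 * p 1 * ψ 3)) * w.1 +
      (ψ 1 + (1 / 2) * (p 0 * ψ 2) + (1 / 12) * (p 0 * p 0 * ψ 3)) * w.2 := by
  simp only [pmpHamiltonian, leftDifferential_horizontalVector, Fin.sum_univ_four]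
  simp
  ring

theorem pmpHamiltonian_eq_dot (p ψ : Fin 4 → ℝ) (w : ℝ × ℝ) :
    pmpHamiltonian p ψ w =
      pmpHamiltonian p ψ (1, 0) * w.1 + pmpHamiltonian p ψ (0, 1) * w.2 := by
  simp only [pmpHamiltonian_eq]
  ring

/-- Passage to left-invariant coordinates. The last component of the covector is constant and the
third one is affine in `x`; together they make the coordinate `h₃` of the covector equal to `φ₃ + φ₄
x` after division by `M`. -/
theorem IsExtremal.isReducedExtremal (hF : ∀ w, F w = 0 → w = 0) {u : ℝ → ℝ × ℝ}
    {g ψ : ℝ → Fin 4 → ℝ} {M : ℝ} (h : IsExtremal F u g ψ M) (hM : 0 < M) (hg : g 0 = 0)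
    (hψ : ψ 0 = M • ![φ₁, φ₂, φ₃, φ₄]) :
    IsReducedExtremal F φ₁ φ₂ φ₃ φ₄ u g
      (fun t => pmpHamiltonian (g t) (ψ t) (1, 0) / M)
      (fun t => pmpHamiltonian (g t) (ψ t) (0, 1) / M) := by
  have hgac : ∀ i a b, AbsolutelyContinuousOnInterval (fun t => g t i) a b :=
    fun i a b => absolutelyContinuousOnInterval_apply (h.trajectory_ac a b) i
  have hψac : ∀ i a b, AbsolutelyContinuousOnInterval (fun t => ψ t i) a b :=
    fun i a b => absolutelyContinuousOnInterval_apply (h.covector_ac a b) i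
  have hgd : ∀ᵐ t, ∀ i, HasDerivAt (fun t => g t i)
      (leftDifferential (g t) (horizontalVector (u t)) i) t :=
    h.state_eq.mono fun t ht => hasDerivAt_pi.1 ht
  have hψd : ∀ᵐ t, ∀ i, HasDerivAt (fun t => ψ t i) (adjointField (g t) (ψ t) (u t) i) t :=
    h.adjoint_eq.mono fun t ht => hasDerivAt_pi.1 ht
  simp only [leftDifferential_horizontalVector] at hgd
  simp only [adjointField_eq] at hψd
  have hx : ∀ᵐ t, HasDerivAt (fun t => g t 0) (u t).1 t := hgd.mono fun t ht => ht 0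
  have hy : ∀ᵐ t, HasDerivAt (fun t => g t 1) (u t).2 t := hgd.mono fun t ht => ht 1
  have hz : ∀ᵐ t, HasDerivAt (fun t => g t 2)
    ((1 / 2) * (g t 0 * (u t).2 - g t 1 * (u t).1)) t := hgd.mono fun t ht => ht 2
  have hv : ∀ᵐ t, HasDerivAt (fun t => g t 3)
    (-(1 / 2) * (g t 2 + (1 / 6) * (g t 0 * g t 1)) * (u t).1
      + (1 / 12) * (g t 0) ^ 2 * (u t).2) t := hgd.mono fun t ht => ht 3
  have h3 : ∀ t, ψ t 3 = M * φ₄ := fun t => by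
    rw [eq_of_ae_hasDerivAt_zero (hψac 3) (hψd.mono fun t ht => ht 3) t 0, hψ]
    rfl
  have h2 : ∀ t, ψ t 2 = M * φ₃ + (1 / 2) * (M * φ₄) * g t 0 := fun t => by
    have h4 := eq_of_ae_hasDerivAt_zero (f := fun t => ψ t 2 - (1 / 2) * (M * φ₄) * g t 0)
      (fun a b => (hψac 2 a b).sub ((hgac 0 a b).const_mul _)) (by
        filter_upwards [hψd, hx] with t ht1 ht2
        refine ((ht1 2).sub (ht2.const_mul _)).congr_deriv ?_
        simp [h3]) t 0
    simp only [hψ, hg] at h4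
    simp at h4
    linarith
  have hsup : ∀ t, supportNorm F
      (pmpHamiltonian (g t) (ψ t) (1, 0), pmpHamiltonian (g t) (ψ t) (0, 1)) = M := by
    have hgc : ∀ i, Continuous fun t => g t i := fun i =>
      continuous_of_forall_absolutelyContinuousOnInterval (hgac i)
    have hψc : ∀ i, Continuous fun t => ψ t i := fun i =>
      continuous_of_forall_absolutelyContinuousOnInterval (hψac i)
    have hcont : Continuous fun t => supportNorm F
        (pmpHamiltonian (g t) (ψ t) (1, 0), pmpHamiltonian (g t) (ψ t) (0, 1)) := by
      refine (continuous_supportNorm hF).comp ?_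
      simp only [pmpHamiltonian_eq]
      have := hgc 0; have := hgc 1; have := hgc 2
      have := hψc 0; have := hψc 1; have := hψc 2; have := hψc 3
      fun_prop
    -- The maximum condition is given almost everywhere; both sides are continuous, so it extends to
    -- all times.
    refine congrFun ((hcont.ae_eq_iff_eq volume continuous_const).1 ?_)
    filter_upwards [h.maximum_eq] with t ht
    refine le_antisymm ((supportNorm_le_iff hF).2 fun w hw => ?_) ?_
    · rw [← pmpHamiltonian_eq_dot]
      exact ht.2 w hw
    · rw [← ht.1, pmpHamiltonian_eq_dot]
      exact dot_le_supportNorm hF (pmpHamiltonian (g t) (ψ t) (1, 0),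
        pmpHamiltonian (g t) (ψ t) (0, 1)) (h.control_mem t)
  have hM' := hM.ne'
  refine ⟨h.measurable_control, h.control_mem, hgac, hg, hx, hy, hz, hv, fun a b => ?_,
    fun a b => ?_, ?_, ?_, ?_, ?_, ?_, fun t => ?_⟩
  · simp only [pmpHamiltonian_eq, mul_one, mul_zero, add_zero, div_eq_inv_mul]
    exact (((((hψac 0 a b).sub (((hgac 1 a b).mul (hψac 2 a b)).const_mul _)).sub
      (((hgac 2 a b).mul (hψac 3 a b)).const_mul _))).sub
      ((((hgac 0 a b).mul (hgac 1 a b)).mul (hψac 3 a b)).const_mul _)).const_mul _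
  · simp only [pmpHamiltonian_eq, mul_one, mul_zero, zero_add, div_eq_inv_mul]
    exact (((hψac 1 a b).add (((hgac 0 a b).mul (hψac 2 a b)).const_mul _)).add
      ((((hgac 0 a b).mul (hgac 0 a b)).mul (hψac 3 a b)).const_mul _)).const_mul _
  · simp only [pmpHamiltonian_eq, hg, hψ]
    simp [hM']
  · simp only [pmpHamiltonian_eq, hg, hψ]
    simp [hM']
  · filter_upwards [hψd, hx, hy, hz] with t ht htx hty htz
    simp only [pmpHamiltonian_eq, mul_one, mul_zero, add_zero, h2, h3]
    have h0 : HasDerivAt (fun t => ψ t 0) _ t := ht 0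
    refine ((((h0.sub ((hty.mul ((htx.const_mul (1 / 2 * (M * φ₄))).const_add
      (M * φ₃))).const_mul _)).sub ((htz.mul_const (M * φ₄)).const_mul _)).sub
      (((htx.mul hty).mul_const (M * φ₄)).const_mul _)).div_const M).congr_deriv ?_
    simp [h2, h3]
    field_simp
    ring
  · filter_upwards [hψd, hx, hy, hz] with t ht htx hty htz
    simp only [pmpHamiltonian_eq, mul_one, mul_zero, zero_add, h2, h3]
    have h0 : HasDerivAt (fun t => ψ t 1) _ t := ht 1
    refine (((h0.add ((htx.mul ((htx.const_mul (1 / 2 * (M * φ₄))).const_add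
      (M * φ₃))).const_mul _)).add
      (((htx.mul htx).mul_const (M * φ₄)).const_mul _)).div_const M).congr_deriv ?_
    simp [h2, h3]
    field_simp
    ring
  · filter_upwards [h.maximum_eq] with t ht
    have h4 := ht.1
    rw [pmpHamiltonian_eq_dot] at h4
    field_simp
    exact h4
  · have h4 := supportNorm_smul hF (inv_pos.2 hM).le
      (pmpHamiltonian (g t) (ψ t) (1, 0), pmpHamiltonian (g t) (ψ t) (0, 1))
    rw [hsup, inv_mul_cancel₀ hM'] at h4
    simp only [Prod.smul_mk, smul_eq_mul, ← div_eq_inv_mul] at h4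
    exact h4

end Extremal

section ReducedExtremal

variable {F : Seminorm ℝ (ℝ × ℝ)} {φ₁ φ₂ φ₃ φ₄ : ℝ}

/-- Lift `h₁ + i h₂` through the covering `exp : ℂ → ℂ ∖ {0}`. The imaginary part of the lift is the
angle, and the modulus must be `r(θ)` by homogeneity of the dual norm. -/
theorem exists_continuous_polar_angle (hF : ∀ w, F w = 0 → w = 0) {H₁ H₂ : ℝ → ℝ}
    (h₁ : Continuous H₁) (h₂ : Continuous H₂) (hN : ∀ t, supportNorm F (H₁ t, H₂ t) = 1) :
    ∃ θ : ℝ → ℝ, Continuous θ ∧ ∀ t, H₁ t = polarRadius F (θ t) * Real.cos (θ t) ∧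
      H₂ t = polarRadius F (θ t) * Real.sin (θ t) := by
  have hne : ∀ t, (⟨H₁ t, H₂ t⟩ : ℂ) ≠ 0 := fun t h0 => by
    have h3 : H₁ t = 0 := congrArg Complex.re h0
    have h4 : H₂ t = 0 := congrArg Complex.im h0
    have h5 := hN t
    rw [h3, h4] at h5
    have h6 := supportNorm_smul hF le_rfl (0 : ℝ × ℝ)
    rw [zero_smul, zero_mul] at h6
    have h7 : ((0 : ℝ), (0 : ℝ)) = (0 : ℝ × ℝ) := rfl
    rw [h7, h6] at h5
    exact zero_ne_one h5
  have hcont : Continuous fun t => (⟨H₁ t, H₂ t⟩ : ℂ) := by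
    simp only [Complex.mk_eq_add_mul_I]
    fun_prop
  let f : C(ℝ, {z : ℂ // z ≠ 0}) := ⟨fun t => ⟨⟨H₁ t, H₂ t⟩, hne t⟩, by fun_prop⟩
  obtain ⟨L, ⟨-, hL⟩, -⟩ := Complex.isCoveringMap_exp.existsUnique_continuousMap_lifts f 0
    (Complex.log ⟨H₁ 0, H₂ 0⟩) (Subtype.ext (Complex.exp_log (hne 0)))
  have hexp : ∀ t, Complex.exp (L t) = ⟨H₁ t, H₂ t⟩ := fun t =>
    congrArg Subtype.val (congrFun hL t)
  have hre : ∀ t, H₁ t = Real.exp (L t).re * Real.cos (L t).im := fun t => by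
    rw [← Complex.exp_re, hexp]
  have him : ∀ t, H₂ t = Real.exp (L t).re * Real.sin (L t).im := fun t => by
    rw [← Complex.exp_im, hexp]
  refine ⟨fun t => (L t).im, by fun_prop, fun t => ?_⟩
  have h3 : Real.exp (L t).re = polarRadius F (L t).im :=
    eq_polarRadius_of_supportNorm_eq_one hF (Real.exp_pos _).le (by rw [← hre, ← him, hN])
  rw [← h3]
  exact ⟨hre t, him t⟩

variable {u : ℝ → ℝ × ℝ} {g : ℝ → Fin 4 → ℝ} {H₁ H₂ : ℝ → ℝ}

/-- The components of `h` are differentiable only almost everywhere, yet this product with `h(t)`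
frozen is differentiable at every `t`: its density `h₃(τ) h(t)·u(τ)` tends to `h₃(t)`, because
`h(τ)·u(τ) = 1` and `u` is bounded. -/
theorem IsReducedExtremal.hasDerivAt_cross (hF : ∀ w, F w = 0 → w = 0)
    (h : IsReducedExtremal F φ₁ φ₂ φ₃ φ₄ u g H₁ H₂) (t : ℝ) :
    HasDerivAt (fun s => H₁ t * H₂ s - H₂ t * H₁ s) (φ₃ + φ₄ * g t 0) t := by
  obtain ⟨C, hC, hU⟩ := exists_norm_le_of_mem_unitBallOf hF
  have hg0 := continuous_of_forall_absolutelyContinuousOnInterval (h.trajectory_ac 0)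
  have hc1 := continuous_of_forall_absolutelyContinuousOnInterval h.ac₁
  have hc2 := continuous_of_forall_absolutelyContinuousOnInterval h.ac₂
  have hu1 : Measurable fun τ => (u τ).1 := h.measurable_control.fst
  have hu2 : Measurable fun τ => (u τ).2 := h.measurable_control.snd
  set φ : ℝ → ℝ := fun τ => (φ₃ + φ₄ * g τ 0) * (H₁ t * (u τ).1 + H₂ t * (u τ).2) with hφ
  have hint : ∀ s, H₁ t * H₂ s - H₂ t * H₁ s = ∫ τ in t..s, φ τ := fun s => by
    rw [← sub_eq_integral_of_ae_hasDerivAt (f := fun s => H₁ t * H₂ s - H₂ t * H₁ s)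
      (fun a b => ((h.ac₂ a b).const_mul _).sub ((h.ac₁ a b).const_mul _))]
    · ring
    · filter_upwards [h.hasDerivAt₁, h.hasDerivAt₂] with s h1 h2
      refine ((h2.const_mul _).sub (h1.const_mul _)).congr_deriv ?_
      rw [hφ]
      ring
  have hmeas : Measurable φ :=
    (by fun_prop : Measurable fun τ => φ₃ + φ₄ * g τ 0).mul
      ((hu1.const_mul _).add (hu2.const_mul _))
  simp only [hint]
  refine intervalIntegral.integral_hasDerivAt_of_tendsto_ae_right (by simp)
    hmeas.stronglyMeasurable.stronglyMeasurableAtFilter ?_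
  -- The error made by replacing `h(τ)` with `h(t)` in `h(τ)·u(τ) = 1`.
  set e : ℝ → ℝ := fun τ => (H₁ t - H₁ τ) * (u τ).1 + (H₂ t - H₂ τ) * (u τ).2 with he
  have he0 : Tendsto e (𝓝 t) (𝓝 0) := by
    have h3 : Tendsto (fun τ => |H₁ t - H₁ τ| * C + |H₂ t - H₂ τ| * C) (𝓝 t) (𝓝 0) := by
      have : Continuous fun τ => |H₁ t - H₁ τ| * C + |H₂ t - H₂ τ| * C := by fun_prop
      simpa using this.tendsto t
    refine squeeze_zero_norm (fun τ => ?_) h3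
    obtain ⟨h4, h5⟩ := hU _ (h.control_mem τ)
    rw [Real.norm_eq_abs]
    refine (abs_add_le _ _).trans ?_
    rw [abs_mul, abs_mul]
    gcongr
  have h6 : Tendsto (fun τ => (φ₃ + φ₄ * g τ 0) * (1 + e τ)) (𝓝 t) (𝓝 (φ₃ + φ₄ * g t 0)) := by
    have h7 : Continuous fun τ => φ₃ + φ₄ * g τ 0 := by fun_prop
    simpa using (h7.tendsto t).mul (he0.const_add 1)
  refine (h6.mono_left inf_le_left).congr' ?_
  filter_upwards [mem_inf_of_right h.dot_eq] with τ hτ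
  rw [hφ, he]
  linear_combination -(φ₃ + φ₄ * g τ 0) * hτ

/-- The cross product equals `r(θ(t)) r(θ(s)) sin(θ(s) - θ(t))`. Dividing the difference quotient by
the radii needs only continuity of `r`, so corners of the polar curve do no harm, and `arcsin`
removes the sine. -/
theorem IsReducedExtremal.hasDerivAt_angle (hF : ∀ w, F w = 0 → w = 0)
    (h : IsReducedExtremal F φ₁ φ₂ φ₃ φ₄ u g H₁ H₂) {θ : ℝ → ℝ} (hθ : Continuous θ)
    (h₁ : ∀ t, H₁ t = polarRadius F (θ t) * Real.cos (θ t))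
    (h₂ : ∀ t, H₂ t = polarRadius F (θ t) * Real.sin (θ t)) (t : ℝ) :
    HasDerivAt θ ((φ₃ + φ₄ * g t 0) / polarRadius F (θ t) ^ 2) t := by
  have hr : ∀ s, 0 < polarRadius F (θ s) := fun s => polarRadius_pos hF _
  have hsin : HasDerivAt (fun s => Real.sin (θ s - θ t))
      ((φ₃ + φ₄ * g t 0) / polarRadius F (θ t) ^ 2) t := by
    have hcross := hasDerivAt_iff_tendsto_slope.1 (h.hasDerivAt_cross hF t)
    rw [hasDerivAt_iff_tendsto_slope]
    have hcont : Tendsto (fun s => (polarRadius F (θ t) * polarRadius F (θ s))⁻¹) (𝓝[≠] t)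
        (𝓝 (polarRadius F (θ t) * polarRadius F (θ t))⁻¹) := by
      have : Continuous fun s => polarRadius F (θ t) * polarRadius F (θ s) :=
        continuous_const.mul ((continuous_polarRadius hF).comp hθ)
      exact ((this.tendsto t).inv₀ (mul_pos (hr t) (hr t)).ne').mono_left nhdsWithin_le_nhds
    have h3 := hcross.mul hcont
    rw [pow_two, div_eq_mul_inv]
    refine h3.congr fun s => ?_
    have := (hr s).ne'
    have := (hr t).ne'
    simp only [slope_def_field, h₁, h₂, Real.sin_sub]
    field_simp
    ring
  have harc : HasDerivAt Real.arcsin 1 (Real.sin (θ t - θ t)) := by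
    simpa using Real.hasDerivAt_arcsin (x := 0) (by norm_num) (by norm_num)
  have h4 := (HasDerivAt.comp (h := fun s => Real.sin (θ s - θ t)) t harc hsin).const_add (θ t)
  rw [one_mul] at h4
  refine h4.congr_of_eventuallyEq ?_
  have h5 : ∀ᶠ s in 𝓝 t, θ s - θ t ∈ Ioo (-(Real.pi / 2)) (Real.pi / 2) := by
    refine (hθ.sub continuous_const).continuousAt.eventually_mem ?_
    simpa using Ioo_mem_nhds (neg_lt_zero.2 Real.pi_div_two_pos) Real.pi_div_two_pos
  filter_upwards [h5] with s hs
  simp only [Function.comp_apply]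
  rw [Real.arcsin_sin hs.1.le hs.2.le]
  ring

theorem IsReducedExtremal.isGivenBy (hF : ∀ w, F w = 0 → w = 0) (hφ₄ : φ₄ ≠ 0)
    (h : IsReducedExtremal F φ₁ φ₂ φ₃ φ₄ u g H₁ H₂) {θ : ℝ → ℝ} (hθ : Continuous θ)
    (h₁ : ∀ t, H₁ t = polarRadius F (θ t) * Real.cos (θ t))
    (h₂ : ∀ t, H₂ t = polarRadius F (θ t) * Real.sin (θ t)) :
    ∃ ρ, IsGivenBy F φ₁ φ₂ φ₃ φ₄ g θ ρ := by
  have hr : ∀ s, 0 < polarRadius F (θ s) := fun s => polarRadius_pos hF _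
  have hd := h.hasDerivAt_angle hF hθ h₁ h₂
  have hg0 := continuous_of_forall_absolutelyContinuousOnInterval (h.trajectory_ac 0)
  have hc1 := continuous_of_forall_absolutelyContinuousOnInterval h.ac₁
  have hc2 := continuous_of_forall_absolutelyContinuousOnInterval h.ac₂
  have hrc : Continuous fun t => polarRadius F (θ t) := (continuous_polarRadius hF).comp hθ
  have hu1 : Measurable fun τ => (u τ).1 := h.measurable_control.fst
  have hu2 : Measurable fun τ => (u τ).2 := h.measurable_control.snd
  have hgi : ∀ i, g 0 i = 0 := fun i => by rw [h.initial]; rfl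
  have hdeq : ∀ t, deriv θ t = (φ₃ + φ₄ * g t 0) / polarRadius F (θ t) ^ 2 := fun t =>
    (hd t).deriv
  -- Both `ḣ₂ = h₃u₁` and `ẋ = u₁`, so `h₂` is a quadratic polynomial in `x`; this is conservation
  -- of the Casimir energy.
  have hH₂ : ∀ t, H₂ t = φ₂ + φ₃ * g t 0 + (1 / 2) * φ₄ * (g t 0 * g t 0) := fun t => by
    have h3 := eq_of_ae_hasDerivAt_zero
      (f := fun t => H₂ t - φ₃ * g t 0 - (1 / 2) * φ₄ * (g t 0 * g t 0))
      (fun a b => ((h.ac₂ a b).sub ((h.trajectory_ac 0 a b).const_mul _)).sub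
        (((h.trajectory_ac 0 a b).mul (h.trajectory_ac 0 a b)).const_mul _)) (by
        filter_upwards [h.hasDerivAt₂, h.hasDerivAt_x] with t ht hx
        refine ((ht.sub (hx.const_mul _)).sub ((hx.mul hx).const_mul _)).congr_deriv ?_
        ring) t 0
    simp only [hgi, h.initial₂] at h3
    linarith
  have hz : ∀ t, φ₄ * g t 2 = -(H₁ t - φ₁ + (φ₃ + (1 / 2) * φ₄ * g t 0) * g t 1) := fun t => by
    have h3 := eq_of_ae_hasDerivAt_zero
      (f := fun t => φ₄ * g t 2 + H₁ t + φ₃ * g t 1 + (1 / 2) * φ₄ * (g t 0 * g t 1))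
      (fun a b => ((((h.trajectory_ac 2 a b).const_mul _).add (h.ac₁ a b)).add
        ((h.trajectory_ac 1 a b).const_mul _)).add
        (((h.trajectory_ac 0 a b).mul (h.trajectory_ac 1 a b)).const_mul _)) (by
        filter_upwards [h.hasDerivAt₁, h.hasDerivAt_x, h.hasDerivAt_y, h.hasDerivAt_z]
          with t ht hx hy hz
        refine ((((hz.const_mul _).add ht).add (hy.const_mul _)).add
          ((hx.mul hy).const_mul _)).congr_deriv ?_
        ring) t 0
    simp only [hgi, h.initial₁] at h3
    linarith
  -- The time enters this first integral through `h · u = 1`; the previous two integrals eliminate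
  -- `h₁` and `h₂`.
  have hv : ∀ t, 3 * φ₄ * g t 3 = t - φ₁ * g t 0 - φ₂ * g t 1
      - (2 * φ₃ + (1 / 2) * φ₄ * g t 0) * g t 2 := fun t => by
    have h3 := eq_of_ae_hasDerivAt_zero
      (f := fun t => 3 * φ₄ * g t 3 - t + φ₁ * g t 0 + φ₂ * g t 1 + 2 * φ₃ * g t 2
        + (1 / 2) * φ₄ * (g t 0 * g t 2))
      (fun a b => (((((h.trajectory_ac 3 a b).const_mul _).sub
        (contDiff_id.contDiffOn.absolutelyContinuousOnInterval)).add
        ((h.trajectory_ac 0 a b).const_mul _)).add ((h.trajectory_ac 1 a b).const_mul _)).add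
        ((h.trajectory_ac 2 a b).const_mul _) |>.add
        (((h.trajectory_ac 0 a b).mul (h.trajectory_ac 2 a b)).const_mul _)) (by
        filter_upwards [h.dot_eq, h.hasDerivAt_x, h.hasDerivAt_y, h.hasDerivAt_z,
          h.hasDerivAt_v] with t ht hx hy hz' hv
        refine ((((((hv.const_mul _).sub (hasDerivAt_id t)).add (hx.const_mul _)).add
          (hy.const_mul _)).add (hz'.const_mul _)).add ((hx.mul hz').const_mul _)).congr_deriv ?_
        linear_combination ht - (u t).2 * hH₂ t - (u t).1 * hz t) t 0
    simp only [hgi] at h3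
    linarith
  -- The support condition may fail on a null set of times. There `ρ` is replaced by the right
  -- derivative of the radius, which is measurable and always admissible, and the integrals do not
  -- change.
  let good : Set ℝ := {t | H₁ t * (u t).1 + H₂ t * (u t).2 = 1}
  have hgood : MeasurableSet good :=
    measurableSet_eq_fun ((hc1.measurable.mul hu1).add (hc2.measurable.mul hu2)) measurable_const
  classical
  let ρ : ℝ → ℝ := good.piecewise
    (fun t => polarRadius F (θ t) ^ 2 * ((u t).1 * Real.sin (θ t) - (u t).2 * Real.cos (θ t)))
    (fun t => derivWithin (polarRadius F) (Ici (θ t)) (θ t))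
  have hρ : ∀ t ∈ good, ρ t =
      polarRadius F (θ t) ^ 2 * ((u t).1 * Real.sin (θ t) - (u t).2 * Real.cos (θ t)) :=
    fun t ht => piecewise_eq_of_mem _ _ _ ht
  have hsupp : ∀ t ∈ good, IsRadiusDerivValue F (θ t) (ρ t) ∧
      controlX F (θ t) (ρ t) = (u t).1 ∧ controlY F (θ t) (ρ t) = (u t).2 := fun t ht => by
    rw [hρ t ht]
    refine isRadiusDerivValue_of_support hF (h.control_mem t) ?_
    rw [← h₁, ← h₂]
    exact ht
  refine ⟨ρ, ?_, ?_, ?_, ?_, fun t => ?_, fun t => ?_, fun t => ?_, fun t => ?_, fun t => ?_,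
    fun t => ?_, fun t => ?_⟩
  · refine contDiff_one_iff_deriv.2 ⟨fun t => (hd t).differentiableAt, ?_⟩
    rw [funext hdeq]
    exact (by fun_prop : Continuous fun t => φ₃ + φ₄ * g t 0).div (hrc.pow 2)
      fun t => (pow_pos (hr t) 2).ne'
  · rw [← h₁, h.initial₁]
  · rw [← h₂, h.initial₂]
  · refine Measurable.piecewise hgood ?_ ?_
    · exact (hrc.measurable.pow_const 2).mul ((hu1.mul (Real.measurable_sin.comp hθ.measurable)).sub
        (hu2.mul (Real.measurable_cos.comp hθ.measurable)))
    · exact (measurable_derivWithin_Ici (polarRadius F)).comp hθ.measurable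
  · by_cases ht : t ∈ good
    · exact (hsupp t ht).1
    · have : ρ t = derivWithin (polarRadius F) (Ici (θ t)) (θ t) :=
        piecewise_eq_of_notMem _ _ _ ht
      rw [this]
      exact isRadiusDerivValue_derivWithin_Ici hF _
  · rw [hdeq]
    field_simp [(hr t).ne']
  · have h3 := hH₂ t
    rw [h₂] at h3
    rw [hdeq, angularSpeedSq, h3, div_pow, ← pow_mul]
    congr 1
    ring
  · have h3 := sub_eq_integral_of_ae_hasDerivAt (h.trajectory_ac 0) h.hasDerivAt_x 0 t
    rw [hgi, sub_zero] at h3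
    rw [h3]
    exact intervalIntegral.integral_congr_ae (h.dot_eq.mono fun τ hτ _ => (hsupp τ hτ).2.1.symm)
  · have h3 := sub_eq_integral_of_ae_hasDerivAt (h.trajectory_ac 1) h.hasDerivAt_y 0 t
    rw [hgi, sub_zero] at h3
    rw [h3]
    exact intervalIntegral.integral_congr_ae (h.dot_eq.mono fun τ hτ _ => (hsupp τ hτ).2.2.symm)
  · rw [← h₁]
    field_simp
    linear_combination 2 * hz t
  · field_simp
    linear_combination 2 * hv t

theorem IsNormalExtremal.exists_isGivenBy (hF : ∀ w, F w = 0 → w = 0) (hφ₄ : φ₄ ≠ 0)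
    {θ : ℝ → ℝ} (h : IsNormalExtremal F φ₁ φ₂ φ₃ φ₄ g θ) :
    ∃ ρ, IsGivenBy F φ₁ φ₂ φ₃ φ₄ g θ ρ := by
  obtain ⟨u, ψ, M, hE, hM, hg, hψ, hθ, hθ'⟩ := h
  exact (hE.isReducedExtremal hF hM hg hψ).isGivenBy hF hφ₄ hθ (fun t => (hθ' t).1)
    fun t => (hθ' t).2

theorem IsExtremal.exists_isPolarAngle (hF : ∀ w, F w = 0 → w = 0) {ψ : ℝ → Fin 4 → ℝ} {M : ℝ}
    (h : IsExtremal F u g ψ M) (hM : 0 < M) (hg : g 0 = 0)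
    (hψ : ψ 0 = M • ![φ₁, φ₂, φ₃, φ₄]) : ∃ θ, IsPolarAngle F g ψ M θ := by
  have h1 := h.isReducedExtremal hF hM hg hψ
  exact exists_continuous_polar_angle hF
    (continuous_of_forall_absolutelyContinuousOnInterval h1.ac₁)
    (continuous_of_forall_absolutelyContinuousOnInterval h1.ac₂) h1.norm_eq

end ReducedExtremal

/-! ### From the explicit description to extremals -/

section AbsolutelyContinuous

theorem LipschitzWith.absolutelyContinuousOnInterval_comp {K : NNReal} {f θ : ℝ → ℝ}
    (hf : LipschitzWith K f) (hθ : ContDiff ℝ 1 θ) (a b : ℝ) :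
    AbsolutelyContinuousOnInterval (fun t => f (θ t)) a b := by
  obtain ⟨C, hC⟩ := hθ.contDiffOn.exists_lipschitzOnWith one_ne_zero (convex_uIcc a b)
    isCompact_uIcc
  exact (hf.comp_lipschitzOnWith hC).absolutelyContinuousOnInterval

theorem ae_differentiableAt_of_forall_absolutelyContinuousOnInterval {f : ℝ → ℝ}
    (hf : ∀ a b, AbsolutelyContinuousOnInterval f a b) : ∀ᵐ t, DifferentiableAt ℝ f t := by
  have h1 : ∀ᵐ t, ∀ n : ℕ, t ∈ uIcc (-(n : ℝ)) n → DifferentiableAt ℝ f t :=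
    ae_all_iff.2 fun n => (hf (-(n : ℝ)) n).ae_differentiableAt
  filter_upwards [h1] with t ht
  obtain ⟨n, hn⟩ := exists_nat_ge |t|
  refine ht n ?_
  rw [uIcc_of_le (by linarith [abs_nonneg t])]
  exact abs_le.1 hn

theorem ae_hasDerivAt_integral_of_abs_le {f : ℝ → ℝ} (hf : Measurable f) {C : ℝ}
    (hC : ∀ t, |f t| ≤ C) : ∀ᵐ t, HasDerivAt (fun t => ∫ τ in (0 : ℝ)..t, f τ) (f t) t :=
  have h : LocallyIntegrable f volume := (locallyIntegrable_const C).mono hf.aestronglyMeasurable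
    (Eventually.of_forall fun t => (hC t).trans (le_abs_self C))
  (_root_.LocallyIntegrable.ae_hasDerivAt_integral h).mono fun _ ht => ht 0

theorem absolutelyContinuousOnInterval_integral_of_abs_le {f : ℝ → ℝ} (hf : Measurable f) {C : ℝ}
    (hC : ∀ t, |f t| ≤ C) (a b : ℝ) :
    AbsolutelyContinuousOnInterval (fun t => ∫ τ in (0 : ℝ)..t, f τ) a b := by
  have h0 : uIcc (min (min a b) 0) (max (max a b) 0) = Icc (min (min a b) 0) (max (max a b) 0) :=
    uIcc_of_le ((min_le_right _ _).trans (le_max_right _ _))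
  have h1 := (intervalIntegrable_of_abs_le hf hC (min (min a b) 0)
    (max (max a b) 0)).absolutelyContinuousOnInterval_intervalIntegral (c := 0) (by
      rw [h0]
      exact ⟨min_le_right _ _, le_max_right _ _⟩)
  refine h1.mono ?_
  rw [h0]
  exact fun t ht => ⟨(min_le_left _ _).trans ht.1, ht.2.trans (le_max_left _ _)⟩

end AbsolutelyContinuous

section GivenBy

variable {F : Seminorm ℝ (ℝ × ℝ)} {φ₁ φ₂ φ₃ φ₄ : ℝ} {g : ℝ → Fin 4 → ℝ} {θ ρ : ℝ → ℝ}

theorem measurable_controlX (hF : ∀ w, F w = 0 → w = 0) (hθ : Continuous θ) (hρ : Measurable ρ) :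
    Measurable fun t => controlX F (θ t) (ρ t) := by
  have hr : Measurable fun t => polarRadius F (θ t) :=
    ((continuous_polarRadius hF).comp hθ).measurable
  have hc : Measurable fun t => Real.cos (θ t) := (Real.continuous_cos.comp hθ).measurable
  have hs : Measurable fun t => Real.sin (θ t) := (Real.continuous_sin.comp hθ).measurable
  exact ((hρ.mul hs).add (hr.mul hc)).div (hr.pow_const 2)

theorem measurable_controlY (hF : ∀ w, F w = 0 → w = 0) (hθ : Continuous θ) (hρ : Measurable ρ) :
    Measurable fun t => controlY F (θ t) (ρ t) := by
  have hr : Measurable fun t => polarRadius F (θ t) :=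
    ((continuous_polarRadius hF).comp hθ).measurable
  have hc : Measurable fun t => Real.cos (θ t) := (Real.continuous_cos.comp hθ).measurable
  have hs : Measurable fun t => Real.sin (θ t) := (Real.continuous_sin.comp hθ).measurable
  exact ((hr.mul hs).sub (hρ.mul hc)).div (hr.pow_const 2)

/-- The velocity of a curve on the polar curve, in terms of the supporting vectors. -/
theorem ae_hasDerivAt_polar (hF : ∀ w, F w = 0 → w = 0) (hθ : ContDiff ℝ 1 θ) {u : ℝ → ℝ × ℝ}
    (hu : ∀ t, u t ∈ unitBallOf F)
    (hdot : ∀ t, polarRadius F (θ t) * Real.cos (θ t) * (u t).1 +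
      polarRadius F (θ t) * Real.sin (θ t) * (u t).2 = 1) :
    ∀ᵐ t, HasDerivAt (fun t => polarRadius F (θ t) * Real.cos (θ t))
        (-(polarRadius F (θ t) ^ 2 * deriv θ t) * (u t).2) t ∧
      HasDerivAt (fun t => polarRadius F (θ t) * Real.sin (θ t))
        (polarRadius F (θ t) ^ 2 * deriv θ t * (u t).1) t := by
  obtain ⟨K, hK⟩ := lipschitz_polarRadius hF
  filter_upwards [ae_differentiableAt_of_forall_absolutelyContinuousOnInterval
    (hK.absolutelyContinuousOnInterval_comp hθ)] with t ht
  have hθd : HasDerivAt θ (deriv θ t) t :=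
    ((hθ.differentiable one_ne_zero) t).hasDerivAt
  have h1 := ht.hasDerivAt.mul hθd.cos
  have h2 := ht.hasDerivAt.mul hθd.sin
  set R := polarRadius F (θ t) with hR
  set R' := deriv (fun t => polarRadius F (θ t)) t with hR'
  -- With the control frozen at time `t`, the pairing with a moving boundary point of the polar
  -- figure is at most 1 and equals 1 at time `t`. Hence the velocity of `h` is orthogonal to
  -- `u(t)`; this, `h·u = 1` and the angular velocity determine it.
  have hmax : IsLocalMax (fun s => polarRadius F (θ s) * Real.cos (θ s) * (u t).1 +
      polarRadius F (θ s) * Real.sin (θ s) * (u t).2) t := by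
    refine Eventually.of_forall fun s => ?_
    beta_reduce
    rw [hdot t]
    have := dot_le_supportNorm hF (polarRadius F (θ s) * Real.cos (θ s),
      polarRadius F (θ s) * Real.sin (θ s)) (hu t)
    rwa [supportNorm_polar hF] at this
  have h3 := hmax.hasDerivAt_eq_zero ((h1.mul_const (u t).1).add (h2.mul_const (u t).2))
  have h4 := hdot t
  rw [← hR] at h4
  have hcs := Real.sin_sq_add_cos_sq (θ t)
  set C := Real.cos (θ t)
  set S := Real.sin (θ t)
  set D := deriv θ t
  set a := (u t).1
  set b := (u t).2
  refine ⟨h1.congr_deriv ?_, h2.congr_deriv ?_⟩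
  · linear_combination (R * C) * h3 - (R' * C + R * (-S * D)) * h4 - R ^ 2 * D * b * hcs
  · linear_combination (R * S) * h3 - (R' * S + R * (C * D)) * h4 + R ^ 2 * D * a * hcs

theorem IsGivenBy.sq_eq (hF : ∀ w, F w = 0 → w = 0) (h : IsGivenBy F φ₁ φ₂ φ₃ φ₄ g θ ρ) (t : ℝ) :
    (φ₃ + φ₄ * g t 0) ^ 2 = φ₃ ^ 2 + 2 * φ₄ * (polarH2 F (θ t) - φ₂) := by
  have h1 := h.angle_sq_eq t
  have hr := (polarRadius_pos hF (θ t)).ne'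
  rw [angularSpeedSq, eq_div_iff (pow_ne_zero 4 hr)] at h1
  rw [← h.angle_eq, polarH2, ← h1]
  ring

/-- The control is the supporting vector attached to the chosen value of `r'`. The derivatives of
`z` and `v` are recovered by running the two first integrals backwards, which needs division by
`φ₄`. -/
theorem IsGivenBy.isNormalExtremal (hF : ∀ w, F w = 0 → w = 0) (hφ₄ : φ₄ ≠ 0)
    (h : IsGivenBy F φ₁ φ₂ φ₃ φ₄ g θ ρ) : IsNormalExtremal F φ₁ φ₂ φ₃ φ₄ g θ := by
  obtain ⟨C, hC, hU⟩ := exists_norm_le_of_mem_unitBallOf hF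
  obtain ⟨K, hK⟩ := lipschitz_polarRadius hF
  have hθc : Continuous θ := h.angle_contDiff.continuous
  set u : ℝ → ℝ × ℝ := fun t => (controlX F (θ t) (ρ t), controlY F (θ t) (ρ t)) with hu
  have hsupp := fun t => control_support hF (h.choice_mem t)
  have hu1 : Measurable fun t => (u t).1 := measurable_controlX hF hθc h.choice_measurable
  have hu2 : Measurable fun t => (u t).2 := measurable_controlY hF hθc h.choice_measurable
  have hb1 : ∀ t, |(u t).1| ≤ C := fun t => (hU _ (hsupp t).1).1
  have hb2 : ∀ t, |(u t).2| ≤ C := fun t => (hU _ (hsupp t).1).2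
  set H₁ : ℝ → ℝ := fun t => polarRadius F (θ t) * Real.cos (θ t) with hH₁
  set H₂ : ℝ → ℝ := fun t => polarRadius F (θ t) * Real.sin (θ t) with hH₂
  have hRac : ∀ a b, AbsolutelyContinuousOnInterval (fun t => polarRadius F (θ t)) a b :=
    hK.absolutelyContinuousOnInterval_comp h.angle_contDiff
  have hac₁ : ∀ a b, AbsolutelyContinuousOnInterval H₁ a b := fun a b =>
    (hRac a b).mul (h.angle_contDiff.cos.contDiffOn.absolutelyContinuousOnInterval)
  have hac₂ : ∀ a b, AbsolutelyContinuousOnInterval H₂ a b := fun a b =>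
    (hRac a b).mul (h.angle_contDiff.sin.contDiffOn.absolutelyContinuousOnInterval)
  have hgx : (fun t => g t 0) = fun t => ∫ τ in (0 : ℝ)..t, (u τ).1 := funext h.x_eq
  have hgy : (fun t => g t 1) = fun t => ∫ τ in (0 : ℝ)..t, (u τ).2 := funext h.y_eq
  have hgz : (fun t => g t 2) = fun t => -(1 / φ₄) * (H₁ t - φ₁ + φ₃ * g t 1
      + (1 / 2) * φ₄ * (g t 0 * g t 1)) := funext fun t => by
    rw [h.z_eq]
    ring
  have hgv : (fun t => g t 3) = fun t => (1 / (3 * φ₄)) * (t - φ₁ * g t 0 - φ₂ * g t 1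
      - 2 * φ₃ * g t 2 - (1 / 2) * φ₄ * (g t 0 * g t 2)) := funext fun t => by
    rw [h.v_eq]
    ring
  have hxac : ∀ a b, AbsolutelyContinuousOnInterval (fun t => g t 0) a b := fun a b => by
    rw [hgx]
    exact absolutelyContinuousOnInterval_integral_of_abs_le hu1 hb1 a b
  have hyac : ∀ a b, AbsolutelyContinuousOnInterval (fun t => g t 1) a b := fun a b => by
    rw [hgy]
    exact absolutelyContinuousOnInterval_integral_of_abs_le hu2 hb2 a b
  have hconst : ∀ c a b, AbsolutelyContinuousOnInterval (fun _ : ℝ => (c : ℝ)) a b :=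
    fun c a b => contDiff_const.contDiffOn.absolutelyContinuousOnInterval
  have hzac : ∀ a b, AbsolutelyContinuousOnInterval (fun t => g t 2) a b := fun a b => by
    rw [hgz]
    exact ((((hac₁ a b).sub (hconst φ₁ a b)).add ((hyac a b).const_mul _)).add
      (((hxac a b).mul (hyac a b)).const_mul _)).const_mul _
  have hvac : ∀ a b, AbsolutelyContinuousOnInterval (fun t => g t 3) a b := fun a b => by
    rw [hgv]
    exact (((((contDiff_id.contDiffOn.absolutelyContinuousOnInterval).sub
      ((hxac a b).const_mul _)).sub ((hyac a b).const_mul _)).sub ((hzac a b).const_mul _)).sub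
      (((hxac a b).mul (hzac a b)).const_mul _)).const_mul _
  have hxd : ∀ᵐ t, HasDerivAt (fun t => g t 0) (u t).1 t := by
    rw [hgx]
    exact ae_hasDerivAt_integral_of_abs_le hu1 hb1
  have hyd : ∀ᵐ t, HasDerivAt (fun t => g t 1) (u t).2 t := by
    rw [hgy]
    exact ae_hasDerivAt_integral_of_abs_le hu2 hb2
  have hHd : ∀ᵐ t, HasDerivAt H₁ (-(φ₃ + φ₄ * g t 0) * (u t).2) t ∧
      HasDerivAt H₂ ((φ₃ + φ₄ * g t 0) * (u t).1) t := by
    filter_upwards [ae_hasDerivAt_polar hF h.angle_contDiff (u := u) (fun t => (hsupp t).1)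
      fun t => (hsupp t).2] with t ht
    rwa [← h.angle_eq]
  have hzd : ∀ᵐ t, HasDerivAt (fun t => g t 2)
      ((1 / 2) * (g t 0 * (u t).2 - g t 1 * (u t).1)) t := by
    filter_upwards [hxd, hyd, hHd] with t hx hy hH
    rw [hgz]
    refine ((((hH.1.sub_const φ₁).add (hy.const_mul _)).add
      ((hx.mul hy).const_mul _)).const_mul _).congr_deriv ?_
    field_simp
    ring
  have hH₂x : ∀ t, H₂ t = φ₂ + φ₃ * g t 0 + (1 / 2) * φ₄ * (g t 0 * g t 0) := fun t => by
    have h1 := h.sq_eq hF t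
    rw [polarH2] at h1
    have h2 : 2 * φ₄ * (H₂ t - (φ₂ + φ₃ * g t 0 + (1 / 2) * φ₄ * (g t 0 * g t 0))) = 0 := by
      rw [hH₂]
      linear_combination -h1
    have h3 := (mul_eq_zero.1 h2).resolve_left (mul_ne_zero two_ne_zero hφ₄)
    linarith
  have hvd : ∀ᵐ t, HasDerivAt (fun t => g t 3)
      (-(1 / 2) * (g t 2 + (1 / 6) * (g t 0 * g t 1)) * (u t).1
        + (1 / 12) * (g t 0) ^ 2 * (u t).2) t := by
    filter_upwards [hxd, hyd, hzd] with t hx hy hz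
    rw [hgv]
    refine ((((((hasDerivAt_id t).sub (hx.const_mul _)).sub (hy.const_mul _)).sub
      (hz.const_mul _)).sub ((hx.mul hz).const_mul _)).const_mul _).congr_deriv ?_
    have h1 : H₁ t * (u t).1 + H₂ t * (u t).2 = 1 := (hsupp t).2
    have h2 : g t 2 = _ := congrFun hgz t
    have h3 : H₁ t = φ₁ - φ₄ * g t 2 - φ₃ * g t 1 - (1 / 2) * φ₄ * (g t 0 * g t 1) := by
      rw [h2]
      field_simp
      ring
    rw [h3, hH₂x] at h1
    field_simp
    linear_combination (-288) * h1
  have hr0 := polarRadius_pos hF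
  have hg0 : g 0 = 0 := by
    have h0 : g 0 0 = 0 := by rw [h.x_eq, intervalIntegral.integral_same]
    have h1 : g 0 1 = 0 := by rw [h.y_eq, intervalIntegral.integral_same]
    have h2 : g 0 2 = 0 := by rw [h.z_eq, h0, h1, h.initial₁]; ring
    have h3 : g 0 3 = 0 := by rw [h.v_eq, h0, h1, h2]; ring
    ext i
    fin_cases i
    exacts [h0, h1, h2, h3]
  -- The left-invariant coordinates depend on the covector through a triangular system; this is its
  -- solution for the prescribed `h₁`, `h₂`, `h₃ = φ₃ + φ₄x`, `h₄ = φ₄`. The last entry keeps it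
  -- away from zero.
  set ψ : ℝ → Fin 4 → ℝ := fun t =>
    ![H₁ t + (1 / 2) * (g t 1 * (φ₃ + (1 / 2) * φ₄ * g t 0)) + (1 / 2) * φ₄ * g t 2
        + (1 / 12) * φ₄ * (g t 0 * g t 1),
      H₂ t - (1 / 2) * (g t 0 * (φ₃ + (1 / 2) * φ₄ * g t 0)) - (1 / 12) * φ₄ * (g t 0 * g t 0),
      φ₃ + (1 / 2) * φ₄ * g t 0, φ₄] with hψ
  have hψ1 : ∀ t, pmpHamiltonian (g t) (ψ t) (1, 0) = H₁ t := fun t => by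
    rw [pmpHamiltonian_eq]
    simp [hψ]
    ring
  have hψ2 : ∀ t, pmpHamiltonian (g t) (ψ t) (0, 1) = H₂ t := fun t => by
    rw [pmpHamiltonian_eq]
    simp [hψ]
    ring
  refine ⟨u, ψ, 1, ⟨hu1.prodMk hu2, fun t => (hsupp t).1, fun a b => ?_, fun a b => ?_,
    fun t h0 => ?_, ?_, ?_, zero_le_one, ?_⟩, one_pos, hg0, ?_, hθc, fun t => ?_⟩
  · refine absolutelyContinuousOnInterval_pi fun i => ?_
    fin_cases i
    exacts [hxac a b, hyac a b, hzac a b, hvac a b]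
  · have h2 : AbsolutelyContinuousOnInterval (fun t => φ₃ + (1 / 2) * φ₄ * g t 0) a b :=
      (hconst φ₃ a b).add ((hxac a b).const_mul _)
    refine absolutelyContinuousOnInterval_pi fun i => ?_
    fin_cases i
    · exact (((hac₁ a b).add (((hyac a b).mul h2).const_mul _)).add
        ((hzac a b).const_mul _)).add (((hxac a b).mul (hyac a b)).const_mul _)
    · exact ((hac₂ a b).sub (((hxac a b).mul h2).const_mul _)).sub
        (((hxac a b).mul (hxac a b)).const_mul _)
    · exact h2
    · exact hconst φ₄ a b
  · exact hφ₄ (congrFun h0 3)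
  · filter_upwards [hxd, hyd, hzd, hvd] with t hx hy hz hv
    rw [leftDifferential_horizontalVector, hasDerivAt_pi]
    intro i
    fin_cases i
    exacts [hx, hy, hz, hv]
  · filter_upwards [hxd, hyd, hzd, hHd] with t hx hy hz hH
    rw [adjointField_eq, hasDerivAt_pi]
    have h2 : HasDerivAt (fun t => φ₃ + (1 / 2) * φ₄ * g t 0) ((1 / 2) * φ₄ * (u t).1) t :=
      (hx.const_mul _).const_add _
    intro i
    fin_cases i
    · refine ((((hH.1.add ((hy.mul h2).const_mul (1 / 2))).add
        (hz.const_mul ((1 / 2) * φ₄))).add ((hx.mul hy).const_mul ((1 / 12) * φ₄)))).congr_deriv ?_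
      simp [hψ]
      ring
    · refine ((hH.2.sub ((hx.mul h2).const_mul (1 / 2))).sub
        ((hx.mul hx).const_mul ((1 / 12) * φ₄))).congr_deriv ?_
      simp [hψ]
      ring
    · exact h2
    · exact hasDerivAt_const t φ₄
  · refine Eventually.of_forall fun t => ⟨?_, fun w hw => ?_⟩
    · rw [pmpHamiltonian_eq_dot, hψ1, hψ2]
      exact (hsupp t).2
    · rw [pmpHamiltonian_eq_dot, hψ1, hψ2]
      have := dot_le_supportNorm hF (H₁ t, H₂ t) hw
      rwa [hH₁, hH₂, supportNorm_polar hF] at this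
  · ext i
    fin_cases i <;> simp [hψ, hg0, hH₁, hH₂, h.initial₁, h.initial₂]
  · rw [hψ1, hψ2, div_one, div_one]
    exact ⟨rfl, rfl⟩

theorem isNormalExtremal_iff (hF : ∀ w, F w = 0 → w = 0) (hφ₄ : φ₄ ≠ 0) :
    IsNormalExtremal F φ₁ φ₂ φ₃ φ₄ g θ ↔ ∃ ρ, IsGivenBy F φ₁ φ₂ φ₃ φ₄ g θ ρ :=
  ⟨fun h => h.exists_isGivenBy hF hφ₄, fun ⟨_, h⟩ => h.isNormalExtremal hF hφ₄⟩

end GivenBy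

/-! ### The time of a one-dimensional motion -/

section Motion

theorem pos_or_neg_of_ne_zero {f : ℝ → ℝ} {s : Set ℝ} (hs : IsPreconnected s)
    (hf : ContinuousOn f s) (h0 : ∀ t ∈ s, f t ≠ 0) :
    (∀ t ∈ s, 0 < f t) ∨ (∀ t ∈ s, f t < 0) := by
  by_contra! hc
  obtain ⟨⟨a, ha, ha'⟩, b, hb, hb'⟩ := hc
  obtain ⟨c, hc, hc'⟩ := hs.intermediate_value ha hb hf ⟨ha', hb'⟩
  exact h0 c hc hc'

theorem exists_first_zero {f : ℝ → ℝ} (hf : Continuous f) {a : ℝ} (hz : ∃ t > a, f t = 0)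
    (h0 : ∀ᶠ t in 𝓝[>] a, f t ≠ 0) : ∃ T > a, f T = 0 ∧ ∀ t ∈ Ioo a T, f t ≠ 0 := by
  obtain ⟨ε, hε, hne⟩ := mem_nhdsGT_iff_exists_Ioo_subset.1 h0
  obtain ⟨t₀, ht₀, hft₀⟩ := hz
  -- Zeros do not accumulate at `a` from the right, so those to the right of `a` form a closed set
  -- beginning at `ε`, and the infimum is attained.
  set S := {t | ε ≤ t ∧ f t = 0} with hS
  have hcl : IsClosed S :=
    (isClosed_le continuous_const continuous_id).inter (isClosed_eq hf continuous_const)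
  have hbb : BddBelow S := ⟨ε, fun t ht => ht.1⟩
  have hmem : sInf S ∈ S := hcl.csInf_mem ⟨t₀, by
    by_contra! hlt
    exact hne ⟨ht₀, hlt⟩ hft₀, hft₀⟩ hbb
  refine ⟨sInf S, lt_of_lt_of_le hε hmem.1, hmem.2, fun t ht hft => ?_⟩
  by_cases h : ε ≤ t
  · exact absurd (csInf_le hbb ⟨h, hft⟩) (not_le.2 ht.2)
  · exact hne ⟨ht.1, not_le.1 h⟩ hft

/-- Positivity is needed only between the two upper limits, so the common lower limit may be a
singular point of an improper integral. -/
theorem eq_of_integral_eq_of_pos {f : ℝ → ℝ} {c d e : ℝ} (hd : IntervalIntegrable f volume c d)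
    (he : IntervalIntegrable f volume c e) (hpos : ∀ ξ ∈ Ioo (min d e) (max d e), 0 < f ξ)
    (h : ∫ ξ in c..d, f ξ = ∫ ξ in c..e, f ξ) : d = e := by
  have hde : IntervalIntegrable f volume d e := hd.symm.trans he
  have h0 : ∫ ξ in d..e, f ξ = 0 := by
    rw [← intervalIntegral.integral_interval_sub_left he hd, h, sub_self]
  rcases lt_trichotomy d e with hlt | heq | hlt
  · rw [min_eq_left hlt.le, max_eq_right hlt.le] at hpos
    exact absurd h0 (intervalIntegral.intervalIntegral_pos_of_pos_on hde hpos hlt).ne'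
  · exact heq
  · rw [min_eq_right hlt.le, max_eq_left hlt.le] at hpos
    rw [intervalIntegral.integral_symm, neg_eq_zero] at h0
    exact absurd h0 (intervalIntegral.intervalIntegral_pos_of_pos_on hde.symm hpos hlt).ne'

/-- After the substitution `ξ = θ(t)` the integrand becomes 1. The velocity may vanish at the end
points, so convergence of the improper integral is part of the conclusion. -/
theorem integral_inv_sqrt_of_deriv_pos {θ q : ℝ → ℝ} {a b : ℝ} (hab : a < b)
    (hθ : ContDiff ℝ 1 θ) (hq : ∀ t, deriv θ t ^ 2 = q (θ t))
    (hpos : ∀ t ∈ Ioo a b, 0 < deriv θ t) :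
    IntervalIntegrable (fun ξ => 1 / √(q ξ)) volume (θ a) (θ b) ∧
      ∫ ξ in θ a..θ b, 1 / √(q ξ) = b - a := by
  have hmono : StrictMonoOn θ (Icc a b) := strictMonoOn_of_deriv_pos (convex_Icc a b)
    hθ.continuous.continuousOn (by rwa [interior_Icc])
  have hlt : θ a < θ b := hmono (left_mem_Icc.2 hab.le) (right_mem_Icc.2 hab.le) hab
  have himg : θ '' Ioo a b = Ioo (θ a) (θ b) := by
    refine Subset.antisymm ?_ (intermediate_value_Ioo hab.le hθ.continuous.continuousOn)
    rintro _ ⟨t, ht, rfl⟩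
    exact ⟨hmono (left_mem_Icc.2 hab.le) (Ioo_subset_Icc_self ht) ht.1,
      hmono (Ioo_subset_Icc_self ht) (right_mem_Icc.2 hab.le) ht.2⟩
  have hinj : InjOn θ (Ioo a b) := hmono.injOn.mono Ioo_subset_Icc_self
  have hd : ∀ t ∈ Ioo a b, HasDerivWithinAt θ (deriv θ t) (Ioo a b) t := fun t _ =>
    ((hθ.differentiable one_ne_zero) t).hasDerivAt.hasDerivWithinAt
  have hone : EqOn (fun t => |deriv θ t| • (1 / √(q (θ t)))) (fun _ => (1 : ℝ)) (Ioo a b) := by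
    intro t ht
    have h1 := (hpos t ht).ne'
    simp only [← hq, Real.sqrt_sq_eq_abs, smul_eq_mul]
    field_simp
  constructor
  · rw [intervalIntegrable_iff_integrableOn_Ioo_of_le hlt.le, ← himg,
      integrableOn_image_iff_integrableOn_abs_deriv_smul measurableSet_Ioo hd hinj,
      integrableOn_congr_fun hone measurableSet_Ioo]
    exact integrableOn_const (by simp)
  · rw [intervalIntegral.integral_of_le hlt.le, integral_Ioc_eq_integral_Ioo, ← himg,
      integral_image_eq_integral_abs_deriv_smul measurableSet_Ioo hd hinj,
      setIntegral_congr_fun measurableSet_Ioo hone]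
    simp [hab.le]

theorem integral_inv_sqrt_of_deriv_neg {θ q : ℝ → ℝ} {a b : ℝ} (hab : a < b)
    (hθ : ContDiff ℝ 1 θ) (hq : ∀ t, deriv θ t ^ 2 = q (θ t))
    (hneg : ∀ t ∈ Ioo a b, deriv θ t < 0) :
    IntervalIntegrable (fun ξ => 1 / √(q ξ)) volume (θ a) (θ b) ∧
      ∫ ξ in θ a..θ b, 1 / √(q ξ) = -(b - a) := by
  have hd : ∀ t, deriv (fun s => -θ s) t = -deriv θ t := fun t => deriv.fun_neg
  obtain ⟨h1, h2⟩ := integral_inv_sqrt_of_deriv_pos (q := fun ξ => q (-ξ)) hab hθ.neg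
    (fun t => by rw [hd, neg_sq, hq, neg_neg]) fun t ht => by
      rw [hd]
      exact neg_pos.2 (hneg t ht)
  constructor
  · have h3 := (IntervalIntegrable.comp_sub_left h1 0)
    simp only [zero_sub, neg_neg] at h3
    exact h3
  · rw [intervalIntegral.integral_comp_neg (fun ξ => 1 / √(q ξ)), neg_neg, neg_neg,
      intervalIntegral.integral_symm] at h2
    linarith

theorem integral_inv_sqrt_of_motion {θ q : ℝ → ℝ} {a b σ : ℝ} (hσ : σ = 1 ∨ σ = -1) (hab : a < b)
    (hθ : ContDiff ℝ 1 θ) (hq : ∀ t, deriv θ t ^ 2 = q (θ t))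
    (hpos : ∀ t ∈ Ioo a b, 0 < σ * deriv θ t) :
    IntervalIntegrable (fun ξ => 1 / √(q ξ)) volume (θ a) (θ b) ∧
      ∫ ξ in θ a..θ b, 1 / √(q ξ) = σ * (b - a) := by
  rcases hσ with rfl | rfl
  · simp only [one_mul] at hpos ⊢
    exact integral_inv_sqrt_of_deriv_pos hab hθ hq hpos
  · simp only [neg_one_mul] at hpos ⊢
    exact integral_inv_sqrt_of_deriv_neg hab hθ hq fun t ht => neg_pos.1 (hpos t ht)

/-- The same for a motion through the origin of time, on either side of it. -/
theorem integral_inv_sqrt_of_motion_uIoo {θ q : ℝ → ℝ} {s t σ : ℝ} (hσ : σ = 1 ∨ σ = -1)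
    (hθ : ContDiff ℝ 1 θ) (hq : ∀ t, deriv θ t ^ 2 = q (θ t))
    (hpos : ∀ τ ∈ Ioo (min s t) (max s t), 0 < σ * deriv θ τ) :
    IntervalIntegrable (fun ξ => 1 / √(q ξ)) volume (θ s) (θ t) ∧
      ∫ ξ in θ s..θ t, 1 / √(q ξ) = σ * (t - s) := by
  rcases lt_trichotomy s t with h | rfl | h
  · rw [min_eq_left h.le, max_eq_right h.le] at hpos
    exact integral_inv_sqrt_of_motion hσ h hθ hq hpos
  · simp
  · rw [min_eq_right h.le, max_eq_left h.le] at hpos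
    obtain ⟨h1, h2⟩ := integral_inv_sqrt_of_motion hσ h hθ hq hpos
    refine ⟨h1.symm, ?_⟩
    rw [intervalIntegral.integral_symm, h2]
    ring

/-- The composition of two reflections of the time axis is the translation by `2(t₂ - t₁)`. -/
theorem IsReflectionPeriodic.of_even {θ : ℝ → ℝ} {t₁ t₂ : ℝ}
    (h₁ : ∀ t, θ (t₁ + t) = θ (t₁ - t)) (h₂ : ∀ t, θ (t₂ + t) = θ (t₂ - t)) :
    IsReflectionPeriodic θ t₁ t₂ := by
  have hd : ∀ c, (∀ t, θ (c + t) = θ (c - t)) → ∀ t, deriv θ (c + t) = -deriv θ (c - t) :=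
    fun c hc t => by
      rw [← deriv_comp_const_add, ← deriv_comp_const_sub]
      exact congrArg (deriv · t) (funext hc)
  have hper : Function.Periodic θ (2 * (t₂ - t₁)) := fun t => by
    calc θ (t + 2 * (t₂ - t₁)) = θ (t₂ + (t + t₂ - 2 * t₁)) := by congr 1; ring
      _ = θ (t₂ - (t + t₂ - 2 * t₁)) := h₂ _
      _ = θ (t₁ + (t₁ - t)) := by congr 1; ring
      _ = θ (t₁ - (t₁ - t)) := h₁ _
      _ = θ t := by congr 1; ring
  refine ⟨fun t k => ?_, fun t => ⟨hd t₁ h₁ t, h₁ t⟩, fun t => ⟨hd t₂ h₂ t, h₂ t⟩⟩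
  have h3 := hper.int_mul k t
  rw [← h3]
  congr 1
  ring

end Motion

/-! ### Angular motions -/

section AngularMotion

variable {F : Seminorm ℝ (ℝ × ℝ)} {φ₄ E : ℝ} {θ : ℝ → ℝ}

/-- The angle of an extremal of energy `E`, without initial conditions. -/
structure IsAngularMotion (F : Seminorm ℝ (ℝ × ℝ)) (φ₄ E : ℝ) (θ : ℝ → ℝ) : Prop where
  contDiff : ContDiff ℝ 1 θ
  sq_eq : ∀ t, (polarRadius F (θ t) ^ 2 * deriv θ t) ^ 2 = 2 * (E + φ₄ * polarH2 F (θ t))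
  exists_control : ∃ u : ℝ → ℝ × ℝ, Measurable u ∧ (∀ t, u t ∈ unitBallOf F) ∧
    (∀ t, polarRadius F (θ t) * Real.cos (θ t) * (u t).1 +
      polarRadius F (θ t) * Real.sin (θ t) * (u t).2 = 1) ∧
    ∀ s t, polarRadius F (θ t) ^ 2 * deriv θ t - polarRadius F (θ s) ^ 2 * deriv θ s =
      φ₄ * ∫ τ in s..t, (u τ).1

/-- The square of the angular speed at the energy `E`. -/
noncomputable def energySpeedSq (F : Seminorm ℝ (ℝ × ℝ)) (φ₄ E ξ : ℝ) : ℝ :=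
  2 * (E + φ₄ * polarH2 F ξ) / polarRadius F ξ ^ 4

theorem angularSpeedSq_eq (F : Seminorm ℝ (ℝ × ℝ)) (φ₂ φ₃ φ₄ ξ : ℝ) :
    angularSpeedSq F φ₂ φ₃ φ₄ ξ = energySpeedSq F φ₄ (casimirEnergy φ₂ φ₃ φ₄) ξ := by
  rw [angularSpeedSq, energySpeedSq, casimirEnergy, polarH2]
  congr 1
  ring

theorem continuous_energySpeedSq (hF : ∀ w, F w = 0 → w = 0) (φ₄ E : ℝ) :
    Continuous (energySpeedSq F φ₄ E) := by
  have h1 := continuous_polarH2 hF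
  have h2 := continuous_polarRadius hF
  exact (by fun_prop : Continuous fun ξ => 2 * (E + φ₄ * polarH2 F ξ)).div (h2.pow 4)
    fun ξ => (pow_pos (polarRadius_pos hF ξ) 4).ne'

theorem energySpeedSq_periodic (F : Seminorm ℝ (ℝ × ℝ)) (φ₄ E : ℝ) :
    Function.Periodic (energySpeedSq F φ₄ E) (2 * Real.pi) := fun ξ => by
  rw [energySpeedSq, polarH2_periodic F ξ, polarRadius_periodic F ξ, energySpeedSq]

theorem energySpeedSq_eq_zero_iff (hF : ∀ w, F w = 0 → w = 0) {ξ : ℝ} :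
    energySpeedSq F φ₄ E ξ = 0 ↔ E + φ₄ * polarH2 F ξ = 0 := by
  have := pow_pos (polarRadius_pos hF ξ) 4
  simp [energySpeedSq, this.ne']

theorem energySpeedSq_pos_iff (hF : ∀ w, F w = 0 → w = 0) {ξ : ℝ} :
    0 < energySpeedSq F φ₄ E ξ ↔ 0 < E + φ₄ * polarH2 F ξ := by
  have := pow_pos (polarRadius_pos hF ξ) 4
  rw [energySpeedSq, div_pos_iff_of_pos_right this]
  constructor <;> intro h <;> linarith

theorem IsAngularMotion.deriv_sq (hF : ∀ w, F w = 0 → w = 0) (h : IsAngularMotion F φ₄ E θ)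
    (t : ℝ) : deriv θ t ^ 2 = energySpeedSq F φ₄ E (θ t) := by
  have hr := (polarRadius_pos hF (θ t)).ne'
  rw [energySpeedSq, ← h.sq_eq]
  field_simp

theorem IsAngularMotion.deriv_eq_zero_iff (hF : ∀ w, F w = 0 → w = 0)
    (h : IsAngularMotion F φ₄ E θ) {t : ℝ} :
    deriv θ t = 0 ↔ E + φ₄ * polarH2 F (θ t) = 0 := by
  rw [← energySpeedSq_eq_zero_iff hF, ← h.deriv_sq hF, sq_eq_zero_iff]

theorem IsAngularMotion.continuous_deriv (h : IsAngularMotion F φ₄ E θ) :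
    Continuous (deriv θ) := h.contDiff.continuous_deriv le_rfl

theorem IsAngularMotion.comp_const_sub (h : IsAngularMotion F φ₄ E θ) (T : ℝ) :
    IsAngularMotion F φ₄ E fun t => θ (T - t) := by
  obtain ⟨u, hu, hU, hdot, hw⟩ := h.exists_control
  have hd : ∀ t, deriv (fun t => θ (T - t)) t = -deriv θ (T - t) := fun t =>
    deriv_comp_const_sub θ T t
  refine ⟨h.contDiff.comp (contDiff_const.sub contDiff_id), fun t => ?_,
    fun t => u (T - t), hu.comp (measurable_const.sub measurable_id), fun t => hU _,
    fun t => hdot _, fun s t => ?_⟩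
  · rw [hd, ← h.sq_eq]
    ring
  · rw [hd, hd, intervalIntegral.integral_comp_sub_left (fun τ => (u τ).1) T, ← hw]
    ring

theorem IsGivenBy.isAngularMotion (hF : ∀ w, F w = 0 → w = 0) {φ₁ φ₂ φ₃ : ℝ}
    {g : ℝ → Fin 4 → ℝ} {ρ : ℝ → ℝ} (h : IsGivenBy F φ₁ φ₂ φ₃ φ₄ g θ ρ) :
    IsAngularMotion F φ₄ (casimirEnergy φ₂ φ₃ φ₄) θ := by
  have hθc : Continuous θ := h.angle_contDiff.continuous
  have hsupp := fun t => control_support hF (h.choice_mem t)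
  have hm1 := measurable_controlX hF hθc h.choice_measurable
  obtain ⟨C, hC, hU⟩ := exists_norm_le_of_mem_unitBallOf hF
  have hint := intervalIntegrable_of_abs_le hm1 fun t => (hU _ (hsupp t).1).1
  refine ⟨h.angle_contDiff, fun t => ?_, fun t => (controlX F (θ t) (ρ t), controlY F (θ t) (ρ t)),
    hm1.prodMk (measurable_controlY hF hθc h.choice_measurable), fun t => (hsupp t).1,
    fun t => (hsupp t).2, fun s t => ?_⟩
  · rw [h.angle_eq, h.sq_eq hF, casimirEnergy]
    ring
  · rw [h.angle_eq, h.angle_eq, h.x_eq, h.x_eq,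
      ← intervalIntegral.integral_interval_sub_left (hint 0 t) (hint 0 s)]
    ring

/-- On the polar curve away from its highest and lowest points the supporting vectors are
transversal to the vertical direction. -/
theorem eventually_le_mul_control (hF : ∀ w, F w = 0 → w = 0) {a : ℝ}
    (ha : (a, F (0, 1)) ∈ polarFigure F) {η : ℝ} (hη : |polarH2 F η| < F (0, 1)) :
    ∃ δ > 0, ∀ᶠ ξ in 𝓝 η, ∀ u ∈ unitBallOf F,
      polarRadius F ξ * Real.cos ξ * u.1 + polarRadius F ξ * Real.sin ξ * u.2 = 1 →
      δ ≤ (polarRadius F η * Real.cos η - a / F (0, 1) * polarH2 F η) * u.1 := by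
  obtain ⟨C, hC, hU⟩ := exists_norm_le_of_mem_unitBallOf hF
  have hm := seminorm_vertical_pos hF
  set κ : ℝ → ℝ := fun ξ => polarRadius F ξ * Real.cos ξ - a / F (0, 1) * polarH2 F ξ with hκ
  have hr := continuous_polarRadius hF
  have hh := continuous_polarH2 hF
  have hκc : Continuous κ := by fun_prop
  have hcont : Continuous fun ξ => 1 - |polarH2 F ξ| / F (0, 1) - |κ ξ - κ η| * C := by fun_prop
  have hpos : 0 < 1 - |polarH2 F η| / F (0, 1) := by
    rw [sub_pos, div_lt_one hm]
    exact hη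
  -- At `η` itself `one_sub_abs_div_le` gives twice this bound; half of it absorbs the variation of
  -- the two quantities in `ξ`, since `u₁` is bounded by `C`.
  refine ⟨(1 - |polarH2 F η| / F (0, 1)) / 2, by positivity, ?_⟩
  have hev := hcont.continuousAt (x := η) |>.eventually_const_lt
    (u := (1 - |polarH2 F η| / F (0, 1)) / 2) (by simp; linarith)
  filter_upwards [hev] with ξ hξ u hu hdot
  have h1 := one_sub_abs_div_le hF ha
    (h := (polarRadius F ξ * Real.cos ξ, polarRadius F ξ * Real.sin ξ)) hu hdot
  have h2 : (κ ξ - κ η) * u.1 ≤ |κ ξ - κ η| * C := by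
    refine (le_abs_self _).trans ?_
    rw [abs_mul]
    exact mul_le_mul_of_nonneg_left (hU u hu).1 (abs_nonneg _)
  have h3 : κ ξ * u.1 = (polarRadius F ξ * Real.cos ξ -
    a / F (0, 1) * (polarRadius F ξ * Real.sin ξ)) * u.1 := rfl
  have h4 : 1 - |polarH2 F ξ| / F (0, 1) ≤ κ ξ * u.1 := h1
  change _ ≤ κ η * u.1
  linarith [sub_mul (κ ξ) (κ η) u.1]

theorem abs_polarH2_lt_of_energy_eq (hE : |E| < |φ₄| * F (0, 1))
    {η : ℝ} (hη : E + φ₄ * polarH2 F η = 0) : |polarH2 F η| < F (0, 1) := by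
  have h1 : |E| = |φ₄| * |polarH2 F η| := by
    rw [← abs_mul, ← abs_neg E]
    congr 1
    linarith
  rw [h1] at hE
  exact lt_of_mul_lt_mul_left hE (abs_nonneg _)

theorem energy_coeff_ne_zero (hE : |E| < |φ₄| * F (0, 1)) : φ₄ ≠ 0 := by
  rintro rfl
  rw [abs_zero, zero_mul] at hE
  exact absurd hE (not_lt.2 (abs_nonneg E))

/-- At an intermediate energy the angular velocity changes its sign at its zeros, in the direction
determined by the angle. -/
theorem exists_crossing_direction (hF : ∀ w, F w = 0 → w = 0) (hE : |E| < |φ₄| * F (0, 1)) :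
    ∃ σ : ℝ → ℝ, ∀ θ, IsAngularMotion F φ₄ E θ → ∀ T, deriv θ T = 0 →
      ∀ᶠ t in 𝓝[≠] T, 0 < σ (θ T) * ((t - T) * deriv θ t) := by
  obtain ⟨a, ha⟩ := exists_mem_polarFigure_top hF
  have hφ₄ := energy_coeff_ne_zero hE
  -- The second factor has the sign of `u₁` for every supporting vector near `η`, and the momentum
  -- `r²θ̇` has the derivative `φ₄u₁`; so the product is the direction in which the momentum crosses
  -- zero, and it depends only on the position.
  refine ⟨fun η => φ₄ * (polarRadius F η * Real.cos η - a / F (0, 1) * polarH2 F η),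
    fun θ h T hT => ?_⟩
  have hη := abs_polarH2_lt_of_energy_eq hE ((h.deriv_eq_zero_iff hF).1 hT)
  obtain ⟨δ, hδ, hev⟩ := eventually_le_mul_control hF ha hη
  set k := polarRadius F (θ T) * Real.cos (θ T) - a / F (0, 1) * polarH2 F (θ T) with hk
  obtain ⟨u, hu, hU, hdot, hw⟩ := h.exists_control
  obtain ⟨C, hC, hUC⟩ := exists_norm_le_of_mem_unitBallOf hF
  have hint := intervalIntegrable_of_abs_le hu.fst fun t => (hUC _ (hU t)).1
  obtain ⟨ε, hε, hball⟩ := Metric.eventually_nhds_iff.1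
    (h.contDiff.continuous.continuousAt.eventually hev)
  have hlow : ∀ τ, |τ - T| < ε → δ ≤ k * (u τ).1 := fun τ hτ =>
    hball (by rwa [Real.dist_eq]) _ (hU τ) (hdot τ)
  have hφ : 0 < φ₄ ^ 2 := by positivity
  have key : ∀ s t, s < t → (∀ τ ∈ Icc s t, |τ - T| < ε) →
      0 < φ₄ * k * (φ₄ * ∫ τ in s..t, (u τ).1) := fun s t hst hI => by
    have h1 : ∫ τ in s..t, δ ≤ ∫ τ in s..t, k * (u τ).1 :=
      intervalIntegral.integral_mono_on hst.le intervalIntegrable_const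
        ((hint s t).const_mul k) fun τ hτ => hlow τ (hI τ hτ)
    rw [intervalIntegral.integral_const, intervalIntegral.integral_const_mul, smul_eq_mul] at h1
    have h2 : 0 < k * ∫ τ in s..t, (u τ).1 := lt_of_lt_of_le (mul_pos (sub_pos.2 hst) hδ) h1
    calc 0 < φ₄ ^ 2 * (k * ∫ τ in s..t, (u τ).1) := mul_pos hφ h2
      _ = _ := by ring
  rw [eventually_nhdsWithin_iff]
  filter_upwards [Metric.ball_mem_nhds T hε] with t ht hne
  rw [Metric.mem_ball, Real.dist_eq] at ht
  have hr : 0 < polarRadius F (θ t) ^ 2 := pow_pos (polarRadius_pos hF _) 2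
  have h0 := hw T t
  rw [hT, mul_zero, sub_zero] at h0
  have hdiv : deriv θ t = (φ₄ * ∫ τ in T..t, (u τ).1) / polarRadius F (θ t) ^ 2 := by
    rw [← h0, mul_div_cancel_left₀ _ hr.ne']
  rw [hdiv, show φ₄ * k * ((t - T) * ((φ₄ * ∫ τ in T..t, (u τ).1) / polarRadius F (θ t) ^ 2)) =
    (t - T) * (φ₄ * k * (φ₄ * ∫ τ in T..t, (u τ).1)) / polarRadius F (θ t) ^ 2 by ring]
  refine div_pos ?_ hr
  rcases lt_or_gt_of_ne hne with hlt | hgt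
  · have h1 := key t T hlt fun τ hτ => by
      rw [abs_of_nonpos (by linarith [hτ.2])]
      rw [abs_of_neg (by linarith)] at ht
      linarith [hτ.1]
    rw [intervalIntegral.integral_symm]
    have : (t - T) * (φ₄ * k * (φ₄ * -∫ τ in t..T, (u τ).1)) =
      (T - t) * (φ₄ * k * (φ₄ * ∫ τ in t..T, (u τ).1)) := by ring
    rw [this]
    exact mul_pos (sub_pos.2 hlt) h1
  · refine mul_pos (sub_pos.2 hgt) (key T t hgt fun τ hτ => ?_)
    rw [abs_of_nonneg (by linarith [hτ.1])]
    rw [abs_of_pos (by linarith [show T < t from hgt])] at ht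
    linarith [hτ.2]

theorem exists_polarH2_eq (hF : ∀ w, F w = 0 → w = 0) : ∃ ξ, polarH2 F ξ = F (0, 1) := by
  obtain ⟨a, ha⟩ := exists_mem_polarFigure_top hF
  have hm := seminorm_vertical_pos hF
  have hz : (⟨a, F (0, 1)⟩ : ℂ) ≠ 0 := fun h => hm.ne' (congrArg Complex.im h)
  set z : ℂ := ⟨a, F (0, 1)⟩ with hzdef
  have h1 : ‖z‖ * Real.cos z.arg = a := Complex.norm_mul_cos_arg z
  have h2 : ‖z‖ * Real.sin z.arg = F (0, 1) := Complex.norm_mul_sin_arg z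
  have h3 := le_polarRadius hF (norm_nonneg z) (θ := z.arg) (by rw [h1, h2]; exact ha)
  refine ⟨z.arg, le_antisymm ((abs_le.1 (abs_polarH2_le hF _)).2) ?_⟩
  have hs : 0 < Real.sin z.arg := (mul_pos_iff_of_pos_left (norm_pos_iff.2 hz)).1 (h2.symm ▸ hm)
  calc F (0, 1) = ‖z‖ * Real.sin z.arg := h2.symm
    _ ≤ polarRadius F z.arg * Real.sin z.arg := mul_le_mul_of_nonneg_right h3 hs.le

theorem exists_energy_neg (hF : ∀ w, F w = 0 → w = 0) (hE : |E| < |φ₄| * F (0, 1)) :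
    ∃ ξ, E + φ₄ * polarH2 F ξ < 0 := by
  by_contra! hc
  obtain ⟨θ₀, hθ₀⟩ := exists_polarH2_eq hF
  have h1 := hc θ₀
  have h2 := hc (θ₀ + Real.pi)
  rw [polarH2_add_pi hF] at h2
  rw [hθ₀] at h1 h2
  have h3 : |φ₄| * F (0, 1) ≤ E := by
    rcases abs_choice φ₄ with h | h <;> rw [h] <;> linarith
  exact absurd (hE.trans_le h3) (not_lt.2 (le_abs_self E))

theorem exists_energy_neg_gt (hF : ∀ w, F w = 0 → w = 0) (hE : |E| < |φ₄| * F (0, 1)) (c : ℝ) :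
    ∃ ξ > c, E + φ₄ * polarH2 F ξ < 0 := by
  obtain ⟨ξ, hξ⟩ := exists_energy_neg hF hE
  obtain ⟨y, hy, he⟩ := (polarH2_periodic F).exists_mem_Ioc Real.two_pi_pos ξ c
  exact ⟨y, hy.1, he ▸ hξ⟩

theorem exists_energy_neg_lt (hF : ∀ w, F w = 0 → w = 0) (hE : |E| < |φ₄| * F (0, 1)) (c : ℝ) :
    ∃ ξ < c, E + φ₄ * polarH2 F ξ < 0 := by
  obtain ⟨ξ, hξ⟩ := exists_energy_neg hF hE
  obtain ⟨y, hy, he⟩ := (polarH2_periodic F).exists_mem_Ico Real.two_pi_pos ξ (c - 2 * Real.pi)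
  exact ⟨y, by linarith [hy.2], he ▸ hξ⟩

theorem IsAngularMotion.energy_nonneg (h : IsAngularMotion F φ₄ E θ) (t : ℝ) :
    0 ≤ E + φ₄ * polarH2 F (θ t) := by
  have := h.sq_eq t
  nlinarith [sq_nonneg (polarRadius F (θ t) ^ 2 * deriv θ t)]

/-- An angle where `E + φ₄h₂ < 0` is a potential barrier, and by periodicity there is one on each
side. -/
theorem IsAngularMotion.bounded (hF : ∀ w, F w = 0 → w = 0) (hE : |E| < |φ₄| * F (0, 1))
    (h : IsAngularMotion F φ₄ E θ) : ∃ b c, ∀ t, θ t ∈ Icc b c := by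
  obtain ⟨c, hc, hc'⟩ := exists_energy_neg_gt hF hE (θ 0)
  obtain ⟨b, hb, hb'⟩ := exists_energy_neg_lt hF hE (θ 0)
  have hne : ∀ t ξ, E + φ₄ * polarH2 F ξ < 0 → θ t ≠ ξ := fun t ξ hξ he => by
    have := h.energy_nonneg t
    rw [he] at this
    linarith
  refine ⟨b, c, fun t => ⟨?_, ?_⟩⟩
  · by_contra! hlt
    obtain ⟨s, hs⟩ := mem_range_of_exists_le_of_exists_ge h.contDiff.continuous ⟨t, hlt.le⟩
      ⟨0, hb.le⟩
    exact hne s b hb' hs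
  · by_contra! hlt
    obtain ⟨s, hs⟩ := mem_range_of_exists_le_of_exists_ge h.contDiff.continuous ⟨0, hc.le⟩
      ⟨t, hlt.le⟩
    exact hne s c hc' hs

theorem exists_tendsto_of_deriv_ne_zero {θ : ℝ → ℝ} (hθ : ContDiff ℝ 1 θ) {a b c : ℝ}
    (hb : ∀ t, θ t ∈ Icc b c) (h0 : ∀ t ∈ Ioi a, deriv θ t ≠ 0) :
    ∃ L, Tendsto θ atTop (𝓝 L) := by
  have hcongr : ∀ L, Tendsto (fun t => θ (max a t)) atTop (𝓝 L) → Tendsto θ atTop (𝓝 L) :=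
    fun L hL => hL.congr' (by
      filter_upwards [eventually_ge_atTop a] with t ht
      rw [max_eq_right ht])
  rcases pos_or_neg_of_ne_zero isPreconnected_Ioi
    ((hθ.continuous_deriv le_rfl).continuousOn) h0 with hs | hs
  · have hm : MonotoneOn θ (Ici a) := (strictMonoOn_of_deriv_pos (convex_Ici a)
      hθ.continuous.continuousOn (by rwa [interior_Ici])).monotoneOn
    refine ⟨_, hcongr _ (tendsto_atTop_ciSup (fun s t hst => hm (le_max_left a s)
      (le_max_left a t) (max_le_max_left a hst)) ⟨c, ?_⟩)⟩
    rintro _ ⟨t, rfl⟩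
    exact (hb _).2
  · have hm : AntitoneOn θ (Ici a) := (strictAntiOn_of_deriv_neg (convex_Ici a)
      hθ.continuous.continuousOn (by rwa [interior_Ici])).antitoneOn
    refine ⟨_, hcongr _ (tendsto_atTop_ciInf (fun s t hst => hm (le_max_left a s)
      (le_max_left a t) (max_le_max_left a hst)) ⟨b, ?_⟩)⟩
    rintro _ ⟨t, rfl⟩
    exact (hb _).1

/-- At an intermediate energy the angular velocity vanishes at arbitrarily large times. -/
theorem IsAngularMotion.exists_deriv_eq_zero (hF : ∀ w, F w = 0 → w = 0)
    (hE : |E| < |φ₄| * F (0, 1)) (h : IsAngularMotion F φ₄ E θ) (a : ℝ) :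
    ∃ t > a, deriv θ t = 0 := by
  by_contra! h0
  obtain ⟨b, c, hb⟩ := h.bounded hF hE
  -- Without further zeros the motion is eventually monotone, hence convergent. Mean values of the
  -- velocity over unit intervals then tend to zero, so the limit `L` is a turning point.
  obtain ⟨L, hL⟩ := exists_tendsto_of_deriv_ne_zero h.contDiff hb h0
  have hd : Differentiable ℝ θ := h.contDiff.differentiable one_ne_zero
  have hslope : ∀ n : ℕ, ∃ ξ ∈ Ioo (n : ℝ) (n + 1), deriv θ ξ = θ (n + 1) - θ n := fun n => by
    obtain ⟨ξ, hξ, he⟩ := exists_deriv_eq_slope θ (lt_add_one (n : ℝ)) hd.continuous.continuousOn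
      hd.differentiableOn
    exact ⟨ξ, hξ, by rw [he]; simp⟩
  choose ξ hξ hξd using hslope
  have hξt : Tendsto ξ atTop atTop :=
    tendsto_atTop_mono (fun n => (hξ n).1.le) tendsto_natCast_atTop_atTop
  have h1 : Tendsto (fun n => deriv θ (ξ n) ^ 2) atTop (𝓝 0) := by
    have hn : Tendsto (fun n : ℕ => θ n) atTop (𝓝 L) := hL.comp tendsto_natCast_atTop_atTop
    have hn1 : Tendsto (fun n : ℕ => θ ((n : ℝ) + 1)) atTop (𝓝 L) :=
      hL.comp (tendsto_atTop_add_const_right _ 1 tendsto_natCast_atTop_atTop)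
    simpa [hξd] using (hn1.sub hn).pow 2
  have h2 : Tendsto (fun n => deriv θ (ξ n) ^ 2) atTop (𝓝 (energySpeedSq F φ₄ E L)) := by
    simp only [h.deriv_sq hF]
    exact ((continuous_energySpeedSq hF φ₄ E).tendsto L).comp (hL.comp hξt)
  have hL0 : E + φ₄ * polarH2 F L = 0 :=
    (energySpeedSq_eq_zero_iff hF).1 (tendsto_nhds_unique h2 h1)
  obtain ⟨a', ha'⟩ := exists_mem_polarFigure_top hF
  obtain ⟨δ, hδ, hev⟩ := eventually_le_mul_control hF ha' (abs_polarH2_lt_of_energy_eq hE hL0)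
  set k := polarRadius F L * Real.cos L - a' / F (0, 1) * polarH2 F L with hk
  obtain ⟨u, hu, hU, hdot, hw⟩ := h.exists_control
  obtain ⟨C, hC, hUC⟩ := exists_norm_le_of_mem_unitBallOf hF
  have hint := intervalIntegrable_of_abs_le hu.fst fun t => (hUC _ (hU t)).1
  obtain ⟨t₀, ht₀⟩ := eventually_atTop.1 (hL.eventually hev)
  set w : ℝ → ℝ := fun t => polarRadius F (θ t) ^ 2 * deriv θ t with hwdef
  have hφ : 0 < φ₄ ^ 2 := by
    have := energy_coeff_ne_zero hE
    positivity
  obtain ⟨B, hB⟩ : ∃ B, ∀ t, |w t| ≤ B := by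
    refine ⟨√(2 * (E + |φ₄| * F (0, 1))), fun t => Real.abs_le_sqrt ?_⟩
    rw [hwdef]
    simp only
    rw [h.sq_eq]
    have : φ₄ * polarH2 F (θ t) ≤ |φ₄| * F (0, 1) := by
      refine (le_abs_self _).trans ?_
      rw [abs_mul]
      exact mul_le_mul_of_nonneg_left (abs_polarH2_le hF _) (abs_nonneg _)
    linarith
  -- Near `L` the control has `k u₁ ≥ δ`, so the momentum, whose derivative is `φ₄u₁`, grows at
  -- least linearly, while the energy equation keeps it bounded by `B`.
  have hgrow : ∀ t, t₀ ≤ t → φ₄ ^ 2 * (δ * (t - t₀)) ≤ |φ₄ * k| * (2 * B) := fun t ht => by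
    have h3 : ∫ τ in t₀..t, δ ≤ ∫ τ in t₀..t, k * (u τ).1 :=
      intervalIntegral.integral_mono_on ht intervalIntegrable_const
        ((hint t₀ t).const_mul k) fun τ hτ => ht₀ τ hτ.1 _ (hU τ) (hdot τ)
    rw [intervalIntegral.integral_const, intervalIntegral.integral_const_mul, smul_eq_mul] at h3
    calc φ₄ ^ 2 * (δ * (t - t₀)) ≤ φ₄ ^ 2 * (k * ∫ τ in t₀..t, (u τ).1) := by
          exact mul_le_mul_of_nonneg_left (by linarith) hφ.le
      _ = φ₄ * k * (w t - w t₀) := by rw [hwdef]; simp only; rw [hw]; ring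
      _ ≤ |φ₄ * k| * |w t - w t₀| := by rw [← abs_mul]; exact le_abs_self _
      _ ≤ |φ₄ * k| * (2 * B) := by
          gcongr
          have h4 := abs_sub (w t) (w t₀)
          linarith [hB t, hB t₀]
  have hBk : 0 ≤ |φ₄ * k| * (2 * B) := by
    have := (abs_nonneg _).trans (hB 0)
    positivity
  have h5 := hgrow (t₀ + (|φ₄ * k| * (2 * B) + 1) / (φ₄ ^ 2 * δ)) (by
    have : 0 ≤ (|φ₄ * k| * (2 * B) + 1) / (φ₄ ^ 2 * δ) := by positivity
    linarith)
  rw [add_sub_cancel_left, ← mul_assoc, mul_div_cancel₀ _ (by positivity)] at h5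
  linarith

theorem IsAngularMotion.exists_next_zero (hF : ∀ w, F w = 0 → w = 0)
    (hE : |E| < |φ₄| * F (0, 1)) (h : IsAngularMotion F φ₄ E θ) {a : ℝ}
    (h0 : ∀ᶠ t in 𝓝[>] a, deriv θ t ≠ 0) :
    ∃ T > a, deriv θ T = 0 ∧ ∀ t ∈ Ioo a T, deriv θ t ≠ 0 :=
  exists_first_zero h.continuous_deriv (h.exists_deriv_eq_zero hF hE a) h0

/-- At an intermediate energy the motion starts in a direction determined by its initial data. -/
theorem exists_local_direction (hF : ∀ w, F w = 0 → w = 0) (hE : |E| < |φ₄| * F (0, 1))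
    {θ θ' : ℝ → ℝ} (h : IsAngularMotion F φ₄ E θ) (h' : IsAngularMotion F φ₄ E θ') {s : ℝ}
    (hs : θ s = θ' s) (hd : deriv θ s = deriv θ' s) :
    ∃ σ : ℝ, (σ = 1 ∨ σ = -1) ∧
      ∀ᶠ t in 𝓝[>] s, 0 < σ * deriv θ t ∧ 0 < σ * deriv θ' t := by
  -- At a turning point the direction is a function of the position alone, hence common to both
  -- motions; elsewhere continuity of the common velocity decides.
  rcases eq_or_ne (deriv θ s) 0 with h0 | h0
  · obtain ⟨σ, hσ⟩ := exists_crossing_direction hF hE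
    have hsub : 𝓝[>] s ≤ 𝓝[≠] s := nhdsWithin_mono s fun t (ht : s < t) => ht.ne'
    have e1 := (hσ θ h s h0).filter_mono hsub
    have e2 := (hσ θ' h' s (hd ▸ h0)).filter_mono hsub
    rw [← hs] at e2
    have key : ∀ x d : ℝ, 0 < x → 0 < σ (θ s) * (x * d) → 0 < σ (θ s) * d := fun x d hx hxd => by
      have : σ (θ s) * (x * d) = x * (σ (θ s) * d) := by ring
      rw [this] at hxd
      exact (mul_pos_iff_of_pos_left hx).1 hxd
    rcases lt_trichotomy (σ (θ s)) 0 with hlt | heq | hgt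
    · refine ⟨-1, Or.inr rfl, ?_⟩
      filter_upwards [e1, e2, self_mem_nhdsWithin] with t h1 h2 h3
      have h4 := key _ _ (sub_pos.2 h3) h1
      have h5 := key _ _ (sub_pos.2 h3) h2
      constructor <;> nlinarith
    · obtain ⟨t, h1⟩ := e1.exists
      rw [heq, zero_mul] at h1
      exact absurd h1 (lt_irrefl 0)
    · refine ⟨1, Or.inl rfl, ?_⟩
      filter_upwards [e1, e2, self_mem_nhdsWithin] with t h1 h2 h3
      have h4 := key _ _ (sub_pos.2 h3) h1
      have h5 := key _ _ (sub_pos.2 h3) h2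
      constructor <;> nlinarith
  · obtain ⟨σ, hσ, hpos⟩ : ∃ σ : ℝ, (σ = 1 ∨ σ = -1) ∧ 0 < σ * deriv θ s := by
      rcases lt_or_gt_of_ne h0 with hlt | hgt
      · exact ⟨-1, Or.inr rfl, by linarith⟩
      · exact ⟨1, Or.inl rfl, by linarith⟩
    refine ⟨σ, hσ, Filter.Eventually.filter_mono nhdsWithin_le_nhds ?_⟩
    have e1 : Continuous fun t => σ * deriv θ t := continuous_const.mul h.continuous_deriv
    have e2 : Continuous fun t => σ * deriv θ' t := continuous_const.mul h'.continuous_deriv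
    exact (e1.continuousAt.eventually_const_lt hpos).and
      (e2.continuousAt.eventually_const_lt (by beta_reduce; rw [← hd]; exact hpos))

/-- At an intermediate energy the motion is determined by its initial data. -/
theorem IsAngularMotion.eq_of_initial (hF : ∀ w, F w = 0 → w = 0) (hE : |E| < |φ₄| * F (0, 1))
    {θ θ' : ℝ → ℝ} (h : IsAngularMotion F φ₄ E θ) (h' : IsAngularMotion F φ₄ E θ') {a : ℝ}
    (ha : θ a = θ' a) (hda : deriv θ a = deriv θ' a) {b : ℝ} (hab : a ≤ b) : θ b = θ' b := by
  -- A continuity argument in time. Beyond a common state both motions go in one direction, and the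
  -- same elapsed time is an integral of `1/√R` up to either position, which forces the positions to
  -- agree.
  set S := {t | θ t = θ' t ∧ deriv θ t = deriv θ' t} with hS
  have hcl : IsClosed S :=
    (isClosed_eq h.contDiff.continuous h'.contDiff.continuous).inter
      (isClosed_eq h.continuous_deriv h'.continuous_deriv)
  suffices H : Icc a b ⊆ S from (H (right_mem_Icc.2 hab)).1
  refine (hcl.inter isClosed_Icc).Icc_subset_of_forall_exists_gt ⟨ha, hda⟩ ?_
  rintro s ⟨⟨hs, hds⟩, -⟩ y hy
  obtain ⟨σ, hσ, hev⟩ := exists_local_direction hF hE h h' hs hds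
  obtain ⟨ε, hε, hI⟩ := mem_nhdsGT_iff_exists_Ioo_subset.1 hev
  obtain ⟨t, hst, ht⟩ := exists_between (lt_min hε (mem_Ioi.1 hy))
  have htε := ht.trans_le (min_le_left _ _)
  have hsub : ∀ τ ∈ Ioo s t, 0 < σ * deriv θ τ ∧ 0 < σ * deriv θ' τ := fun τ hτ =>
    hI ⟨hτ.1, hτ.2.trans htε⟩
  obtain ⟨i1, e1⟩ := integral_inv_sqrt_of_motion hσ hst h.contDiff (h.deriv_sq hF)
    fun τ hτ => (hsub τ hτ).1
  obtain ⟨i2, e2⟩ := integral_inv_sqrt_of_motion hσ hst h'.contDiff (h'.deriv_sq hF)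
    fun τ hτ => (hsub τ hτ).2
  rw [← hs] at i2 e2
  have hpos : ∀ ξ ∈ Ioo (min (θ t) (θ' t)) (max (θ t) (θ' t)),
      0 < 1 / √(energySpeedSq F φ₄ E ξ) := by
    intro ξ hξ
    have hmono : ∀ f : ℝ → ℝ, ContDiff ℝ 1 f → (∀ τ ∈ Ioo s t, 0 < σ * deriv f τ) →
        σ * f s < σ * f t := fun f hf hpos => by
      have hm : StrictMonoOn (fun τ => σ * f τ) (Icc s t) :=
        strictMonoOn_of_deriv_pos (convex_Icc s t)
          (continuous_const.mul hf.continuous).continuousOn (by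
            rw [interior_Icc]
            intro τ hτ
            rw [deriv_const_mul _ (hf.differentiable one_ne_zero τ)]
            exact hpos τ hτ)
      exact hm (left_mem_Icc.2 hst.le) (right_mem_Icc.2 hst.le) hst
    have m1 := hmono θ h.contDiff fun τ hτ => (hsub τ hτ).1
    have m2 := hmono θ' h'.contDiff fun τ hτ => (hsub τ hτ).2
    rw [← hs] at m2
    -- A point strictly between the two positions has been passed by the motion that is further
    -- along, with nonzero velocity.
    have himg : (∃ τ ∈ Ioo s t, θ τ = ξ) ∨ ∃ τ ∈ Ioo s t, θ' τ = ξ := by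
      have iv1 := intermediate_value_Ioo hst.le h.contDiff.continuous.continuousOn
      have iv1' := intermediate_value_Ioo' hst.le h.contDiff.continuous.continuousOn
      have iv2 := intermediate_value_Ioo hst.le h'.contDiff.continuous.continuousOn
      have iv2' := intermediate_value_Ioo' hst.le h'.contDiff.continuous.continuousOn
      rw [← hs] at iv2 iv2'
      rcases le_total (θ t) (θ' t) with hle | hle
      · rw [min_eq_left hle, max_eq_right hle] at hξ
        rcases hσ with rfl | rfl
        · exact Or.inr (iv2 ⟨by linarith [hξ.1], hξ.2⟩)
        · exact Or.inl (iv1' ⟨hξ.1, by linarith [hξ.2]⟩)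
      · rw [min_eq_right hle, max_eq_left hle] at hξ
        rcases hσ with rfl | rfl
        · exact Or.inl (iv1 ⟨by linarith [hξ.1], hξ.2⟩)
        · exact Or.inr (iv2' ⟨hξ.1, by linarith [hξ.2]⟩)
    have hq : 0 < energySpeedSq F φ₄ E ξ := by
      rcases himg with ⟨τ, hτ, rfl⟩ | ⟨τ, hτ, rfl⟩
      · rw [← h.deriv_sq hF]
        exact sq_pos_of_ne_zero (right_ne_zero_of_mul (hsub τ hτ).1.ne')
      · rw [← h'.deriv_sq hF]
        exact sq_pos_of_ne_zero (right_ne_zero_of_mul (hsub τ hτ).2.ne')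
    exact div_pos one_pos (Real.sqrt_pos.2 hq)
  have heq : θ t = θ' t := eq_of_integral_eq_of_pos i1 i2 hpos (e1.trans e2.symm)
  refine ⟨t, ⟨heq, ?_⟩, hst, (ht.trans_le (min_le_right _ _)).le⟩
  have hsq : deriv θ t ^ 2 = deriv θ' t ^ 2 := by rw [h.deriv_sq hF, h'.deriv_sq hF, heq]
  obtain ⟨p1, p2⟩ : 0 < σ * deriv θ t ∧ 0 < σ * deriv θ' t := hI ⟨hst, htε⟩
  rcases sq_eq_sq_iff_eq_or_eq_neg.1 hsq with he | he
  · exact he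
  · rw [he] at p1
    linarith

/-- The motion reflected in time about `T` has the same position and, since the velocity vanishes,
the same velocity at `T`; uniqueness applies. -/
theorem IsAngularMotion.even_about_zero (hF : ∀ w, F w = 0 → w = 0)
    (hE : |E| < |φ₄| * F (0, 1)) (h : IsAngularMotion F φ₄ E θ) {T : ℝ} (hT : deriv θ T = 0)
    (t : ℝ) : θ (T + t) = θ (T - t) := by
  have key : ∀ b, T ≤ b → θ b = θ (2 * T - b) := fun b hb =>
    h.eq_of_initial hF hE (h.comp_const_sub (2 * T)) (a := T) (by congr 1; ring)
      (by rw [deriv_comp_const_sub, show 2 * T - T = T by ring, hT, neg_zero]) hb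
  rcases le_total 0 t with ht | ht
  · rw [key (T + t) (by linarith)]
    congr 1
    ring
  · rw [key (T - t) (by linarith)]
    congr 1
    ring

end AngularMotion

/-! ### The time as a function of the angle -/

section Time

variable {F : Seminorm ℝ (ℝ × ℝ)} {φ₁ φ₂ φ₃ φ₄ E : ℝ} {θ : ℝ → ℝ}

/-- Reduces the integrand to the common form `1/√R`, with the sign of the initial velocity. The
identity also holds at zeros of `R`, where both sides are 0 by the convention for division. -/
theorem timeIntegrand_eq (hF : ∀ w, F w = 0 → w = 0) (hφ₃ : φ₃ ≠ 0) (ξ : ℝ) :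
    timeIntegrand F φ₂ φ₃ φ₄ ξ =
      Real.sign φ₃ * (1 / √(energySpeedSq F φ₄ (casimirEnergy φ₂ φ₃ φ₄) ξ)) := by
  have hr := polarRadius_pos hF ξ
  have h1 : 1 + 2 * φ₄ / φ₃ ^ 2 * (polarRadius F ξ * Real.sin ξ - φ₂) =
      (φ₃ ^ 2 + 2 * φ₄ * (polarRadius F ξ * Real.sin ξ - φ₂)) / φ₃ ^ 2 := by
    field_simp
  rw [← angularSpeedSq_eq, angularSpeedSq, timeIntegrand, h1, Real.sqrt_div' _ (sq_nonneg φ₃),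
    Real.sqrt_div' _ (pow_pos hr 4).le, Real.sqrt_sq_eq_abs,
    show polarRadius F ξ ^ 4 = (polarRadius F ξ ^ 2) ^ 2 by ring, Real.sqrt_sq (sq_nonneg _)]
  rcases lt_or_gt_of_ne hφ₃ with h | h
  · rw [Real.sign_of_neg h, abs_of_neg h, mul_div_assoc', div_neg, mul_div_cancel_left₀ _ hφ₃,
      one_div_div, neg_one_mul, div_neg]
  · rw [Real.sign_of_pos h, abs_of_pos h, mul_div_assoc', mul_div_cancel_left₀ _ hφ₃,
      one_div_div, one_mul]

theorem timeIntegrandZero_eq (hF : ∀ w, F w = 0 → w = 0) (ξ : ℝ) :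
    timeIntegrandZero F φ₂ φ₄ ξ = 1 / √(energySpeedSq F φ₄ (casimirEnergy φ₂ 0 φ₄) ξ) := by
  have hr := polarRadius_pos hF ξ
  rw [← angularSpeedSq_eq, angularSpeedSq, timeIntegrandZero, Real.sqrt_div' _ (pow_pos hr 4).le,
    show polarRadius F ξ ^ 4 = (polarRadius F ξ ^ 2) ^ 2 by ring, Real.sqrt_sq (sq_nonneg _),
    one_div_div]
  congr 3
  ring

theorem timeZeroFinite_iff (hF : ∀ w, F w = 0 → w = 0) {a b : ℝ} :
    TimeZeroFinite F φ₂ φ₄ a b ↔ IntervalIntegrable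
      (fun ξ => 1 / √(energySpeedSq F φ₄ (casimirEnergy φ₂ 0 φ₄) ξ)) volume a b := by
  rw [TimeZeroFinite, funext (timeIntegrandZero_eq hF)]

theorem timeOfZero_eq (hF : ∀ w, F w = 0 → w = 0) (a b : ℝ) :
    timeOfZero F φ₂ φ₄ a b =
      ∫ ξ in a..b, 1 / √(energySpeedSq F φ₄ (casimirEnergy φ₂ 0 φ₄) ξ) := by
  rw [timeOfZero, funext (timeIntegrandZero_eq hF)]

theorem sign_mul_sign_self {x : ℝ} (hx : x ≠ 0) : Real.sign x * Real.sign x = 1 := by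
  rcases lt_or_gt_of_ne hx with h | h
  · rw [Real.sign_of_neg h]; norm_num
  · rw [Real.sign_of_pos h]; norm_num

theorem sign_eq_one_or {x : ℝ} (hx : x ≠ 0) : Real.sign x = 1 ∨ Real.sign x = -1 := by
  rcases lt_or_gt_of_ne hx with h | h
  · exact Or.inr (Real.sign_of_neg h)
  · exact Or.inl (Real.sign_of_pos h)

theorem timeFinite_iff (hF : ∀ w, F w = 0 → w = 0) (hφ₃ : φ₃ ≠ 0) {a b : ℝ} :
    TimeFinite F φ₂ φ₃ φ₄ a b ↔ IntervalIntegrable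
      (fun ξ => 1 / √(energySpeedSq F φ₄ (casimirEnergy φ₂ φ₃ φ₄) ξ)) volume a b := by
  rw [TimeFinite, funext (timeIntegrand_eq hF hφ₃)]
  refine ⟨fun h => ?_, fun h => h.const_mul _⟩
  have h1 := h.const_mul (Real.sign φ₃)
  simpa only [← mul_assoc, sign_mul_sign_self hφ₃, one_mul] using h1

theorem timeOf_eq (hF : ∀ w, F w = 0 → w = 0) (hφ₃ : φ₃ ≠ 0) (a b : ℝ) :
    timeOf F φ₂ φ₃ φ₄ a b = Real.sign φ₃ *
      ∫ ξ in a..b, 1 / √(energySpeedSq F φ₄ (casimirEnergy φ₂ φ₃ φ₄) ξ) := by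
  rw [timeOf, funext (timeIntegrand_eq hF hφ₃), intervalIntegral.integral_const_mul]

theorem intervalIntegrable_inv_sqrt (hF : ∀ w, F w = 0 → w = 0) {a b : ℝ}
    (h : ∀ ξ ∈ uIcc a b, 0 < energySpeedSq F φ₄ E ξ) :
    IntervalIntegrable (fun ξ => 1 / √(energySpeedSq F φ₄ E ξ)) volume a b := by
  have h1 := continuous_energySpeedSq hF φ₄ E
  refine ContinuousOn.intervalIntegrable ?_
  exact continuousOn_const.div h1.sqrt.continuousOn fun ξ hξ => (Real.sqrt_pos.2 (h ξ hξ)).ne'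

/-- A motion in the direction of `φ₃` reaches its positions at the times `t(θ)`. -/
theorem IsAngularMotion.timeOf_eq (hF : ∀ w, F w = 0 → w = 0) (hφ₃ : φ₃ ≠ 0)
    (h : IsAngularMotion F φ₄ (casimirEnergy φ₂ φ₃ φ₄) θ) {t : ℝ}
    (hpos : ∀ τ ∈ Ioo (min 0 t) (max 0 t), 0 < Real.sign φ₃ * deriv θ τ) :
    TimeFinite F φ₂ φ₃ φ₄ (θ 0) (θ t) ∧ timeOf F φ₂ φ₃ φ₄ (θ 0) (θ t) = t := by
  obtain ⟨h1, h2⟩ := integral_inv_sqrt_of_motion_uIoo (sign_eq_one_or hφ₃) h.contDiff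
    (h.deriv_sq hF) hpos
  refine ⟨(timeFinite_iff hF hφ₃).2 h1, ?_⟩
  rw [_root_.timeOf_eq hF hφ₃, h2, ← mul_assoc, sign_mul_sign_self hφ₃, one_mul, sub_zero]

theorem sign_mul_pos {x y : ℝ} (hx : x ≠ 0) : 0 < Real.sign x * y ↔ 0 < x * y := by
  rcases lt_or_gt_of_ne hx with h | h
  · rw [Real.sign_of_neg h]
    constructor <;> intro h' <;> nlinarith
  · rw [Real.sign_of_pos h]
    constructor <;> intro h' <;> nlinarith

theorem IsGivenBy.deriv_zero_eq {g : ℝ → Fin 4 → ℝ} {ρ : ℝ → ℝ}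
    (h : IsGivenBy F φ₁ φ₂ φ₃ φ₄ g θ ρ) : polarRadius F (θ 0) ^ 2 * deriv θ 0 = φ₃ := by
  rw [h.angle_eq, h.x_eq, intervalIntegral.integral_same, mul_zero, add_zero]

theorem IsGivenBy.sign_mul_deriv_zero_pos (hF : ∀ w, F w = 0 → w = 0) (hφ₃ : φ₃ ≠ 0)
    {g : ℝ → Fin 4 → ℝ} {ρ : ℝ → ℝ} (h : IsGivenBy F φ₁ φ₂ φ₃ φ₄ g θ ρ) :
    0 < Real.sign φ₃ * deriv θ 0 := by
  have h1 := h.deriv_zero_eq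
  have h2 := pow_pos (polarRadius_pos hF (θ 0)) 2
  rw [sign_mul_pos hφ₃, ← h1]
  have h3 : deriv θ 0 ≠ 0 := fun h3 => hφ₃ (by rw [← h1, h3, mul_zero])
  have : polarRadius F (θ 0) ^ 2 * deriv θ 0 * deriv θ 0 =
    polarRadius F (θ 0) ^ 2 * deriv θ 0 ^ 2 := by ring
  rw [this]
  exact mul_pos h2 (by positivity)

/-- On an interval of times without zeros of the velocity the motion goes in the direction
of `φ₃`. -/
theorem IsGivenBy.sign_mul_deriv_pos (hF : ∀ w, F w = 0 → w = 0) (hφ₃ : φ₃ ≠ 0)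
    {g : ℝ → Fin 4 → ℝ} {ρ : ℝ → ℝ} (h : IsGivenBy F φ₁ φ₂ φ₃ φ₄ g θ ρ) {s : Set ℝ}
    (hs : IsPreconnected s) (h0 : (0 : ℝ) ∈ s) (hne : ∀ t ∈ s, deriv θ t ≠ 0) :
    ∀ t ∈ s, 0 < Real.sign φ₃ * deriv θ t := by
  have hc : Continuous fun t => Real.sign φ₃ * deriv θ t :=
    continuous_const.mul (h.angle_contDiff.continuous_deriv le_rfl)
  have hz := h.sign_mul_deriv_zero_pos hF hφ₃
  rcases pos_or_neg_of_ne_zero hs hc.continuousOn (fun t ht h1 => by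
    rcases mul_eq_zero.1 h1 with h2 | h2
    · rw [h2, zero_mul] at hz
      exact lt_irrefl _ hz
    · exact hne t ht h2) with hp | hn
  · exact hp
  · exact absurd (hn 0 h0) (not_lt.2 hz.le)

/-- A motion that stays where the speed is positive is the inverse of the function `t(θ)`. -/
theorem IsGivenBy.inverse_timeOf (hF : ∀ w, F w = 0 → w = 0) (hφ₃ : φ₃ ≠ 0)
    {g : ℝ → Fin 4 → ℝ} {ρ : ℝ → ℝ} (h : IsGivenBy F φ₁ φ₂ φ₃ φ₄ g θ ρ) {A : Set ℝ}
    (hA : A.OrdConnected) (hθ : ∀ t, θ t ∈ A)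
    (hq : ∀ ξ ∈ A, 0 < energySpeedSq F φ₄ (casimirEnergy φ₂ φ₃ φ₄) ξ) :
    (∀ η ∈ A, TimeFinite F φ₂ φ₃ φ₄ (θ 0) η) ∧
      (∀ t, timeOf F φ₂ φ₃ φ₄ (θ 0) (θ t) = t) ∧
      ∀ η ∈ A, θ (timeOf F φ₂ φ₃ φ₄ (θ 0) η) = η := by
  have hm := h.isAngularMotion hF
  have hne : ∀ t ∈ univ, deriv θ t ≠ 0 := fun t _ h0 => by
    have h1 := hq _ (hθ t)
    rw [← hm.deriv_sq hF, h0] at h1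
    norm_num at h1
  have hpos := h.sign_mul_deriv_pos hF hφ₃ isPreconnected_univ (mem_univ 0) hne
  have hfin : ∀ η ∈ A, IntervalIntegrable
      (fun ξ => 1 / √(energySpeedSq F φ₄ (casimirEnergy φ₂ φ₃ φ₄) ξ)) volume (θ 0) η :=
    fun η hη => intervalIntegrable_inv_sqrt hF fun ξ hξ => hq ξ (hA.uIcc_subset (hθ 0) hη hξ)
  have htime : ∀ t, timeOf F φ₂ φ₃ φ₄ (θ 0) (θ t) = t := fun t =>
    (hm.timeOf_eq hF hφ₃ fun τ _ => hpos τ (mem_univ τ)).2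
  refine ⟨fun η hη => (timeFinite_iff hF hφ₃).2 (hfin η hη), htime, fun η hη => ?_⟩
  -- The position at the time `t(η)` has the same travel time as `η`; the integrand is positive
  -- between the two, so they coincide.
  have h1 := htime (timeOf F φ₂ φ₃ φ₄ (θ 0) η)
  rw [timeOf_eq hF hφ₃, timeOf_eq hF hφ₃] at h1
  have hs : Real.sign φ₃ ≠ 0 := fun h0 => hφ₃ (Real.sign_eq_zero_iff.1 h0)
  rw [timeOf_eq hF hφ₃]
  exact eq_of_integral_eq_of_pos (hfin _ (hθ _)) (hfin η hη) (fun ξ hξ => one_div_pos.2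
    (Real.sqrt_pos.2 (hq ξ (hA.uIcc_subset (hθ _) hη (Ioo_subset_Icc_self hξ)))))
    (mul_left_cancel₀ hs h1)

end Time

/-! ### Metric straight lines -/

section MetricLine

variable {F : Seminorm ℝ (ℝ × ℝ)}

/-- Calibration by a constant covector `h` with `h·w ≤ F(w)` and `h₂ = F(0,1)`: since the
displacement in `x` is zero, the integral of `h·w` along the curve is `F(0,1)` times the
displacement in `y`. The opposite covector handles the other sign. -/
theorem abs_le_of_mem_horizontalLengths (hF : ∀ w, F w = 0 → w = 0) {p q : Fin 4 → ℝ}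
    (hpq : p 0 = q 0) {ℓ : ℝ} (hℓ : ℓ ∈ horizontalLengths F p q) :
    |q 1 - p 1| * F (0, 1) ≤ ℓ := by
  obtain ⟨w, c, hc, hd, rfl, rfl, rfl⟩ := hℓ
  have hfst : ∀ᵐ t ∂volume.restrict (Icc (0 : ℝ) 1),
      HasDerivAt (fun t => c t 0) (w t).1 t ∧ HasDerivAt (fun t => c t 1) (w t).2 t := by
    filter_upwards [hd] with t ht
    rw [leftDifferential_horizontalVector, hasDerivAt_pi] at ht
    exact ⟨by simpa using ht 0, by simpa using ht 1⟩
  have hsub : volume.restrict (uIoc (0 : ℝ) 1) ≤ volume.restrict (Icc (0 : ℝ) 1) :=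
    Measure.restrict_mono (by rw [uIoc_of_le zero_le_one]; exact Ioc_subset_Icc_self) le_rfl
  have hfst' := ae_mono hsub hfst
  have key : ∀ i : Fin 4, ∀ f : ℝ → ℝ, (∀ᵐ t ∂volume.restrict (uIoc (0 : ℝ) 1),
      HasDerivAt (fun t => c t i) (f t) t) →
      IntervalIntegrable f volume 0 1 ∧ ∫ t in (0 : ℝ)..1, f t = c 1 i - c 0 i := by
    intro i f hf
    have hac := absolutelyContinuousOnInterval_apply hc i
    have he : deriv (fun t => c t i) =ᵐ[volume.restrict (uIoc (0 : ℝ) 1)] f := by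
      filter_upwards [hf] with t ht using ht.deriv
    refine ⟨hac.intervalIntegrable_deriv.congr_ae he, ?_⟩
    rw [← hac.integral_deriv_eq_sub]
    exact (intervalIntegral.integral_congr_ae_restrict he).symm
  obtain ⟨i0, e0⟩ := key 0 (fun t => (w t).1) (by filter_upwards [hfst'] with t ht using ht.1)
  obtain ⟨i1, e1⟩ := key 1 (fun t => (w t).2) (by filter_upwards [hfst'] with t ht using ht.2)
  -- The definition of length assumes no measurability of `w`; it follows because the components of
  -- `w` are almost everywhere derivatives of absolutely continuous functions.
  have hw : AEStronglyMeasurable w (volume.restrict (uIoc (0 : ℝ) 1)) :=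
    (i0.aestronglyMeasurable_restrict_uIoc).prodMk i1.aestronglyMeasurable_restrict_uIoc
  have hint : IntervalIntegrable (fun t => F (w t)) volume 0 1 := by
    refine IntervalIntegrable.mono_fun
      ((i0.norm.add i1.norm).const_mul (F (1, 0) + F (0, 1)))
      ((continuous_seminorm_plane F).comp_aestronglyMeasurable hw)
      (Eventually.of_forall fun t => ?_)
    have h0 : 0 ≤ F (1, 0) + F (0, 1) := add_nonneg (apply_nonneg F _) (apply_nonneg F _)
    beta_reduce
    rw [Real.norm_of_nonneg (apply_nonneg F _), Real.norm_of_nonneg (by positivity)]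
    refine (seminorm_plane_le F (w t)).trans (mul_le_mul_of_nonneg_left ?_ h0)
    rw [Prod.norm_def]
    exact max_le (le_add_of_nonneg_right (norm_nonneg _)) (le_add_of_nonneg_left (norm_nonneg _))
  have hbound : ∀ h : ℝ × ℝ, supportNorm F h ≤ 1 → h.2 * (c 1 1 - c 0 1) ≤
      ∫ t in (0 : ℝ)..1, F (w t) := by
    intro h hh
    have h1 := intervalIntegral.integral_mono_on zero_le_one
      ((i0.const_mul h.1).add (i1.const_mul h.2)) hint fun t _ =>
        (dot_le_supportNorm_mul hF h (w t)).trans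
          (mul_le_of_le_one_left (apply_nonneg F _) hh)
    rw [intervalIntegral.integral_add (i0.const_mul h.1) (i1.const_mul h.2),
      intervalIntegral.integral_const_mul, intervalIntegral.integral_const_mul, e0, e1,
      ← hpq, sub_self, mul_zero, zero_add] at h1
    exact h1
  obtain ⟨h, hh, hv⟩ := exists_supporting_covector hF (0, 1)
  have hv2 : h.2 = F (0, 1) := by simpa using hv
  have b1 := hbound h hh
  have b2 := hbound (-h) (by rwa [supportNorm_neg hF])
  rw [Prod.snd_neg] at b2
  rw [hv2] at b1 b2
  rcases abs_cases (c 1 1 - c 0 1) with ⟨h3, -⟩ | ⟨h3, -⟩ <;> rw [h3] <;> linarith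

theorem subFinslerDist_vertical (hF : ∀ w, F w = 0 → w = 0) (a b : ℝ) :
    subFinslerDist F ![0, a, 0, 0] ![0, b, 0, 0] = |b - a| * F (0, 1) := by
  refine IsLeast.csInf_eq ⟨?_, fun ℓ hℓ => ?_⟩
  · have hd : ∀ t : ℝ, HasDerivAt (fun t : ℝ => ![0, a + t * (b - a), 0, 0])
        (leftDifferential ![0, a + t * (b - a), 0, 0] (horizontalVector (0, b - a))) t := by
      intro t
      rw [leftDifferential_horizontalVector, hasDerivAt_pi]
      intro i
      fin_cases i
      · simpa using hasDerivAt_const t (0 : ℝ)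
      · simpa using ((hasDerivAt_id t).mul_const (b - a)).const_add a
      · simpa using hasDerivAt_const t (0 : ℝ)
      · simpa using hasDerivAt_const t (0 : ℝ)
    refine ⟨fun _ => (0, b - a), fun t => ![0, a + t * (b - a), 0, 0], ?_,
      Eventually.of_forall hd, by simp, by simp, ?_⟩
    · refine absolutelyContinuousOnInterval_pi fun i => ?_
      have hl : ∀ (k c : ℝ), AbsolutelyContinuousOnInterval (fun t : ℝ => k + t * c) 0 1 :=
        fun k c => by
          have : LipschitzWith ‖c‖₊ fun t : ℝ => k + t * c := LipschitzWith.of_dist_le_mul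
            fun x y => by
              rw [Real.dist_eq, Real.dist_eq, show k + x * c - (k + y * c) = c * (x - y) by ring,
                abs_mul, coe_nnnorm, Real.norm_eq_abs]
          exact (this.lipschitzOnWith).absolutelyContinuousOnInterval
      fin_cases i
      · simpa using hl 0 0
      · simpa using hl a (b - a)
      · simpa using hl 0 0
      · simpa using hl 0 0
    · have h1 : ((0 : ℝ), b - a) = (b - a) • ((0 : ℝ), (1 : ℝ)) := by ext <;> simp
      rw [intervalIntegral.integral_const, h1, map_smul_eq_mul]
      simp
  · simpa using abs_le_of_mem_horizontalLengths hF (by simp) hℓ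

/-- A constant angle forces `h₃ = 0`, hence `x = 0`, and integrating `h·u = 1` gives `φ₂y = t`. -/
theorem IsGivenBy.isVerticalMetricLine (hF : ∀ w, F w = 0 → w = 0) {φ₁ φ₂ φ₄ : ℝ}
    (hφ₄ : φ₄ ≠ 0) {g : ℝ → Fin 4 → ℝ} {θ ρ : ℝ → ℝ} (h : IsGivenBy F φ₁ φ₂ 0 φ₄ g θ ρ)
    (hθ : ∀ t, θ t = θ 0) (hφ₂ : |φ₂| = F (0, 1)) : IsVerticalMetricLine F g := by
  have hm := seminorm_vertical_pos hF
  have hφ₂0 : φ₂ ≠ 0 := abs_pos.1 (hφ₂ ▸ hm)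
  have hx : ∀ t, g t 0 = 0 := fun t => by
    have h1 := h.angle_eq t
    rw [show deriv θ t = 0 by rw [funext hθ]; exact deriv_const _ _, mul_zero, zero_add] at h1
    exact (mul_eq_zero.1 h1.symm).resolve_left hφ₄
  have hy : ∀ t, g t 1 = t / φ₂ := fun t => by
    have hsupp := fun t => control_support hF (h.choice_mem t)
    obtain ⟨C, hC, hU⟩ := exists_norm_le_of_mem_unitBallOf hF
    have hθc := h.angle_contDiff.continuous
    have i0 := intervalIntegrable_of_abs_le (measurable_controlX hF hθc h.choice_measurable)
      (fun t => (hU _ (hsupp t).1).1) 0 t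
    have i1 := intervalIntegrable_of_abs_le (measurable_controlY hF hθc h.choice_measurable)
      (fun t => (hU _ (hsupp t).1).2) 0 t
    have h1 : ∫ τ in (0 : ℝ)..t, (φ₁ * controlX F (θ τ) (ρ τ) + φ₂ * controlY F (θ τ) (ρ τ)) =
        ∫ τ in (0 : ℝ)..t, (1 : ℝ) := by
      refine intervalIntegral.integral_congr fun τ _ => ?_
      have h2 := (hsupp τ).2
      simp only [hθ τ, h.initial₁, h.initial₂] at h2 ⊢
      exact h2
    rw [intervalIntegral.integral_add (i0.const_mul _) (i1.const_mul _),
      intervalIntegral.integral_const_mul, intervalIntegral.integral_const_mul, ← h.x_eq,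
      ← h.y_eq, hx, mul_zero, zero_add, intervalIntegral.integral_const, smul_eq_mul, mul_one,
      sub_zero] at h1
    rw [eq_div_iff hφ₂0, mul_comm, h1]
  have hz : ∀ t, g t 2 = 0 := fun t => by
    rw [h.z_eq, hθ, h.initial₁, hx]
    ring
  have hv : ∀ t, g t 3 = 0 := fun t => by
    rw [h.v_eq, hz, hx, hy, mul_div_cancel₀ _ hφ₂0]
    ring
  have hg : ∀ t, g t = ![0, t / φ₂, 0, 0] := fun t => by
    ext i
    fin_cases i
    · simpa using hx t
    · simpa using hy t
    · simpa using hz t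
    · simpa using hv t
  refine ⟨?_, fun s t => ?_⟩
  · rcases abs_choice φ₂ with h1 | h1
    · left
      intro t
      rw [hg, ← hφ₂, h1]
    · right
      intro t
      rw [hg, ← hφ₂, h1, div_neg, neg_neg]
  · rw [hg, hg, subFinslerDist_vertical hF, ← hφ₂, ← sub_div, abs_div,
      div_mul_cancel₀ _ (abs_pos.2 hφ₂0).ne']

end MetricLine

/-! ### The energy levels -/

section Energy

variable {F : Seminorm ℝ (ℝ × ℝ)} {φ₁ φ₂ φ₃ φ₄ : ℝ} {g : ℝ → Fin 4 → ℝ} {θ ρ : ℝ → ℝ}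

theorem IsGivenBy.abs_mul_le (hF : ∀ w, F w = 0 → w = 0) (h : IsGivenBy F φ₁ φ₂ φ₃ φ₄ g θ ρ) :
    |φ₂ * φ₄| ≤ |φ₄| * F (0, 1) := by
  rw [abs_mul, mul_comm, ← h.initial₂]
  exact mul_le_mul_of_nonneg_left (abs_polarH2_le hF (θ 0)) (abs_nonneg _)

/-- For `φ₃ = 0` the energy is a value of the potential and lies in its range; for `φ₃ ≠ 0` it
exceeds such a value, so it cannot be the minimum. -/
theorem IsGivenBy.energy_cases (hF : ∀ w, F w = 0 → w = 0) (h : IsGivenBy F φ₁ φ₂ φ₃ φ₄ g θ ρ) :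
    (φ₃ ≠ 0 ∧ energyMax F φ₄ < casimirEnergy φ₂ φ₃ φ₄) ∨
      (φ₃ = 0 ∧ casimirEnergy φ₂ φ₃ φ₄ = energyMin F φ₄) ∨
      (energyMin F φ₄ < casimirEnergy φ₂ φ₃ φ₄ ∧ casimirEnergy φ₂ φ₃ φ₄ < energyMax F φ₄) ∨
      (φ₃ ≠ 0 ∧ casimirEnergy φ₂ φ₃ φ₄ = energyMax F φ₄) ∨
      (φ₃ = 0 ∧ casimirEnergy φ₂ φ₃ φ₄ = energyMax F φ₄) := by
  have h1 := abs_le.1 (h.abs_mul_le hF)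
  rw [energyMax_eq hF, energyMin_eq hF, casimirEnergy]
  rcases eq_or_ne φ₃ 0 with rfl | h3
  · rcases eq_or_lt_of_le h1.1 with h4 | h4
    · exact Or.inr (Or.inr (Or.inr (Or.inr ⟨rfl, by linarith⟩)))
    · rcases eq_or_lt_of_le h1.2 with h5 | h5
      · exact Or.inr (Or.inl ⟨rfl, by linarith⟩)
      · exact Or.inr (Or.inr (Or.inl ⟨by linarith, by linarith⟩))
  · have h4 : 0 < φ₃ ^ 2 := by positivity
    rcases lt_trichotomy (φ₃ ^ 2 / 2 - φ₂ * φ₄) (|φ₄| * F (0, 1)) with h5 | h5 | h5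
    · exact Or.inr (Or.inr (Or.inl ⟨by linarith, h5⟩))
    · exact Or.inr (Or.inr (Or.inr (Or.inl ⟨h3, h5⟩)))
    · exact Or.inl ⟨h3, h5⟩

theorem abs_mul_polarH2_le (hF : ∀ w, F w = 0 → w = 0) (φ₄ ξ : ℝ) :
    |φ₄ * polarH2 F ξ| ≤ |φ₄| * F (0, 1) := by
  rw [abs_mul]
  exact mul_le_mul_of_nonneg_left (abs_polarH2_le hF ξ) (abs_nonneg _)

theorem abs_casimirEnergy_lt (hF : ∀ w, F w = 0 → w = 0)
    (h₁ : energyMin F φ₄ < casimirEnergy φ₂ φ₃ φ₄) (h₂ : casimirEnergy φ₂ φ₃ φ₄ < energyMax F φ₄) :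
    |casimirEnergy φ₂ φ₃ φ₄| < |φ₄| * F (0, 1) := by
  rw [energyMin_eq hF] at h₁
  rw [energyMax_eq hF] at h₂
  exact abs_lt.2 ⟨h₁, h₂⟩

theorem abs_eq_of_mul_eq {m s : ℝ} (hφ₄ : φ₄ ≠ 0) (hm : 0 < m) (hs : |s| = 1)
    (h : φ₂ * φ₄ = s * (|φ₄| * m)) : |φ₂| = m := by
  have h1 := congrArg abs h
  rw [abs_mul, abs_mul, abs_mul, abs_abs, hs, one_mul, mul_comm, abs_of_pos hm] at h1
  exact mul_left_cancel₀ (abs_ne_zero.2 hφ₄) h1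

/-! ### Energies outside of the range of the potential -/

theorem IsGivenBy.inverse_of_energyMax_lt (hF : ∀ w, F w = 0 → w = 0) (hφ₃ : φ₃ ≠ 0)
    (hE : energyMax F φ₄ < casimirEnergy φ₂ φ₃ φ₄) (h : IsGivenBy F φ₁ φ₂ φ₃ φ₄ g θ ρ) :
    (∀ η, TimeFinite F φ₂ φ₃ φ₄ (θ 0) η) ∧ (∀ t, timeOf F φ₂ φ₃ φ₄ (θ 0) (θ t) = t) ∧
      ∀ η, θ (timeOf F φ₂ φ₃ φ₄ (θ 0) η) = η := by
  rw [energyMax_eq hF] at hE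
  have h1 := h.inverse_timeOf hF hφ₃ ordConnected_univ (fun t => mem_univ _) fun ξ _ => by
    rw [energySpeedSq_pos_iff hF]
    linarith [(abs_le.1 (abs_mul_polarH2_le hF φ₄ ξ)).1]
  exact ⟨fun η => h1.1 η (mem_univ η), h1.2.1, fun η => h1.2.2 η (mem_univ η)⟩

theorem IsGivenBy.const_of_energyMin (hF : ∀ w, F w = 0 → w = 0) (hφ₄ : φ₄ ≠ 0)
    (hE : casimirEnergy φ₂ 0 φ₄ = energyMin F φ₄) (h : IsGivenBy F φ₁ φ₂ 0 φ₄ g θ ρ) :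
    (∀ t, θ t = θ 0) ∧ IsVerticalMetricLine F g := by
  have hm := h.isAngularMotion hF
  rw [energyMin_eq hF] at hE
  have hd : ∀ t, deriv θ t = 0 := fun t => by
    rw [hm.deriv_eq_zero_iff hF]
    refine le_antisymm ?_ (hm.energy_nonneg t)
    linarith [(abs_le.1 (abs_mul_polarH2_le hF φ₄ (θ t))).2]
  have hθ : ∀ t, θ t = θ 0 := fun t =>
    is_const_of_deriv_eq_zero (h.angle_contDiff.differentiable one_ne_zero) hd t 0
  refine ⟨hθ, h.isVerticalMetricLine hF hφ₄ hθ
    (abs_eq_of_mul_eq (s := 1) hφ₄ (seminorm_vertical_pos hF) abs_one ?_)⟩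
  rw [casimirEnergy] at hE
  linarith

theorem abs_eq_of_energyMax (hF : ∀ w, F w = 0 → w = 0) (hφ₄ : φ₄ ≠ 0)
    (hE : casimirEnergy φ₂ 0 φ₄ = energyMax F φ₄) : |φ₂| = F (0, 1) := by
  rw [energyMax_eq hF, casimirEnergy] at hE
  refine abs_eq_of_mul_eq (s := -1) hφ₄ (seminorm_vertical_pos hF) (by simp) ?_
  linarith

/-! ### Intermediate energies -/

theorem IsAngularMotion.exists_prev_zero (hF : ∀ w, F w = 0 → w = 0) {E : ℝ}
    (hE : |E| < |φ₄| * F (0, 1)) (h : IsAngularMotion F φ₄ E θ) {a : ℝ} (h0 : deriv θ a ≠ 0) :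
    ∃ T < a, deriv θ T = 0 ∧ ∀ t ∈ Ioo T a, deriv θ t ≠ 0 := by
  have hd : ∀ t, deriv (fun t => θ (0 - t)) t = -deriv θ (0 - t) := fun t =>
    deriv_comp_const_sub θ 0 t
  obtain ⟨T, hT, hT0, hne⟩ := (h.comp_const_sub 0).exists_next_zero hF hE (a := -a)
    (by
      refine Filter.Eventually.filter_mono nhdsWithin_le_nhds ?_
      refine (h.comp_const_sub 0).continuous_deriv.continuousAt.eventually_ne ?_
      rw [hd]
      simpa using h0)
  refine ⟨-T, by linarith, by rw [hd] at hT0; simpa using hT0, fun t ht => ?_⟩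
  have h1 := hne (-t) ⟨by linarith [ht.2], by linarith [ht.1]⟩
  rw [hd] at h1
  simpa using h1

theorem IsAngularMotion.isReflectionPeriodic (hF : ∀ w, F w = 0 → w = 0) {E : ℝ}
    (hE : |E| < |φ₄| * F (0, 1)) (h : IsAngularMotion F φ₄ E θ) {t₁ t₂ : ℝ}
    (h₁ : deriv θ t₁ = 0) (h₂ : deriv θ t₂ = 0) : IsReflectionPeriodic θ t₁ t₂ :=
  IsReflectionPeriodic.of_even (h.even_about_zero hF hE h₁) (h.even_about_zero hF hE h₂)

theorem IsAngularMotion.exists_isReflectionPeriodic (hF : ∀ w, F w = 0 → w = 0) {E : ℝ}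
    (hE : |E| < |φ₄| * F (0, 1)) (h : IsAngularMotion F φ₄ E θ) :
    ∃ t₁ t₂ : ℝ, t₁ ≠ t₂ ∧ IsReflectionPeriodic θ t₁ t₂ := by
  obtain ⟨t₁, -, h₁⟩ := h.exists_deriv_eq_zero hF hE 0
  obtain ⟨t₂, h12, h₂⟩ := h.exists_deriv_eq_zero hF hE t₁
  exact ⟨t₁, t₂, (ne_of_lt h12), h.isReflectionPeriodic hF hE h₁ h₂⟩

theorem strictMonoOn_sign_mul {σ a b : ℝ} (hθ : ContDiff ℝ 1 θ)
    (hpos : ∀ t ∈ Ioo a b, 0 < σ * deriv θ t) : StrictMonoOn (fun t => σ * θ t) (Icc a b) :=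
  strictMonoOn_of_deriv_pos (convex_Icc a b) (continuous_const.mul hθ.continuous).continuousOn (by
    rw [interior_Icc]
    intro t ht
    rw [deriv_const_mul _ (hθ.differentiable one_ne_zero t)]
    exact hpos t ht)

theorem mem_image_of_mem_Ioo_min_max {f : ℝ → ℝ} (hf : Continuous f) {a b ξ : ℝ} (hab : a ≤ b)
    (hξ : ξ ∈ Ioo (min (f a) (f b)) (max (f a) (f b))) : ∃ t ∈ Ioo a b, f t = ξ := by
  rcases le_total (f a) (f b) with h | h
  · rw [min_eq_left h, max_eq_right h] at hξ
    exact intermediate_value_Ioo hab hf.continuousOn hξ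
  · rw [min_eq_right h, max_eq_left h] at hξ
    exact intermediate_value_Ioo' hab hf.continuousOn hξ

theorem mem_image_of_mem_uIcc {f : ℝ → ℝ} (hf : Continuous f) {a b ξ : ℝ} (hab : a ≤ b)
    (hξ : ξ ∈ uIcc (f a) (f b)) : ∃ t ∈ Icc a b, f t = ξ := by
  have h := intermediate_value_uIcc (f := f) (a := a) (b := b) hf.continuousOn hξ
  rwa [uIcc_of_le hab] at h

/-- The two angles are the positions at the last zero of the velocity before time 0 and the first
zero after it. Between these times the motion is monotone in the direction of `φ₃`, so it runs
through the whole interval and the times are given by the integral. -/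
theorem IsGivenBy.oscillation (hF : ∀ w, F w = 0 → w = 0) (hφ₃ : φ₃ ≠ 0)
    (hE : |casimirEnergy φ₂ φ₃ φ₄| < |φ₄| * F (0, 1)) (h : IsGivenBy F φ₁ φ₂ φ₃ φ₄ g θ ρ) :
    ∃ θ₁ θ₂ : ℝ, φ₃ * (θ₁ - θ 0) < 0 ∧ 0 < φ₃ * (θ₂ - θ 0) ∧
      angularSpeedSq F φ₂ φ₃ φ₄ θ₁ = 0 ∧ angularSpeedSq F φ₂ φ₃ φ₄ θ₂ = 0 ∧
      (∀ ξ ∈ Ioo (min θ₁ θ₂) (max θ₁ θ₂), angularSpeedSq F φ₂ φ₃ φ₄ ξ ≠ 0) ∧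
      polarH2 F (θ 0) = φ₂ ∧
      TimeFinite F φ₂ φ₃ φ₄ (θ 0) θ₁ ∧ TimeFinite F φ₂ φ₃ φ₄ (θ 0) θ₂ ∧
      timeOf F φ₂ φ₃ φ₄ (θ 0) θ₁ ≠ timeOf F φ₂ φ₃ φ₄ (θ 0) θ₂ ∧
      (∀ η ∈ uIcc θ₁ θ₂, θ (timeOf F φ₂ φ₃ φ₄ (θ 0) η) = η) ∧
      IsReflectionPeriodic θ (timeOf F φ₂ φ₃ φ₄ (θ 0) θ₁) (timeOf F φ₂ φ₃ φ₄ (θ 0) θ₂) := by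
  have hm := h.isAngularMotion hF
  have hz := h.sign_mul_deriv_zero_pos hF hφ₃
  have hz0 : deriv θ 0 ≠ 0 := right_ne_zero_of_mul hz.ne'
  obtain ⟨T₁, hT₁, hd₁, hne₁⟩ := hm.exists_prev_zero hF hE hz0
  obtain ⟨T₂, hT₂, hd₂, hne₂⟩ := hm.exists_next_zero hF hE (a := 0)
    ((hm.continuous_deriv.continuousAt.eventually_ne hz0).filter_mono nhdsWithin_le_nhds)
  have hpos : ∀ t ∈ Ioo T₁ T₂, 0 < Real.sign φ₃ * deriv θ t :=
    h.sign_mul_deriv_pos hF hφ₃ isPreconnected_Ioo ⟨hT₁, hT₂⟩ fun t ht => by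
      rcases lt_trichotomy t 0 with h0 | rfl | h0
      · exact hne₁ t ⟨ht.1, h0⟩
      · exact hz0
      · exact hne₂ t ⟨h0, ht.2⟩
  have htime : ∀ t ∈ Icc T₁ T₂, TimeFinite F φ₂ φ₃ φ₄ (θ 0) (θ t) ∧
      timeOf F φ₂ φ₃ φ₄ (θ 0) (θ t) = t := fun t ht =>
    hm.timeOf_eq hF hφ₃ fun τ hτ => hpos τ
      ⟨(le_min hT₁.le ht.1).trans_lt hτ.1, hτ.2.trans_le (max_le hT₂.le ht.2)⟩
  have h1 : T₁ ∈ Icc T₁ T₂ := left_mem_Icc.2 (hT₁.trans hT₂).le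
  have h2 : T₂ ∈ Icc T₁ T₂ := right_mem_Icc.2 (hT₁.trans hT₂).le
  have h0 : (0 : ℝ) ∈ Icc T₁ T₂ := ⟨hT₁.le, hT₂.le⟩
  have hmono := strictMonoOn_sign_mul h.angle_contDiff hpos
  have hq : ∀ t, angularSpeedSq F φ₂ φ₃ φ₄ (θ t) = deriv θ t ^ 2 := fun t => (h.angle_sq_eq t).symm
  refine ⟨θ T₁, θ T₂, ?_, ?_, by rw [hq, hd₁]; norm_num, by rw [hq, hd₂]; norm_num, ?_, h.initial₂,
    (htime _ h1).1, (htime _ h2).1, ?_, ?_, ?_⟩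
  · have := (sign_mul_pos hφ₃ (y := θ 0 - θ T₁)).1 (by
      have := hmono h1 h0 hT₁
      simp only at this
      linarith)
    linarith
  · refine (sign_mul_pos hφ₃).1 ?_
    have := hmono h0 h2 hT₂
    simp only at this
    linarith
  · intro ξ hξ
    obtain ⟨t, ht, rfl⟩ := mem_image_of_mem_Ioo_min_max h.angle_contDiff.continuous
      (hT₁.trans hT₂).le hξ
    rw [hq]
    exact pow_ne_zero 2 (right_ne_zero_of_mul (hpos t ht).ne')
  · rw [(htime _ h1).2, (htime _ h2).2]
    exact (hT₁.trans hT₂).ne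
  · intro η hη
    obtain ⟨t, ht, rfl⟩ := mem_image_of_mem_uIcc h.angle_contDiff.continuous
      (hT₁.trans hT₂).le hη
    rw [(htime t ht).2]
  · rw [(htime _ h1).2, (htime _ h2).2]
    exact hm.isReflectionPeriodic hF hE hd₁ hd₂

theorem IsGivenBy.oscillation_from_rest (hF : ∀ w, F w = 0 → w = 0)
    (hE : |casimirEnergy φ₂ 0 φ₄| < |φ₄| * F (0, 1)) (h : IsGivenBy F φ₁ φ₂ 0 φ₄ g θ ρ) :
    ∃ θ₂ : ℝ, θ₂ ≠ θ 0 ∧ polarH2 F (θ 0) = polarH2 F θ₂ ∧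
      (∀ ξ ∈ Ioo (min (θ 0) θ₂) (max (θ 0) θ₂), 0 < φ₄ * (polarH2 F ξ - polarH2 F (θ 0))) ∧
      polarH2 F (θ 0) = φ₂ ∧
      TimeZeroFinite F φ₂ φ₄ (θ 0) θ₂ ∧
      Real.sign (φ₄ * (θ₂ - θ 0)) * timeOfZero F φ₂ φ₄ (θ 0) θ₂ ≠ 0 ∧
      (∀ η ∈ uIcc (θ 0) θ₂,
        θ (Real.sign (φ₄ * (θ₂ - θ 0)) * timeOfZero F φ₂ φ₄ (θ 0) η) = η) ∧
      IsReflectionPeriodic θ 0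
        (Real.sign (φ₄ * (θ₂ - θ 0)) * timeOfZero F φ₂ φ₄ (θ 0) θ₂) := by
  have hm := h.isAngularMotion hF
  have hφ₄ := energy_coeff_ne_zero hE
  have hd0 : deriv θ 0 = 0 := by
    have h1 := h.deriv_zero_eq
    exact (mul_eq_zero.1 h1).resolve_left (pow_pos (polarRadius_pos hF _) 2).ne'
  obtain ⟨σ, hσ, hev⟩ := exists_local_direction hF hE hm hm (s := 0) rfl rfl
  have hev' : ∀ᶠ t in 𝓝[>] (0 : ℝ), 0 < σ * deriv θ t := hev.mono fun t ht => ht.1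
  obtain ⟨T, hT, hdT, hne⟩ := hm.exists_next_zero hF hE (a := 0)
    (hev'.mono fun t ht => right_ne_zero_of_mul ht.ne')
  have hσ0 : σ ≠ 0 := by rcases hσ with rfl | rfl <;> norm_num
  have hpos : ∀ t ∈ Ioo 0 T, 0 < σ * deriv θ t := by
    rcases pos_or_neg_of_ne_zero isPreconnected_Ioo
      (continuous_const.mul hm.continuous_deriv).continuousOn
      (fun t ht => mul_ne_zero hσ0 (hne t ht)) with hp | hn
    · exact hp
    · obtain ⟨t, h1, h2⟩ := (hev'.and (Ioo_mem_nhdsGT hT)).exists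
      exact absurd (hn t h2) (not_lt.2 h1.le)
  have hmono := strictMonoOn_sign_mul h.angle_contDiff hpos
  have h0 : (0 : ℝ) ∈ Icc 0 T := left_mem_Icc.2 hT.le
  have h2 : T ∈ Icc 0 T := right_mem_Icc.2 hT.le
  have hlt : 0 < σ * (θ T - θ 0) := by
    have := hmono h0 h2 hT
    simp only at this
    linarith
  have htime : ∀ t ∈ Icc 0 T, TimeZeroFinite F φ₂ φ₄ (θ 0) (θ t) ∧
      timeOfZero F φ₂ φ₄ (θ 0) (θ t) = σ * t := fun t ht => by
    obtain ⟨h3, h4⟩ := integral_inv_sqrt_of_motion_uIoo hσ h.angle_contDiff (hm.deriv_sq hF)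
      (s := 0) (t := t) fun τ hτ => hpos τ (by
        rw [min_eq_left ht.1, max_eq_right ht.1] at hτ
        exact ⟨hτ.1, hτ.2.trans_le ht.2⟩)
    rw [sub_zero] at h4
    exact ⟨(timeZeroFinite_iff hF).2 h3, by rw [timeOfZero_eq hF, h4]⟩
  -- The unsigned integral up to `θ(t)` is `σt`, where `σ` is the direction of departure. Hence the
  -- prescribed sign yields the time `sign(φ₄) t`, possibly negative; the symmetry about time 0
  -- makes either sign correct.
  have hsign : Real.sign (φ₄ * (θ T - θ 0)) * σ = Real.sign φ₄ := by
    rcases hσ with rfl | rfl <;> rcases lt_or_gt_of_ne hφ₄ with h4 | h4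
    · rw [Real.sign_of_neg h4, Real.sign_of_neg (mul_neg_of_neg_of_pos h4 (by linarith)), mul_one]
    · rw [Real.sign_of_pos h4, Real.sign_of_pos (mul_pos h4 (by linarith)), mul_one]
    · rw [Real.sign_of_neg h4, Real.sign_of_pos (mul_pos_of_neg_of_neg h4 (by linarith)), one_mul]
    · rw [Real.sign_of_pos h4, Real.sign_of_neg (mul_neg_of_pos_of_neg h4 (by linarith))]
      norm_num
  have htime' : ∀ t ∈ Icc 0 T, Real.sign (φ₄ * (θ T - θ 0)) * timeOfZero F φ₂ φ₄ (θ 0) (θ t) =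
      Real.sign φ₄ * t := fun t ht => by
    rw [(htime t ht).2, ← mul_assoc, hsign]
  have heven := hm.even_about_zero hF hE hd0
  have hθs : ∀ t, θ (Real.sign φ₄ * t) = θ t := fun t => by
    rcases sign_eq_one_or hφ₄ with h4 | h4
    · rw [h4, one_mul]
    · rw [h4, neg_one_mul]
      simpa using (heven t).symm
  have hdT' : deriv θ (Real.sign φ₄ * T) = 0 := by
    rw [hm.deriv_eq_zero_iff hF, hθs]
    exact (hm.deriv_eq_zero_iff hF).1 hdT
  have he0 := (hm.deriv_eq_zero_iff hF).1 hd0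
  have heT := (hm.deriv_eq_zero_iff hF).1 hdT
  refine ⟨θ T, fun h3 => ?_, ?_, ?_, h.initial₂, (htime T h2).1, ?_, ?_, ?_⟩
  · rw [h3, sub_self, mul_zero] at hlt
    exact lt_irrefl _ hlt
  · exact mul_left_cancel₀ hφ₄ (by linarith)
  · intro ξ hξ
    obtain ⟨t, ht, rfl⟩ := mem_image_of_mem_Ioo_min_max h.angle_contDiff.continuous hT.le hξ
    have h3 := (hm.deriv_eq_zero_iff hF (t := t)).not.1 (hne t ht)
    have h4 := lt_of_le_of_ne (hm.energy_nonneg t) (Ne.symm h3)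
    linarith
  · rw [htime' T h2]
    refine mul_ne_zero (fun h3 => hφ₄ (Real.sign_eq_zero_iff.1 h3)) hT.ne'
  · intro η hη
    obtain ⟨t, ht, rfl⟩ := mem_image_of_mem_uIcc h.angle_contDiff.continuous hT.le hη
    rw [htime' t ht, hθs]
  · rw [htime' T h2]
    exact hm.isReflectionPeriodic hF hE hd0 hdT'

end Energy

/-! ### Motions at the highest energy are extremal -/

section Realization

variable {F : Seminorm ℝ (ℝ × ℝ)} {φ₁ φ₂ φ₃ φ₄ E : ℝ} {θ : ℝ → ℝ}

/-- A function whose square varies slowly in comparison with its absolute value is Lipschitz. -/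
theorem lipschitzWith_of_abs_sq_sub_sq_le {w : ℝ → ℝ} (hw : Continuous w) {L : NNReal}
    (h : ∀ s t, s ≤ t → ∀ M, (∀ τ ∈ Icc s t, |w τ| ≤ M) → |w t ^ 2 - w s ^ 2| ≤ L * M * (t - s)) :
    LipschitzWith L w := by
  have key : ∀ s t, s ≤ t → |w t| ≤ |w s| + L * (t - s) ∧ |w s| ≤ |w t| + L * (t - s) := by
    intro s t hst
    -- At a maximum `c` of `|w|` on the interval the bound reads `w(c)² - x² ≤ L|w(c)|(t - s)` for
    -- either end value `x`, and dividing by `|w(c)|` gives a Lipschitz estimate for `|w|`.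
    obtain ⟨c, hc, hmax⟩ := isCompact_Icc.exists_isMaxOn (nonempty_Icc.2 hst)
      hw.abs.continuousOn
    have hle : ∀ τ ∈ Icc s t, |w τ| ≤ |w c| := fun τ hτ => hmax hτ
    have hL : 0 ≤ L * (t - s) := mul_nonneg L.2 (sub_nonneg.2 hst)
    have h1 := abs_le.1 (h s c hc.1 |w c| fun τ hτ => hle τ ⟨hτ.1, hτ.2.trans hc.2⟩)
    have h2 := abs_le.1 (h c t hc.2 |w c| fun τ hτ => hle τ ⟨hc.1.trans hτ.1, hτ.2⟩)
    have e1 : L * |w c| * (c - s) ≤ L * |w c| * (t - s) :=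
      mul_le_mul_of_nonneg_left (by linarith [hc.2]) (mul_nonneg L.2 (abs_nonneg _))
    have e2 : L * |w c| * (t - c) ≤ L * |w c| * (t - s) :=
      mul_le_mul_of_nonneg_left (by linarith [hc.1]) (mul_nonneg L.2 (abs_nonneg _))
    have main : ∀ x, |x| ≤ |w c| → w c ^ 2 - x ^ 2 ≤ L * |w c| * (t - s) →
        |w c| ≤ |x| + L * (t - s) := by
      intro x hx hsq
      by_contra! hlt
      rw [← sq_abs, ← sq_abs x] at hsq
      have hxn := abs_nonneg x
      have h3 : |x| ^ 2 ≤ |x| * |w c| := by nlinarith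
      have h4 : 0 < |w c| := by linarith
      nlinarith
    have hs := main (w s) (hle s ⟨le_rfl, hst⟩) (by linarith)
    have ht := main (w t) (hle t ⟨hst, le_rfl⟩) (by linarith)
    exact ⟨(hle t ⟨hst, le_rfl⟩).trans hs, (hle s ⟨le_rfl, hst⟩).trans ht⟩
  have main : ∀ s t, s ≤ t → |w s - w t| ≤ L * (t - s) := by
    intro s t hst
    obtain ⟨h1, h2⟩ := key s t hst
    -- The estimate for `|w|` passes to `w`: at a zero the interval is split, and without zeros `w`
    -- keeps its sign.
    by_cases hz : ∃ c ∈ Icc s t, w c = 0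
    · obtain ⟨c, hc, hc0⟩ := hz
      have h3 := (key s c hc.1).2
      have h4 := (key c t hc.2).1
      rw [hc0, abs_zero, zero_add] at h3 h4
      calc |w s - w t| ≤ |w s| + |w t| := abs_sub _ _
        _ ≤ L * (c - s) + L * (t - c) := add_le_add h3 h4
        _ = L * (t - s) := by ring
    · push Not at hz
      rcases pos_or_neg_of_ne_zero isPreconnected_Icc hw.continuousOn hz with hp | hn
      · rw [abs_of_pos (hp s ⟨le_rfl, hst⟩), abs_of_pos (hp t ⟨hst, le_rfl⟩)] at h1 h2
        exact abs_le.2 ⟨by linarith, by linarith⟩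
      · rw [abs_of_neg (hn s ⟨le_rfl, hst⟩), abs_of_neg (hn t ⟨hst, le_rfl⟩)] at h1 h2
        exact abs_le.2 ⟨by linarith, by linarith⟩
  refine LipschitzWith.of_dist_le_mul fun s t => ?_
  rw [Real.dist_eq, Real.dist_eq]
  rcases le_total s t with hst | hst
  · rw [abs_of_nonpos (sub_nonpos.2 hst)]
    linarith [main s t hst]
  · rw [abs_of_nonneg (sub_nonneg.2 hst), abs_sub_comm]
    exact main t s hst

/-- The derivative of a function vanishes at almost all of its zeros. -/
theorem ae_hasDerivAt_zero_of_eq_zero (w : ℝ → ℝ) :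
    ∀ᵐ t, w t = 0 → DifferentiableAt ℝ w t → HasDerivAt w 0 t := by
  -- A zero with nonzero derivative is isolated from the right, and a subset of the line has only
  -- countably many such points.
  have hcount := (countable_setOfPred_isolated_right_within (s := {t | w t = 0})).measure_zero volume
  filter_upwards [measure_eq_zero_iff_ae_notMem.1 hcount] with t ht h0 hd
  by_contra hne
  have hd0 : deriv w t ≠ 0 := fun h => hne (h ▸ hd.hasDerivAt)
  have hev := hd.hasDerivAt.eventually_ne hd0 (c := 0)
  refine ht ⟨h0, ?_⟩
  have hev' : ∀ᶠ s in 𝓝[{t | w t = 0} ∩ Ioi t] t, False := by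
    have h1 := hev.filter_mono (nhdsWithin_mono t (s := {t | w t = 0} ∩ Ioi t)
      fun s hs => (ne_of_gt hs.2 : s ≠ t))
    filter_upwards [h1, self_mem_nhdsWithin] with s hs1 hs2 using hs1 hs2.1
  exact Filter.eventually_false_iff_eq_bot.1 hev'

theorem absolutelyContinuousOnInterval_polarH2 (hF : ∀ w, F w = 0 → w = 0) (hθ : ContDiff ℝ 1 θ)
    (a b : ℝ) : AbsolutelyContinuousOnInterval (fun t => polarH2 F (θ t)) a b := by
  obtain ⟨K, hK⟩ := lipschitz_polarRadius hF
  exact (hK.absolutelyContinuousOnInterval_comp hθ a b).mul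
    (Real.contDiff_sin.comp hθ).contDiffOn.absolutelyContinuousOnInterval

/-- At the highest energy every solution of the equation for the square of the velocity comes from
a control. -/
theorem exists_choice_of_deriv_sq (hF : ∀ w, F w = 0 → w = 0) (hφ₄ : φ₄ ≠ 0)
    (hE : E = |φ₄| * F (0, 1)) (hθ : ContDiff ℝ 1 θ)
    (hsq : ∀ t, deriv θ t ^ 2 = energySpeedSq F φ₄ E (θ t)) :
    ∃ ρ : ℝ → ℝ, Measurable ρ ∧ (∀ t, IsRadiusDerivValue F (θ t) (ρ t)) ∧
      ∀ s t, polarRadius F (θ t) ^ 2 * deriv θ t - polarRadius F (θ s) ^ 2 * deriv θ s =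
        φ₄ * ∫ τ in s..t, controlX F (θ τ) (ρ τ) := by
  have hm := seminorm_vertical_pos hF
  have hθc := hθ.continuous
  have hr := fun t => polarRadius_pos hF (θ t)
  set w : ℝ → ℝ := fun t => polarRadius F (θ t) ^ 2 * deriv θ t with hwdef
  have hwc : Continuous w :=
    (((continuous_polarRadius hF).comp hθc).pow 2).mul (hθ.continuous_deriv le_rfl)
  have hwsq : ∀ t, w t ^ 2 = 2 * (E + φ₄ * polarH2 F (θ t)) := fun t => by
    have := (hr t).ne'
    simp only [hwdef]
    rw [mul_pow, hsq, energySpeedSq]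
    field_simp
  obtain ⟨C, hC, hU⟩ := exists_norm_le_of_mem_unitBallOf hF
  set ρ₀ : ℝ → ℝ := fun t => derivWithin (polarRadius F) (Ici (θ t)) (θ t) with hρ₀
  have hρ₀m : Measurable ρ₀ := (measurable_derivWithin_Ici (polarRadius F)).comp hθc.measurable
  have hρ₀v : ∀ t, IsRadiusDerivValue F (θ t) (ρ₀ t) := fun t =>
    isRadiusDerivValue_derivWithin_Ici hF _
  have hsupp := fun t => control_support hF (hρ₀v t)
  have hpolar := ae_hasDerivAt_polar hF hθ
    (u := fun t => (controlX F (θ t) (ρ₀ t), controlY F (θ t) (ρ₀ t))) (fun t => (hsupp t).1)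
    fun t => (hsupp t).2
  have hh2 : ∀ᵐ t, HasDerivAt (fun t => polarH2 F (θ t)) (w t * controlX F (θ t) (ρ₀ t)) t :=
    hpolar.mono fun t ht => ht.2
  -- The square of the momentum satisfies `(w²)˙ = 2φ₄wu₁`, which gives no information on `ẇ` at
  -- zeros of `w`; the Lipschitz bound supplies the absolute continuity there.
  have hlip : LipschitzWith (2 * ‖φ₄‖₊ * C.toNNReal) w := by
    refine lipschitzWith_of_abs_sq_sub_sq_le hwc fun s t hst M hM => ?_
    have h1 := sub_eq_integral_of_ae_hasDerivAt
      (absolutelyContinuousOnInterval_polarH2 hF hθ) hh2 s t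
    have h2 : ‖∫ τ in s..t, w τ * controlX F (θ τ) (ρ₀ τ)‖ ≤ M * C * |t - s| := by
      refine intervalIntegral.norm_integral_le_of_norm_le_const fun τ hτ => ?_
      rw [uIoc_of_le hst] at hτ
      have h3 := hM τ (Ioc_subset_Icc_self hτ)
      rw [Real.norm_eq_abs, abs_mul]
      exact mul_le_mul h3 (hU _ (hsupp τ).1).1 (abs_nonneg _) ((abs_nonneg _).trans h3)
    rw [← h1, Real.norm_eq_abs, abs_of_nonneg (sub_nonneg.2 hst)] at h2
    have h4 : w t ^ 2 - w s ^ 2 = 2 * φ₄ * (polarH2 F (θ t) - polarH2 F (θ s)) := by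
      rw [hwsq, hwsq]
      ring
    rw [h4, abs_mul, abs_mul, abs_two]
    push_cast
    rw [Real.coe_toNNReal _ hC.le, Real.norm_eq_abs]
    calc 2 * |φ₄| * |polarH2 F (θ t) - polarH2 F (θ s)| ≤ 2 * |φ₄| * (M * C * (t - s)) :=
          mul_le_mul_of_nonneg_left h2 (by positivity)
      _ = 2 * |φ₄| * C * M * (t - s) := by ring
  have hac : ∀ a b, AbsolutelyContinuousOnInterval w a b := fun a b =>
    hlip.lipschitzOnWith.absolutelyContinuousOnInterval
  -- Where the momentum vanishes, the vertical control `(0, 1/h₂)` is used, so that `u₁ = 0`. It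
  -- lies in `U` because at the highest energy such an angle has `|h₂| = F(0,1)`.
  set ρ : ℝ → ℝ := fun t => if w t = 0 then
    polarRadius F (θ t) ^ 2 * (0 * Real.sin (θ t) - 1 / polarH2 F (θ t) * Real.cos (θ t))
    else ρ₀ t with hρ
  have hzero : ∀ t, w t = 0 → (0, 1 / polarH2 F (θ t)) ∈ unitBallOf F ∧
      polarRadius F (θ t) * Real.cos (θ t) * 0 +
        polarRadius F (θ t) * Real.sin (θ t) * (1 / polarH2 F (θ t)) = 1 := fun t ht => by
    have h1 := hwsq t
    rw [ht, hE] at h1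
    have h2 : |polarH2 F (θ t)| = F (0, 1) :=
      abs_eq_of_mul_eq (s := -1) hφ₄ hm (by simp) (by linarith)
    have h3 : polarH2 F (θ t) ≠ 0 := abs_pos.1 (h2 ▸ hm)
    constructor
    · have h4 : ((0 : ℝ), 1 / polarH2 F (θ t)) = (1 / polarH2 F (θ t)) • ((0 : ℝ), (1 : ℝ)) := by
        ext <;> simp
      rw [unitBallOf, mem_ofPred_eq, h4, map_smul_eq_mul, Real.norm_eq_abs, abs_div, h2, abs_one,
        one_div_mul_cancel hm.ne']
    · rw [mul_zero, zero_add]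
      exact mul_one_div_cancel h3
  have hρv : ∀ t, IsRadiusDerivValue F (θ t) (ρ t) := fun t => by
    by_cases h : w t = 0
    · simp only [hρ, if_pos h]
      exact (isRadiusDerivValue_of_support hF (hzero t h).1 (hzero t h).2).1
    · simp only [hρ, if_neg h]
      exact hρ₀v t
  have hρm : Measurable ρ := by
    refine Measurable.ite (isClosed_eq hwc continuous_const).measurableSet ?_ hρ₀m
    have h1 : Measurable fun t => polarRadius F (θ t) :=
      ((continuous_polarRadius hF).comp hθc).measurable
    have h2 : Measurable fun t => polarH2 F (θ t) :=
      ((continuous_polarH2 hF).comp hθc).measurable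
    have hc : Measurable fun t => Real.cos (θ t) := (Real.continuous_cos.comp hθc).measurable
    have hs : Measurable fun t => Real.sin (θ t) := (Real.continuous_sin.comp hθc).measurable
    exact (h1.pow_const 2).mul ((hs.const_mul 0).sub ((h2.const_div 1).mul hc))
  refine ⟨ρ, hρm, hρv, fun s t => ?_⟩
  rw [← intervalIntegral.integral_const_mul]
  refine sub_eq_integral_of_ae_hasDerivAt hac ?_ s t
  -- Off the zeros of `w` the derivative of `w²` is divided by `2w`; at almost all zeros `ẇ = 0`, in
  -- agreement with the vertical control.
  filter_upwards [hh2, ae_differentiableAt_of_forall_absolutelyContinuousOnInterval hac,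
    ae_hasDerivAt_zero_of_eq_zero w] with t h1 h2 h3
  by_cases h : w t = 0
  · have h4 : controlX F (θ t) (ρ t) = 0 := by
      simp only [hρ, if_pos h]
      exact (isRadiusDerivValue_of_support hF (hzero t h).1 (hzero t h).2).2.1
    rw [h4, mul_zero]
    exact h3 h h2
  · have h4 : ρ t = ρ₀ t := by simp only [hρ, if_neg h]
    have h5 : HasDerivAt (fun t => w t ^ 2) (2 * (φ₄ * (w t * controlX F (θ t) (ρ₀ t)))) t := by
      rw [funext hwsq]
      exact ((h1.const_mul φ₄).const_add E).const_mul 2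
    have h6 := h2.hasDerivAt.pow 2
    have h7 := h6.unique h5
    have h8 : deriv w t = φ₄ * controlX F (θ t) (ρ t) := by
      rw [h4]
      refine mul_left_cancel₀ h ?_
      norm_num at h7
      linarith
    rw [← h8]
    exact h2.hasDerivAt

theorem exists_isNormalExtremal_of_deriv_sq (hF : ∀ w, F w = 0 → w = 0) (hφ₄ : φ₄ ≠ 0)
    (hE : casimirEnergy φ₂ φ₃ φ₄ = energyMax F φ₄) (hθ : ContDiff ℝ 1 θ)
    (hsq : ∀ t, deriv θ t ^ 2 = energySpeedSq F φ₄ (casimirEnergy φ₂ φ₃ φ₄) (θ t))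
    (h₁ : polarRadius F (θ 0) * Real.cos (θ 0) = φ₁)
    (h₂ : polarRadius F (θ 0) * Real.sin (θ 0) = φ₂)
    (h₃ : polarRadius F (θ 0) ^ 2 * deriv θ 0 = φ₃) :
    ∃ g, IsNormalExtremal F φ₁ φ₂ φ₃ φ₄ g θ := by
  obtain ⟨ρ, hρm, hρv, hw⟩ := exists_choice_of_deriv_sq hF hφ₄
    (hE.trans (energyMax_eq hF φ₄)) hθ hsq
  set x : ℝ → ℝ := fun t => ∫ τ in (0 : ℝ)..t, controlX F (θ τ) (ρ τ) with hx
  set y : ℝ → ℝ := fun t => ∫ τ in (0 : ℝ)..t, controlY F (θ τ) (ρ τ) with hy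
  set z : ℝ → ℝ := fun t => -(1 / φ₄) *
    (polarRadius F (θ t) * Real.cos (θ t) - φ₁ + (φ₃ + (1 / 2) * φ₄ * x t) * y t) with hz
  set v : ℝ → ℝ := fun t => (1 / (3 * φ₄)) *
    (t - φ₁ * x t - φ₂ * y t - (2 * φ₃ + (1 / 2) * φ₄ * x t) * z t) with hv
  refine ⟨fun t => ![x t, y t, z t, v t], IsGivenBy.isNormalExtremal hF hφ₄ (θ := θ) (ρ := ρ)
    ⟨hθ, h₁, h₂, hρm, hρv, fun t => ?_, fun t => ?_, fun t => rfl, fun t => rfl, fun t => rfl,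
      fun t => rfl⟩⟩
  · have h4 := hw 0 t
    rw [h₃] at h4
    change _ = φ₃ + φ₄ * x t
    linarith
  · rw [angularSpeedSq_eq, hsq]

end Realization

/-! ### Motions with a given square of the velocity -/

section SpeedMotion

/-- A continuously differentiable motion on the line with the square of the velocity `q`. -/
structure IsSpeedMotion (q θ : ℝ → ℝ) : Prop where
  contDiff : ContDiff ℝ 1 θ
  deriv_sq : ∀ t, deriv θ t ^ 2 = q (θ t)

variable {q θ : ℝ → ℝ}

theorem isSpeedMotion_const {η : ℝ} (h : q η = 0) : IsSpeedMotion q fun _ => η :=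
  ⟨contDiff_const, fun t => by simp [h]⟩

theorem IsSpeedMotion.deriv_eq_zero_iff (h : IsSpeedMotion q θ) {t : ℝ} :
    deriv θ t = 0 ↔ q (θ t) = 0 := by
  rw [← h.deriv_sq, sq_eq_zero_iff]

theorem IsSpeedMotion.continuous (h : IsSpeedMotion q θ) : Continuous θ := h.contDiff.continuous

theorem IsSpeedMotion.continuous_deriv (h : IsSpeedMotion q θ) : Continuous (deriv θ) :=
  h.contDiff.continuous_deriv le_rfl

theorem deriv_const_sub_comp (θ : ℝ → ℝ) (T t : ℝ) :
    deriv (fun t => θ (T - t)) t = -deriv θ (T - t) := deriv_comp_const_sub θ T t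

theorem IsSpeedMotion.comp_const_sub (h : IsSpeedMotion q θ) (T : ℝ) :
    IsSpeedMotion q fun t => θ (T - t) :=
  ⟨h.contDiff.comp (contDiff_const.sub contDiff_id), fun t => by
    rw [deriv_const_sub_comp, neg_sq, h.deriv_sq]⟩

theorem IsSpeedMotion.neg (h : IsSpeedMotion q θ) :
    IsSpeedMotion (fun ξ => q (-ξ)) fun t => -θ t :=
  ⟨h.contDiff.neg, fun t => by rw [deriv.fun_neg, neg_sq, neg_neg, h.deriv_sq]⟩

theorem hasDerivAt_ite_le {f g : ℝ → ℝ} {a : ℝ} (hf : Differentiable ℝ f)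
    (hg : Differentiable ℝ g) (h₀ : f a = g a) (h₁ : deriv f a = deriv g a) (t : ℝ) :
    HasDerivAt (fun t => if t ≤ a then f t else g t)
      (if t ≤ a then deriv f t else deriv g t) t := by
  rcases lt_trichotomy t a with h | rfl | h
  · rw [if_pos h.le]
    refine (hf t).hasDerivAt.congr_of_eventuallyEq ?_
    filter_upwards [Iio_mem_nhds h] with s hs
    rw [if_pos (le_of_lt hs)]
  · rw [if_pos le_rfl, ← hasDerivWithinAt_univ, ← Iic_union_Ici (a := t)]
    refine HasDerivWithinAt.union ?_ ?_
    · refine (hf t).hasDerivAt.hasDerivWithinAt.congr (fun s hs => ?_) (if_pos le_rfl)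
      rw [if_pos (mem_Iic.1 hs)]
    · rw [h₁]
      refine (hg t).hasDerivAt.hasDerivWithinAt.congr (fun s hs => ?_) (by rw [if_pos le_rfl, h₀])
      rcases eq_or_lt_of_le (mem_Ici.1 hs) with rfl | hs
      · rw [if_pos le_rfl, h₀]
      · rw [if_neg (not_le.2 hs)]
  · rw [if_neg (not_le.2 h)]
    refine (hg t).hasDerivAt.congr_of_eventuallyEq ?_
    filter_upwards [Ioi_mem_nhds h] with s hs
    rw [if_neg (not_le.2 hs)]

theorem deriv_ite_le {f g : ℝ → ℝ} {a : ℝ} (hf : Differentiable ℝ f)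
    (hg : Differentiable ℝ g) (h₀ : f a = g a) (h₁ : deriv f a = deriv g a) :
    deriv (fun t => if t ≤ a then f t else g t) = fun t =>
      if t ≤ a then deriv f t else deriv g t :=
  funext fun t => (hasDerivAt_ite_le hf hg h₀ h₁ t).deriv

theorem IsSpeedMotion.ite_le {f g : ℝ → ℝ} {a : ℝ} (hf : IsSpeedMotion q f)
    (hg : IsSpeedMotion q g) (h₀ : f a = g a) (h₁ : deriv f a = deriv g a) :
    IsSpeedMotion q fun t => if t ≤ a then f t else g t := by
  have hfd := hf.contDiff.differentiable one_ne_zero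
  have hgd := hg.contDiff.differentiable one_ne_zero
  have hd := deriv_ite_le hfd hgd h₀ h₁
  refine ⟨contDiff_one_iff_deriv.2
    ⟨fun t => (hasDerivAt_ite_le hfd hgd h₀ h₁ t).differentiableAt, ?_⟩, fun t => ?_⟩
  · rw [hd]
    exact hf.continuous_deriv.if_le hg.continuous_deriv continuous_id continuous_const
      fun t ht => by rw [show t = a from ht, h₁]
  · rw [congrFun hd t]
    by_cases h : t ≤ a
    · rw [if_pos h, if_pos h, hf.deriv_sq]
    · rw [if_neg h, if_neg h, hg.deriv_sq]

/-- The motion `θ` up to the time `T`, a rest of length `ℓ`, and the motion `θ` backwards. -/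
noncomputable def pausedMotion (θ : ℝ → ℝ) (T ℓ t : ℝ) : ℝ :=
  if t ≤ T then θ t else if t ≤ T + ℓ then θ T else θ (2 * T + ℓ - t)

/-- The three pieces agree to first order at the joints because the velocity vanishes at `T`, and
the equation for the square of the velocity is insensitive to reversal. -/
theorem IsSpeedMotion.pausedMotion (h : IsSpeedMotion q θ) {T ℓ : ℝ} (hℓ : 0 ≤ ℓ)
    (hT : deriv θ T = 0) : IsSpeedMotion q (pausedMotion θ T ℓ) ∧
      ∀ t ≤ T, deriv (_root_.pausedMotion θ T ℓ) t = deriv θ t := by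
  have hc : IsSpeedMotion q fun _ => θ T := isSpeedMotion_const (h.deriv_eq_zero_iff.1 hT)
  have hr := h.comp_const_sub (2 * T + ℓ)
  have e1 : 2 * T + ℓ - (T + ℓ) = T := by ring
  have a0 : θ T = θ (2 * T + ℓ - (T + ℓ)) := by rw [e1]
  have a1 : deriv (fun _ : ℝ => θ T) (T + ℓ) = deriv (fun t => θ (2 * T + ℓ - t)) (T + ℓ) := by
    rw [deriv_const_sub_comp, e1, hT, deriv_const, neg_zero]
  have h2 := hc.ite_le hr a0 a1
  have b0 : θ T = if T ≤ T + ℓ then θ T else θ (2 * T + ℓ - T) := by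
    rw [if_pos (by linarith)]
  have b1 : deriv θ T = deriv (fun t => if t ≤ T + ℓ then θ T else θ (2 * T + ℓ - t)) T := by
    rw [deriv_ite_le (hc.contDiff.differentiable one_ne_zero)
      (hr.contDiff.differentiable one_ne_zero) a0 a1]
    beta_reduce
    rw [if_pos (by linarith), hT, deriv_const]
  refine ⟨h.ite_le h2 b0 b1, fun t ht => ?_⟩
  have h3 := congrFun (deriv_ite_le (h.contDiff.differentiable one_ne_zero)
    (h2.contDiff.differentiable one_ne_zero) b0 b1) t
  rw [if_pos ht] at h3
  exact h3

/-- There are motions with the initial position `θ₀` and the initial velocity `d` that rest at `η`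
for an arbitrary prescribed time, and the motion is not unique. -/
def HasPauses (q : ℝ → ℝ) (θ₀ d η : ℝ) : Prop :=
  (∃ Θ Θ' : ℝ → ℝ, IsSpeedMotion q Θ ∧ IsSpeedMotion q Θ' ∧ Θ 0 = θ₀ ∧ Θ' 0 = θ₀ ∧
    deriv Θ 0 = d ∧ deriv Θ' 0 = d ∧ Θ ≠ Θ') ∧
  ∀ ℓ : ℝ, 0 < ℓ → ∃ (Θ : ℝ → ℝ) (a b : ℝ), IsSpeedMotion q Θ ∧ Θ 0 = θ₀ ∧ deriv Θ 0 = d ∧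
    b - a = ℓ ∧ (∀ t ∈ Icc a b, Θ t = η) ∧ (∀ᶠ t in 𝓝[<] a, Θ t ≠ η) ∧
    (∀ᶠ t in 𝓝[>] b, Θ t ≠ η)

theorem HasPauses.neg {θ₀ d η : ℝ} (h : HasPauses q θ₀ d η) : HasPauses q θ₀ (-d) η := by
  obtain ⟨⟨Θ, Θ', h1, h2, h3, h4, h5, h6, h7⟩, h8⟩ := h
  refine ⟨⟨fun t => Θ (0 - t), fun t => Θ' (0 - t), h1.comp_const_sub 0, h2.comp_const_sub 0,
    by simpa using h3, by simpa using h4, by rw [deriv_const_sub_comp, sub_zero, h5],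
    by rw [deriv_const_sub_comp, sub_zero, h6], fun h => h7 (funext fun t => ?_)⟩, fun ℓ hℓ => ?_⟩
  · simpa using congrFun h (-t)
  · obtain ⟨Θ, a, b, h1, h2, h3, h4, h5, h6, h7⟩ := h8 ℓ hℓ
    refine ⟨fun t => Θ (0 - t), -b, -a, h1.comp_const_sub 0, by simpa using h2,
      by rw [deriv_const_sub_comp, sub_zero, h3], by linarith,
      fun t ht => h5 _ ⟨by linarith [ht.2], by linarith [ht.1]⟩, ?_, ?_⟩
    · have : Tendsto (fun t : ℝ => 0 - t) (𝓝[<] (-b)) (𝓝[>] b) := by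
        simpa using tendsto_neg_nhdsLT (a := -b)
      exact this.eventually h7
    · have : Tendsto (fun t : ℝ => 0 - t) (𝓝[>] (-a)) (𝓝[<] a) := by
        simpa using tendsto_neg_nhdsGT (a := -a)
      exact this.eventually h6

theorem IsSpeedMotion.hasPauses (h : IsSpeedMotion q θ) {T : ℝ} (hT : 0 ≤ T)
    (hd : deriv θ T = 0) (hne : ∀ᶠ t in 𝓝[<] T, θ t ≠ θ T) :
    HasPauses q (θ 0) (deriv θ 0) (θ T) := by
  have hleft : ∀ ℓ, ∀ t ≤ T, _root_.pausedMotion θ T ℓ t = θ t := fun ℓ t ht => by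
    rw [_root_.pausedMotion, if_pos ht]
  have hmid : ∀ ℓ, ∀ t ∈ Icc T (T + ℓ), _root_.pausedMotion θ T ℓ t = θ T := fun ℓ t ht => by
    rcases eq_or_lt_of_le ht.1 with rfl | h1
    · exact hleft ℓ _ le_rfl
    · rw [_root_.pausedMotion, if_neg (not_le.2 h1), if_pos ht.2]
  have hright : ∀ ℓ, 0 < ℓ → ∀ᶠ t in 𝓝[>] (T + ℓ), _root_.pausedMotion θ T ℓ t ≠ θ T := by
    intro ℓ hℓ
    have h1 : Tendsto (fun t : ℝ => 2 * T + ℓ - t) (𝓝[>] (T + ℓ)) (𝓝[<] T) := by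
      refine tendsto_nhdsWithin_iff.2 ⟨Tendsto.mono_left ?_ nhdsWithin_le_nhds, ?_⟩
      · have : Continuous fun t : ℝ => 2 * T + ℓ - t := by fun_prop
        convert this.tendsto (T + ℓ) using 2
        ring
      · filter_upwards [self_mem_nhdsWithin] with t ht
        rw [mem_Ioi] at ht
        rw [mem_Iio]
        linarith
    filter_upwards [h1.eventually hne, self_mem_nhdsWithin] with t ht htT
    rw [mem_Ioi] at htT
    rw [_root_.pausedMotion, if_neg (by linarith), if_neg (by linarith)]
    exact ht
  -- Pauses of lengths 1 and 2 give two different motions; the initial data are not affected, since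
  -- the pause begins at `T ≥ 0`.
  refine ⟨⟨_root_.pausedMotion θ T 1, _root_.pausedMotion θ T 2,
    (h.pausedMotion zero_le_one hd).1, (h.pausedMotion zero_le_two hd).1, hleft 1 0 hT,
    hleft 2 0 hT, (h.pausedMotion zero_le_one hd).2 0 hT, (h.pausedMotion zero_le_two hd).2 0 hT,
    fun heq => ?_⟩, fun ℓ hℓ => ⟨_root_.pausedMotion θ T ℓ, T, T + ℓ,
    (h.pausedMotion hℓ.le hd).1, hleft ℓ 0 hT, (h.pausedMotion hℓ.le hd).2 0 hT, by ring,
    hmid ℓ, ?_, hright ℓ hℓ⟩⟩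
  · obtain ⟨t, h1, h2⟩ := ((hright 1 one_pos).and
      (Ioo_mem_nhdsGT (show T + 1 < T + 2 by linarith))).exists
    rw [heq] at h1
    exact h1 (hmid 2 t ⟨by linarith [h2.1], h2.2.le⟩)
  · filter_upwards [hne, self_mem_nhdsWithin] with t ht htT
    rw [hleft ℓ t (le_of_lt htT)]
    exact ht

/-- A motion towards a point that can be reached in a finite time reaches it. -/
theorem IsSpeedMotion.exists_hit_of_pos (h : IsSpeedMotion q θ) {η : ℝ} (hη : θ 0 < η)
    (hd : 0 < deriv θ 0) (hq : ∀ ξ ∈ Ico (θ 0) η, q ξ ≠ 0)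
    (hint : IntervalIntegrable (fun ξ => 1 / √(q ξ)) volume (θ 0) η) :
    ∃ T > 0, θ T = η ∧ ∀ t ∈ Ioo 0 T, θ t ≠ η := by
  have hfc : Continuous fun t => θ t - η := h.continuous.sub continuous_const
  suffices hz : ∃ t > 0, θ t - η = 0 by
    obtain ⟨T, hT, hT0, hTne⟩ := exists_first_zero hfc hz
      ((hfc.continuousAt.eventually_ne (sub_neg.2 hη).ne).filter_mono nhdsWithin_le_nhds)
    exact ⟨T, hT, sub_eq_zero.1 hT0, fun t ht => sub_ne_zero.1 (hTne t ht)⟩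
  by_contra! hno
  have hlt : ∀ t, 0 ≤ t → θ t < η := fun t ht => by
    rcases pos_or_neg_of_ne_zero isPreconnected_Ici hfc.continuousOn (s := Ici 0) (fun s hs => by
      rcases eq_or_lt_of_le (mem_Ici.1 hs) with rfl | hs
      · exact (sub_neg.2 hη).ne
      · exact hno s hs) with hp | hn
    · exact absurd (hp 0 self_mem_Ici) (not_lt.2 (sub_neg.2 hη).le)
    · exact sub_neg.1 (hn t ht)
  have hdne : ∀ t > 0, deriv θ t ≠ 0 := by
    by_contra! hz
    obtain ⟨T, hT, hT0, hTne⟩ := exists_first_zero h.continuous_deriv hz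
      ((h.continuous_deriv.continuousAt.eventually_ne hd.ne').filter_mono nhdsWithin_le_nhds)
    have hpos : ∀ t ∈ Ico 0 T, 0 < deriv θ t := by
      rcases pos_or_neg_of_ne_zero isPreconnected_Ico h.continuous_deriv.continuousOn
        (s := Ico 0 T) (fun s hs => by
          rcases eq_or_lt_of_le hs.1 with rfl | hs0
          · exact hd.ne'
          · exact hTne s ⟨hs0, hs.2⟩) with hp | hn
      · exact hp
      · exact absurd (hn 0 ⟨le_rfl, hT⟩) (not_lt.2 hd.le)
    have hmono : StrictMonoOn θ (Icc 0 T) := strictMonoOn_of_deriv_pos (convex_Icc 0 T)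
      h.continuous.continuousOn fun t ht => by
        rw [interior_Icc] at ht
        exact hpos t ⟨ht.1.le, ht.2⟩
    have h1 := hmono (left_mem_Icc.2 (le_of_lt hT)) (right_mem_Icc.2 (le_of_lt hT)) hT
    exact hq (θ T) ⟨h1.le, hlt T (le_of_lt hT)⟩ (h.deriv_eq_zero_iff.1 hT0)
  have hpos : ∀ t > 0, 0 < deriv θ t := by
    rcases pos_or_neg_of_ne_zero isPreconnected_Ici h.continuous_deriv.continuousOn
      (s := Ici 0) (fun s hs => by
        rcases eq_or_lt_of_le (mem_Ici.1 hs) with rfl | hs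
        · exact hd.ne'
        · exact hdne s hs) with hp | hn
    · exact fun t ht => hp t (le_of_lt ht)
    · exact absurd (hn 0 self_mem_Ici) (not_lt.2 hd.le)
  -- A motion that never arrives would keep moving towards `η`, so every elapsed time would be
  -- bounded by this finite integral.
  set K := ∫ ξ in θ 0..η, 1 / √(q ξ) with hK
  have hKt : ∀ t > 0, t ≤ K := fun t ht => by
    obtain ⟨h1, h2⟩ := integral_inv_sqrt_of_deriv_pos ht h.contDiff h.deriv_sq
      fun τ hτ => hpos τ hτ.1
    have hmono : StrictMonoOn θ (Icc 0 t) := strictMonoOn_of_deriv_pos (convex_Icc 0 t)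
      h.continuous.continuousOn fun τ hτ => by
        rw [interior_Icc] at hτ
        exact hpos τ hτ.1
    have h3 := hmono (left_mem_Icc.2 (le_of_lt ht)) (right_mem_Icc.2 (le_of_lt ht)) ht
    have h4 := intervalIntegral.integral_mono_interval le_rfl h3.le (hlt t (le_of_lt ht)).le
      (Eventually.of_forall fun ξ => (by positivity : (0 : ℝ) ≤ 1 / √(q ξ))) hint
    rw [h2] at h4
    linarith
  have hK0 := hKt 1 one_pos
  linarith [hKt (K + 1) (by linarith)]

theorem IsSpeedMotion.hasPauses_of_pos (h : IsSpeedMotion q θ) {η : ℝ} (hη : θ 0 < η)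
    (hd : 0 < deriv θ 0) (hq : ∀ ξ ∈ Ico (θ 0) η, q ξ ≠ 0) (hqη : q η = 0)
    (hint : IntervalIntegrable (fun ξ => 1 / √(q ξ)) volume (θ 0) η) :
    HasPauses q (θ 0) (deriv θ 0) η := by
  obtain ⟨T, hT, hTη, hne⟩ := h.exists_hit_of_pos hη hd hq hint
  have h1 := h.hasPauses (le_of_lt hT) (h.deriv_eq_zero_iff.2 (hTη ▸ hqη)) (by
    filter_upwards [Ioo_mem_nhdsLT hT] with t ht
    rw [hTη]
    exact hne t ht)
  rwa [hTη] at h1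

theorem HasPauses.comp_neg {θ₀ d η : ℝ} (h : HasPauses (fun ξ => q (-ξ)) θ₀ d η) :
    HasPauses q (-θ₀) (-d) (-η) := by
  have hq : (fun ξ => (fun ξ => q (-ξ)) (-ξ)) = q := funext fun ξ => by simp
  obtain ⟨⟨Θ, Θ', h1, h2, h3, h4, h5, h6, h7⟩, h8⟩ := h
  refine ⟨⟨fun t => -Θ t, fun t => -Θ' t, hq ▸ h1.neg, hq ▸ h2.neg, by simp [h3], by simp [h4],
    by rw [deriv.fun_neg, h5], by rw [deriv.fun_neg, h6], fun h => h7 (funext fun t => ?_)⟩,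
    fun ℓ hℓ => ?_⟩
  · exact neg_injective (congrFun h t)
  · obtain ⟨Θ, a, b, h1, h2, h3, h4, h5, h6, h7⟩ := h8 ℓ hℓ
    exact ⟨fun t => -Θ t, a, b, hq ▸ h1.neg, by simp [h2], by rw [deriv.fun_neg, h3], h4,
      fun t ht => by simp [h5 t ht], h6.mono fun t ht h => ht (neg_injective h),
      h7.mono fun t ht h => ht (neg_injective h)⟩

/-- The initial velocity may point away from `η`. Then the reversed motion reaches `η`, and the
pause lies in the past. -/
theorem IsSpeedMotion.hasPauses_right (h : IsSpeedMotion q θ) {η : ℝ} (hη : θ 0 < η)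
    (hq : ∀ ξ ∈ Ico (θ 0) η, q ξ ≠ 0) (hqη : q η = 0)
    (hint : IntervalIntegrable (fun ξ => 1 / √(q ξ)) volume (θ 0) η) :
    HasPauses q (θ 0) (deriv θ 0) η := by
  have hd0 : deriv θ 0 ≠ 0 := h.deriv_eq_zero_iff.not.2 (hq _ ⟨le_rfl, hη⟩)
  rcases lt_or_gt_of_ne hd0 with hd | hd
  · have hr := h.comp_const_sub 0
    have h1 := hr.hasPauses_of_pos (η := η) (by simpa using hη)
      (by rw [deriv_const_sub_comp, sub_zero]; exact neg_pos.2 hd) (by simpa using hq) hqη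
      (by simpa using hint)
    rw [deriv_const_sub_comp, sub_zero] at h1
    simpa using h1.neg
  · exact h.hasPauses_of_pos hη hd hq hqη hint

theorem intervalIntegrable_inv_sqrt_comp_neg {a b : ℝ}
    (h : IntervalIntegrable (fun ξ => 1 / √(q ξ)) volume a b) :
    IntervalIntegrable (fun ξ => 1 / √(q (-ξ))) volume (-a) (-b) := by
  have h1 := IntervalIntegrable.comp_sub_left h 0
  simp only [zero_sub] at h1
  exact h1

theorem IsSpeedMotion.hasPauses_left (h : IsSpeedMotion q θ) {η : ℝ} (hη : η < θ 0)
    (hq : ∀ ξ ∈ Ioc η (θ 0), q ξ ≠ 0) (hqη : q η = 0)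
    (hint : IntervalIntegrable (fun ξ => 1 / √(q ξ)) volume (θ 0) η) :
    HasPauses q (θ 0) (deriv θ 0) η := by
  have h1 := h.neg.hasPauses_right (η := -η) (by linarith)
    (fun ξ hξ => hq _ ⟨by linarith [hξ.2], by linarith [hξ.1]⟩) (by simpa using hqη)
    (intervalIntegrable_inv_sqrt_comp_neg hint)
  have h2 := h1.comp_neg
  rw [deriv.fun_neg] at h2
  simpa using h2

end SpeedMotion

/-! ### The highest energy -/

section HighestEnergy

variable {F : Seminorm ℝ (ℝ × ℝ)} {φ₁ φ₂ φ₃ φ₄ E η : ℝ} {g : ℝ → Fin 4 → ℝ} {θ ρ : ℝ → ℝ}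

theorem IsGivenBy.isSpeedMotion (h : IsGivenBy F φ₁ φ₂ φ₃ φ₄ g θ ρ) :
    IsSpeedMotion (energySpeedSq F φ₄ (casimirEnergy φ₂ φ₃ φ₄)) θ :=
  ⟨h.angle_contDiff, fun t => by rw [h.angle_sq_eq, angularSpeedSq_eq]⟩

theorem IsSpeedMotion.exists_isNormalExtremal (hF : ∀ w, F w = 0 → w = 0) (hφ₄ : φ₄ ≠ 0)
    (hE : casimirEnergy φ₂ φ₃ φ₄ = energyMax F φ₄) (h : IsGivenBy F φ₁ φ₂ φ₃ φ₄ g θ ρ)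
    {Θ : ℝ → ℝ} (hΘ : IsSpeedMotion (energySpeedSq F φ₄ (casimirEnergy φ₂ φ₃ φ₄)) Θ)
    (h₀ : Θ 0 = θ 0) (h₁ : deriv Θ 0 = deriv θ 0) :
    ∃ g', IsNormalExtremal F φ₁ φ₂ φ₃ φ₄ g' Θ :=
  exists_isNormalExtremal_of_deriv_sq hF hφ₄ hE hΘ.contDiff hΘ.deriv_sq (by rw [h₀, h.initial₁])
    (by rw [h₀, h.initial₂]) (by rw [h₀, h₁, h.deriv_zero_eq])

/-- At the highest energy pauses are realized by extremals, because every solution of the speed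
equation with the given initial data is the angle of one. -/
theorem IsGivenBy.of_hasPauses (hF : ∀ w, F w = 0 → w = 0) (hφ₄ : φ₄ ≠ 0)
    (hE : casimirEnergy φ₂ φ₃ φ₄ = energyMax F φ₄) (h : IsGivenBy F φ₁ φ₂ φ₃ φ₄ g θ ρ)
    (hp : HasPauses (energySpeedSq F φ₄ (casimirEnergy φ₂ φ₃ φ₄)) (θ 0) (deriv θ 0) η) :
    AngleNotUnique F φ₁ φ₂ φ₃ φ₄ (θ 0) ∧ HasConstancyIntervals F φ₁ φ₂ φ₃ φ₄ (θ 0) η := by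
  obtain ⟨⟨Θ, Θ', h1, h2, h3, h4, h5, h6, h7⟩, h8⟩ := hp
  constructor
  · obtain ⟨g₁, hg₁⟩ := h1.exists_isNormalExtremal hF hφ₄ hE h h3 h5
    obtain ⟨g₂, hg₂⟩ := h2.exists_isNormalExtremal hF hφ₄ hE h h4 h6
    exact ⟨g₁, g₂, Θ, Θ', hg₁, hg₂, h3, h4, h7⟩
  · intro ℓ hℓ
    obtain ⟨Θ, a, b, h1, h2, h3, h4, h5, h6, h7⟩ := h8 ℓ hℓ
    obtain ⟨g₁, hg₁⟩ := h1.exists_isNormalExtremal hF hφ₄ hE h h2 h3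
    exact ⟨g₁, Θ, a, b, hg₁, h2, h4, h5, h6, h7⟩

theorem exists_energySpeedSq_eq_zero (hF : ∀ w, F w = 0 → w = 0) (hE : E = |φ₄| * F (0, 1)) :
    ∃ ξ, energySpeedSq F φ₄ E ξ = 0 := by
  obtain ⟨ξ, hξ⟩ := exists_polarH2_eq hF
  rcases abs_choice φ₄ with h | h
  · refine ⟨ξ + Real.pi, (energySpeedSq_eq_zero_iff hF).2 ?_⟩
    rw [polarH2_add_pi hF, hξ, hE, h]
    ring
  · refine ⟨ξ, (energySpeedSq_eq_zero_iff hF).2 ?_⟩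
    rw [hξ, hE, h]
    ring

theorem energySpeedSq_nonneg (hF : ∀ w, F w = 0 → w = 0) (hE : E = |φ₄| * F (0, 1)) (ξ : ℝ) :
    0 ≤ energySpeedSq F φ₄ E ξ := by
  have h1 := (abs_le.1 (abs_mul_polarH2_le hF φ₄ ξ)).1
  have h2 := pow_pos (polarRadius_pos hF ξ) 4
  exact div_nonneg (by linarith) h2.le

theorem exists_nearest_zeros (hF : ∀ w, F w = 0 → w = 0) (hE : E = |φ₄| * F (0, 1)) {c : ℝ}
    (hc : energySpeedSq F φ₄ E c ≠ 0) :
    ∃ θ₁ θ₂, θ₁ < c ∧ c < θ₂ ∧ energySpeedSq F φ₄ E θ₁ = 0 ∧ energySpeedSq F φ₄ E θ₂ = 0 ∧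
      ∀ ξ ∈ Ioo θ₁ θ₂, energySpeedSq F φ₄ E ξ ≠ 0 := by
  obtain ⟨ξ, hξ⟩ := exists_energySpeedSq_eq_zero hF hE
  have hq := continuous_energySpeedSq hF φ₄ E
  have hper := energySpeedSq_periodic F φ₄ E
  obtain ⟨y, hy, hye⟩ := hper.exists_mem_Ioc Real.two_pi_pos ξ c
  obtain ⟨y', hy', hye'⟩ := hper.exists_mem_Ico Real.two_pi_pos ξ (c - 2 * Real.pi)
  obtain ⟨θ₂, h2, h20, h2n⟩ := exists_first_zero hq ⟨y, hy.1, by rw [← hye, hξ]⟩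
    ((hq.continuousAt.eventually_ne hc).filter_mono nhdsWithin_le_nhds)
  have hqn : Continuous fun ξ => energySpeedSq F φ₄ E (-ξ) := hq.comp continuous_neg
  obtain ⟨θ₁, h1, h10, h1n⟩ := exists_first_zero hqn (a := -c)
    ⟨-y', by linarith [hy'.2], by rw [neg_neg, ← hye', hξ]⟩
    ((hqn.continuousAt.eventually_ne (by rwa [neg_neg])).filter_mono nhdsWithin_le_nhds)
  refine ⟨-θ₁, θ₂, by linarith, h2, h10, h20, fun ξ hξ => ?_⟩
  rcases lt_trichotomy ξ c with h | rfl | h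
  · have := h1n (-ξ) ⟨by linarith, by linarith [hξ.1]⟩
    rwa [neg_neg] at this
  · exact hc
  · exact h2n ξ ⟨h, hξ.2⟩

theorem exists_first_exit_of_pos (hθ : Continuous θ) {a b t : ℝ} (h0 : θ 0 ∈ Ioo a b)
    (ht : θ t ∉ Ioo a b) (htpos : 0 < t) :
    ∃ T > 0, (θ T = a ∨ θ T = b) ∧ ∀ τ ∈ Ioo 0 T, θ τ ∈ Ioo a b := by
  -- Positive exactly when `θ t` lies in the interval, so leaving the interval through either end is
  -- a zero of one function.
  set f : ℝ → ℝ := fun t => (θ t - a) * (b - θ t) with hf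
  have hfc : Continuous f := (hθ.sub continuous_const).mul (continuous_const.sub hθ)
  have hpos : ∀ t, 0 < f t ↔ θ t ∈ Ioo a b := fun t => by
    constructor
    · intro h
      rcases mul_pos_iff.1 h with h1 | h1
      · exact ⟨by linarith [h1.1], by linarith [h1.2]⟩
      · linarith [h1.1, h1.2, h0.1, h0.2]
    · exact fun h => mul_pos (sub_pos.2 h.1) (sub_pos.2 h.2)
  have hf0 := (hpos 0).2 h0
  have hft : f t ≤ 0 := not_lt.1 ((hpos t).not.2 ht)
  obtain ⟨s, hs, hfs⟩ := intermediate_value_Icc' htpos.le hfc.continuousOn ⟨hft, hf0.le⟩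
  have hs0 : 0 < s := lt_of_le_of_ne hs.1 fun h => by
    rw [← h] at hfs
    exact hf0.ne' hfs
  obtain ⟨T, hT, hT0, hne⟩ := exists_first_zero hfc ⟨s, hs0, hfs⟩
    ((hfc.continuousAt.eventually_ne hf0.ne').filter_mono nhdsWithin_le_nhds)
  refine ⟨T, hT, ?_, fun τ hτ => (hpos τ).1 ?_⟩
  · rcases mul_eq_zero.1 hT0 with h | h
    · exact Or.inl (by linarith)
    · exact Or.inr (by linarith)
  · rcases pos_or_neg_of_ne_zero isPreconnected_Ico hfc.continuousOn (s := Ico 0 T)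
      (fun s hs => by
        rcases eq_or_lt_of_le hs.1 with rfl | hs0
        · exact hf0.ne'
        · exact hne s ⟨hs0, hs.2⟩) with hp | hn
    · exact hp τ ⟨hτ.1.le, hτ.2⟩
    · exact absurd (hn 0 ⟨le_rfl, hT⟩) (not_lt.2 hf0.le)

theorem exists_first_exit (hθ : Continuous θ) {a b t : ℝ} (h0 : θ 0 ∈ Ioo a b)
    (ht : θ t ∉ Ioo a b) :
    ∃ T, (θ T = a ∨ θ T = b) ∧ ∀ τ ∈ Ioo (min 0 T) (max 0 T), θ τ ∈ Ioo a b := by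
  rcases lt_trichotomy t 0 with h | rfl | h
  · obtain ⟨T, hT, hT', hτ⟩ := exists_first_exit_of_pos (θ := fun t => θ (-t))
      (hθ.comp continuous_neg) (t := -t) (by simpa using h0) (by simpa using ht) (by linarith)
    refine ⟨-T, hT', fun τ h1 => ?_⟩
    rw [min_eq_right (by linarith), max_eq_left (by linarith)] at h1
    simpa using hτ (-τ) ⟨by linarith [h1.2], by linarith [h1.1]⟩
  · exact absurd h0 ht
  · obtain ⟨T, hT, hT', hτ⟩ := exists_first_exit_of_pos hθ h0 ht h
    refine ⟨T, hT', fun τ h1 => ?_⟩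
    rw [min_eq_left (le_of_lt hT), max_eq_right (le_of_lt hT)] at h1
    exact hτ τ h1

/-- Arrival at an end point at a time `T` would make the time integral up to that point converge to
`T`. -/
theorem IsGivenBy.mem_Ioo_of_not_timeFinite (hF : ∀ w, F w = 0 → w = 0) (hφ₃ : φ₃ ≠ 0)
    (h : IsGivenBy F φ₁ φ₂ φ₃ φ₄ g θ ρ) {a b : ℝ} (h0 : θ 0 ∈ Ioo a b)
    (hq : ∀ ξ ∈ Ioo a b, energySpeedSq F φ₄ (casimirEnergy φ₂ φ₃ φ₄) ξ ≠ 0)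
    (ha : ¬ TimeFinite F φ₂ φ₃ φ₄ (θ 0) a) (hb : ¬ TimeFinite F φ₂ φ₃ φ₄ (θ 0) b) (t : ℝ) :
    θ t ∈ Ioo a b := by
  by_contra ht
  have hm := h.isAngularMotion hF
  obtain ⟨T, hT, hτ⟩ := exists_first_exit h.angle_contDiff.continuous h0 ht
  have hne : ∀ τ ∈ Ioo (min 0 T) (max 0 T) ∪ {0}, deriv θ τ ≠ 0 := by
    intro τ h1 h2
    rw [h.isSpeedMotion.deriv_eq_zero_iff] at h2
    rcases h1 with h1 | rfl
    · exact hq _ (hτ τ h1) h2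
    · exact hq _ h0 h2
  -- Time 0 is an end point of the interval of motion and must be included, since the sign of the
  -- velocity is known only there.
  have hpre : IsPreconnected (Ioo (min 0 T) (max 0 T) ∪ {0}) := by
    rcases lt_trichotomy T 0 with hT0 | rfl | hT0
    · rw [min_eq_right hT0.le, max_eq_left hT0.le, Ioo_union_right hT0]
      exact isPreconnected_Ioc
    · simp [isPreconnected_singleton]
    · rw [min_eq_left hT0.le, max_eq_right hT0.le, union_comm, singleton_union, Ioo_insert_left hT0]
      exact isPreconnected_Ico
  have hpos := h.sign_mul_deriv_pos hF hφ₃ hpre (Or.inr rfl) hne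
  have hfin := (hm.timeOf_eq hF hφ₃ fun τ h1 => hpos τ (Or.inl h1)).1
  rcases hT with hT | hT
  · exact ha (hT ▸ hfin)
  · exact hb (hT ▸ hfin)

theorem IsGivenBy.deriv_eq_zero_of_const (h : IsGivenBy F φ₁ φ₂ φ₃ φ₄ g θ ρ) {a b : ℝ}
    (hab : a < b) (hc : ∀ t ∈ Icc a b, θ t = θ a) {t : ℝ} (ht : t ∈ Icc a b) : deriv θ t = 0 := by
  have h1 : HasDerivWithinAt θ (deriv θ t) (Icc a b) t :=
    ((h.angle_contDiff.differentiable one_ne_zero) t).hasDerivAt.hasDerivWithinAt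
  have h2 : HasDerivWithinAt θ 0 (Icc a b) t :=
    (hasDerivWithinAt_const t (Icc a b) (θ a)).congr hc (hc t ht)
  exact (uniqueDiffOn_Icc hab t ht).eq_deriv _ h1 h2

/-- A constant angle means `h₃ = 0`, which gives `x`; integrating `h·u = 1` with `x` constant gives
`y`, and `z`, `v` follow from the first integrals. The denominator is `-2E`, nonzero at the highest
energy. -/
theorem IsGivenBy.constancyFormulas (hF : ∀ w, F w = 0 → w = 0) (hφ₄ : φ₄ ≠ 0)
    (hE : casimirEnergy φ₂ φ₃ φ₄ = energyMax F φ₄) (h : IsGivenBy F φ₁ φ₂ φ₃ φ₄ g θ ρ) :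
    ConstancyFormulas φ₂ φ₃ φ₄ g θ := by
  intro a b hab hc t₀ ht₀ t ht
  have hx : ∀ s ∈ Icc a b, g s 0 = -(φ₃ / φ₄) := fun s hs => by
    have h1 := h.angle_eq s
    rw [h.deriv_eq_zero_of_const hab hc hs, mul_zero] at h1
    field_simp
    linarith
  have hH2 : 2 * φ₄ * polarH2 F (θ a) = 2 * φ₂ * φ₄ - φ₃ ^ 2 := by
    have h1 := ((h.isAngularMotion hF).deriv_eq_zero_iff hF).1
      (h.deriv_eq_zero_of_const hab hc (left_mem_Icc.2 hab.le))
    rw [casimirEnergy] at h1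
    linarith
  have hD : 2 * φ₂ * φ₄ - φ₃ ^ 2 ≠ 0 := by
    have hm := seminorm_vertical_pos hF
    have h1 : 0 < |φ₄| * F (0, 1) := mul_pos (abs_pos.2 hφ₄) hm
    rw [energyMax_eq hF, casimirEnergy] at hE
    intro h2
    linarith
  have hy : g t 1 = g t₀ 1 + 2 * φ₄ * (t - t₀) / (2 * φ₂ * φ₄ - φ₃ ^ 2) := by
    have hsupp := fun t => control_support hF (h.choice_mem t)
    obtain ⟨C, hC, hU⟩ := exists_norm_le_of_mem_unitBallOf hF
    have hθc := h.angle_contDiff.continuous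
    have i0 := intervalIntegrable_of_abs_le (measurable_controlX hF hθc h.choice_measurable)
      (fun t => (hU _ (hsupp t).1).1)
    have i1 := intervalIntegrable_of_abs_le (measurable_controlY hF hθc h.choice_measurable)
      (fun t => (hU _ (hsupp t).1).2)
    have h1 : ∫ τ in t₀..t, (polarRadius F (θ a) * Real.cos (θ a) * controlX F (θ τ) (ρ τ) +
        polarH2 F (θ a) * controlY F (θ τ) (ρ τ)) = ∫ τ in t₀..t, (1 : ℝ) := by
      refine intervalIntegral.integral_congr fun τ hτ => ?_
      have h2 := (hsupp τ).2
      rw [← hc τ (uIcc_subset_Icc ht₀ ht hτ)]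
      exact h2
    rw [intervalIntegral.integral_add ((i0 _ _).const_mul _) ((i1 _ _).const_mul _),
      intervalIntegral.integral_const_mul, intervalIntegral.integral_const_mul,
      ← intervalIntegral.integral_interval_sub_left (i0 0 t) (i0 0 t₀),
      ← intervalIntegral.integral_interval_sub_left (i1 0 t) (i1 0 t₀), ← h.x_eq, ← h.x_eq,
      ← h.y_eq, ← h.y_eq, hx t ht, hx t₀ ht₀, sub_self, mul_zero, zero_add,
      intervalIntegral.integral_const, smul_eq_mul, mul_one] at h1
    rw [← h1, ← hH2]
    have h3 : polarH2 F (θ a) ≠ 0 := fun h3 => hD (by rw [← hH2, h3, mul_zero])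
    field_simp
    ring
  have hz : g t 2 = g t₀ 2 + φ₃ * (t - t₀) / (φ₃ ^ 2 - 2 * φ₂ * φ₄) := by
    have hD' : φ₃ ^ 2 - 2 * φ₂ * φ₄ ≠ 0 := fun h1 => hD (by linarith)
    have e : φ₃ * (t - t₀) / (φ₃ ^ 2 - 2 * φ₂ * φ₄) =
        -(φ₃ * (t - t₀) / (2 * φ₂ * φ₄ - φ₃ ^ 2)) := by
      rw [← div_neg]
      congr 1
      ring
    rw [h.z_eq, h.z_eq, hc t ht, hc t₀ ht₀, hx t ht, hx t₀ ht₀, hy, e]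
    field_simp
    ring
  refine ⟨hx t ht, hy, hz, ?_⟩
  have e : φ₃ * (t - t₀) / (φ₃ ^ 2 - 2 * φ₂ * φ₄) =
      -(φ₃ * (t - t₀) / (2 * φ₂ * φ₄ - φ₃ ^ 2)) := by
    rw [← div_neg]
    congr 1
    ring
  rw [h.v_eq, h.v_eq, hx t ht, hx t₀ ht₀, hz, hy, e]
  generalize hDd : 2 * φ₂ * φ₄ - φ₃ ^ 2 = D at hD ⊢
  have hφ₂ : φ₂ = (D + φ₃ ^ 2) / (2 * φ₄) := by
    field_simp
    linarith
  rw [hφ₂]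
  field_simp
  ring

theorem IsGivenBy.highest_energy (hF : ∀ w, F w = 0 → w = 0) (hφ₄ : φ₄ ≠ 0) (hφ₃ : φ₃ ≠ 0)
    (hE : casimirEnergy φ₂ φ₃ φ₄ = energyMax F φ₄) (h : IsGivenBy F φ₁ φ₂ φ₃ φ₄ g θ ρ) :
    ∃ θ₁ θ₂ : ℝ, θ₁ < θ 0 ∧ θ 0 < θ₂ ∧
      angularSpeedSq F φ₂ φ₃ φ₄ θ₁ = 0 ∧ angularSpeedSq F φ₂ φ₃ φ₄ θ₂ = 0 ∧
      (∀ ξ ∈ Ioo θ₁ θ₂, angularSpeedSq F φ₂ φ₃ φ₄ ξ ≠ 0) ∧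
      (¬ TimeFinite F φ₂ φ₃ φ₄ (θ 0) θ₁ → ¬ TimeFinite F φ₂ φ₃ φ₄ (θ 0) θ₂ →
        (∀ t, θ t ∈ Ioo θ₁ θ₂) ∧
        (∀ η ∈ Ioo θ₁ θ₂, TimeFinite F φ₂ φ₃ φ₄ (θ 0) η) ∧
        (∀ t, timeOf F φ₂ φ₃ φ₄ (θ 0) (θ t) = t) ∧
        (∀ η ∈ Ioo θ₁ θ₂, θ (timeOf F φ₂ φ₃ φ₄ (θ 0) η) = η)) ∧
      (TimeFinite F φ₂ φ₃ φ₄ (θ 0) θ₁ ∨ TimeFinite F φ₂ φ₃ φ₄ (θ 0) θ₂ →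
        AngleNotUnique F φ₁ φ₂ φ₃ φ₄ (θ 0)) ∧
      (TimeFinite F φ₂ φ₃ φ₄ (θ 0) θ₁ →
        HasConstancyIntervals F φ₁ φ₂ φ₃ φ₄ (θ 0) θ₁) ∧
      (TimeFinite F φ₂ φ₃ φ₄ (θ 0) θ₂ →
        HasConstancyIntervals F φ₁ φ₂ φ₃ φ₄ (θ 0) θ₂) ∧
      ConstancyFormulas φ₂ φ₃ φ₄ g θ := by
  have hE' := hE.trans (energyMax_eq hF φ₄)
  have hs := h.isSpeedMotion
  have hq0 : energySpeedSq F φ₄ (casimirEnergy φ₂ φ₃ φ₄) (θ 0) ≠ 0 := fun h1 => by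
    rw [← hs.deriv_eq_zero_iff] at h1
    have h2 := h.deriv_zero_eq
    rw [h1, mul_zero] at h2
    exact hφ₃ h2.symm
  obtain ⟨θ₁, θ₂, h1, h2, h10, h20, hne⟩ := exists_nearest_zeros hF hE' hq0
  have p1 : TimeFinite F φ₂ φ₃ φ₄ (θ 0) θ₁ → AngleNotUnique F φ₁ φ₂ φ₃ φ₄ (θ 0) ∧
      HasConstancyIntervals F φ₁ φ₂ φ₃ φ₄ (θ 0) θ₁ := fun hfin =>
    h.of_hasPauses hF hφ₄ hE (hs.hasPauses_left h1
      (fun ξ hξ => hne ξ ⟨hξ.1, hξ.2.trans_lt h2⟩) h10 ((timeFinite_iff hF hφ₃).1 hfin))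
  have p2 : TimeFinite F φ₂ φ₃ φ₄ (θ 0) θ₂ → AngleNotUnique F φ₁ φ₂ φ₃ φ₄ (θ 0) ∧
      HasConstancyIntervals F φ₁ φ₂ φ₃ φ₄ (θ 0) θ₂ := fun hfin =>
    h.of_hasPauses hF hφ₄ hE (hs.hasPauses_right h2
      (fun ξ hξ => hne ξ ⟨h1.trans_le hξ.1, hξ.2⟩) h20 ((timeFinite_iff hF hφ₃).1 hfin))
  refine ⟨θ₁, θ₂, h1, h2, by rw [angularSpeedSq_eq, h10], by rw [angularSpeedSq_eq, h20],
    fun ξ hξ => by rw [angularSpeedSq_eq]; exact hne ξ hξ, fun ha hb => ?_,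
    fun hor => hor.elim (fun hf => (p1 hf).1) fun hf => (p2 hf).1, fun hf => (p1 hf).2,
    fun hf => (p2 hf).2, h.constancyFormulas hF hφ₄ hE⟩
  have hmem := h.mem_Ioo_of_not_timeFinite hF hφ₃ ⟨h1, h2⟩ hne ha hb
  exact ⟨hmem, h.inverse_timeOf hF hφ₃ ordConnected_Ioo hmem fun ξ hξ =>
    lt_of_le_of_ne (energySpeedSq_nonneg hF hE' ξ) (hne ξ hξ).symm⟩

end HighestEnergy

/-! ### Motions that start from rest -/

section StoppedFlow

/-- The velocity of square `q` vanishes at `α` and at `β` and not between them, and a motion leaves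
`α` to the right in a finite time. -/
structure IsDeparture (q : ℝ → ℝ) (α β : ℝ) : Prop where
  continuous : Continuous q
  lt : α < β
  pos : ∀ ξ ∈ Ioo α β, 0 < q ξ
  left_eq_zero : q α = 0
  right_eq_zero : q β = 0
  integrable : ∀ ξ ∈ Ico α β, IntervalIntegrable (fun ζ => 1 / √(q ζ)) volume α ξ

/-- The time of the motion from `α` to `ξ`. -/
noncomputable def travelTime (q : ℝ → ℝ) (α ξ : ℝ) : ℝ := ∫ ζ in α..ξ, 1 / √(q ζ)

/-- The motion that leaves `α` to the right at the time `0` and stops at `β`. -/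
noncomputable def stoppedFlow (q : ℝ → ℝ) (α β t : ℝ) : ℝ :=
  sSup {ξ | ξ ∈ Ico α β ∧ travelTime q α ξ ≤ max t 0}

variable {q : ℝ → ℝ} {α β : ℝ}

theorem IsDeparture.travelTime_sub (h : IsDeparture q α β) {ξ ξ' : ℝ} (hξ : ξ ∈ Ico α β)
    (hξ' : ξ' ∈ Ico α β) :
    travelTime q α ξ' - travelTime q α ξ = ∫ ζ in ξ..ξ', 1 / √(q ζ) :=
  intervalIntegral.integral_interval_sub_left (h.integrable ξ' hξ') (h.integrable ξ hξ)

theorem IsDeparture.travelTime_pos (h : IsDeparture q α β) {ξ : ℝ} (hξ : ξ ∈ Ioo α β) :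
    0 < travelTime q α ξ :=
  intervalIntegral.intervalIntegral_pos_of_pos_on (h.integrable ξ ⟨hξ.1.le, hξ.2⟩)
    (fun ζ hζ => one_div_pos.2 (Real.sqrt_pos.2 (h.pos ζ ⟨hζ.1, hζ.2.trans hξ.2⟩))) hξ.1

theorem IsDeparture.continuousOn_travelTime (h : IsDeparture q α β) {b : ℝ} (hb : b ∈ Ico α β) :
    ContinuousOn (travelTime q α) (Icc α b) := by
  have h1 := intervalIntegral.continuousOn_primitive_interval' (h.integrable b hb) left_mem_uIcc
  rwa [uIcc_of_le hb.1] at h1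

theorem IsDeparture.mem_zero (h : IsDeparture q α β) (t : ℝ) :
    α ∈ {ξ | ξ ∈ Ico α β ∧ travelTime q α ξ ≤ max t 0} :=
  ⟨⟨le_rfl, h.lt⟩, by rw [travelTime, intervalIntegral.integral_same]; exact le_max_right _ _⟩

theorem stoppedFlow_bddAbove (q : ℝ → ℝ) (α β t : ℝ) :
    BddAbove {ξ | ξ ∈ Ico α β ∧ travelTime q α ξ ≤ max t 0} := ⟨β, fun _ hξ => hξ.1.2.le⟩

theorem IsDeparture.le_stoppedFlow (h : IsDeparture q α β) (t : ℝ) : α ≤ stoppedFlow q α β t :=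
  le_csSup (stoppedFlow_bddAbove q α β t) (h.mem_zero t)

theorem IsDeparture.stoppedFlow_le (h : IsDeparture q α β) (t : ℝ) : stoppedFlow q α β t ≤ β :=
  csSup_le ⟨α, h.mem_zero t⟩ fun _ hξ => hξ.1.2.le

theorem IsDeparture.monotone_stoppedFlow (h : IsDeparture q α β) :
    Monotone (stoppedFlow q α β) := fun s t hst =>
  csSup_le_csSup (stoppedFlow_bddAbove q α β t) ⟨α, h.mem_zero s⟩ fun _ hξ =>
    ⟨hξ.1, hξ.2.trans (max_le_max_right 0 hst)⟩

/-- The supremum is attained by continuity, and until the flow stops it inverts the travel time; a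
strict inequality would leave room for a larger point. -/
theorem IsDeparture.travelTime_stoppedFlow (h : IsDeparture q α β) {t : ℝ}
    (ht : stoppedFlow q α β t < β) : travelTime q α (stoppedFlow q α β t) = max t 0 := by
  set S := {ξ | ξ ∈ Ico α β ∧ travelTime q α ξ ≤ max t 0} with hS
  set x := stoppedFlow q α β t with hx
  have hbdd := stoppedFlow_bddAbove q α β t
  have hxI : x ∈ Ico α β := ⟨h.le_stoppedFlow t, ht⟩
  have hSx : S = Icc α x ∩ travelTime q α ⁻¹' Iic (max t 0) := by
    ext ξ
    exact ⟨fun hξ => ⟨⟨hξ.1.1, le_csSup hbdd hξ⟩, hξ.2⟩,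
      fun hξ => ⟨⟨hξ.1.1, hξ.1.2.trans_lt ht⟩, hξ.2⟩⟩
  have hcl : IsClosed S := by
    rw [hSx]
    exact (h.continuousOn_travelTime hxI).preimage_isClosed_of_isClosed isClosed_Icc isClosed_Iic
  have hmem : x ∈ S := hcl.csSup_mem ⟨α, h.mem_zero t⟩ hbdd
  refine le_antisymm hmem.2 ?_
  by_contra! hlt
  obtain ⟨b, hxb, hb⟩ := exists_between ht
  have hc := (h.continuousOn_travelTime ⟨hxI.1.trans hxb.le, hb⟩) x ⟨hxI.1, hxb.le⟩
  have hev : ∀ᶠ ξ in 𝓝[>] x, travelTime q α ξ < max t 0 := by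
    have h1 := hc.eventually_lt_const hlt
    rw [← nhdsWithin_Ioo_eq_nhdsGT hxb]
    exact h1.filter_mono (nhdsWithin_mono x fun ξ hξ =>
      (⟨hxI.1.trans hξ.1.le, hξ.2.le⟩ : ξ ∈ Icc α b))
  obtain ⟨ξ, h1, h2⟩ := (hev.and (Ioo_mem_nhdsGT hxb)).exists
  exact absurd (le_csSup hbdd (show ξ ∈ S from ⟨⟨hxI.1.trans h2.1.le, h2.2.trans hb⟩, h1.le⟩))
    (not_le.2 h2.1)

/-- Where the speed is at most `M`, covering the distance takes at least the distance divided by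
`M`. This serves both for continuity and, with arbitrarily small `M`, for differentiability at zeros
of `q`. -/
theorem IsDeparture.stoppedFlow_sub_le (h : IsDeparture q α β) {s t M : ℝ} (hst : s ≤ t)
    (hM : 0 < M)
    (hq : ∀ ξ ∈ Ioo (stoppedFlow q α β s) (stoppedFlow q α β t), q ξ ≤ M ^ 2) :
    stoppedFlow q α β t - stoppedFlow q α β s ≤ M * (t - s) := by
  rw [sub_le_iff_le_add]
  refine csSup_le ⟨α, h.mem_zero t⟩ fun ξ hξ => ?_
  have hMt : 0 ≤ M * (t - s) := mul_nonneg hM.le (sub_nonneg.2 hst)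
  rcases le_or_gt ξ (stoppedFlow q α β s) with hle | hlt
  · linarith
  have hs : stoppedFlow q α β s ∈ Ico α β := ⟨h.le_stoppedFlow s, hlt.trans hξ.1.2⟩
  have hξt : ξ ≤ stoppedFlow q α β t := le_csSup (stoppedFlow_bddAbove q α β t) hξ
  have h1 : ∫ ζ in stoppedFlow q α β s..ξ, 1 / M ≤ ∫ ζ in stoppedFlow q α β s..ξ, 1 / √(q ζ) := by
    refine intervalIntegral.integral_mono_on_of_le_Ioo hlt.le intervalIntegrable_const
      ((h.integrable _ hs).symm.trans (h.integrable _ hξ.1)) fun ζ hζ => ?_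
    have h2 := h.pos ζ ⟨hs.1.trans_lt hζ.1, hζ.2.trans hξ.1.2⟩
    exact one_div_le_one_div_of_le (Real.sqrt_pos.2 h2)
      ((Real.sqrt_le_left hM.le).2 (hq ζ ⟨hζ.1, hζ.2.trans_le hξt⟩))
  rw [← h.travelTime_sub hs hξ.1, h.travelTime_stoppedFlow hs.2, intervalIntegral.integral_const,
    smul_eq_mul, mul_one_div, div_le_iff₀ hM] at h1
  have h2 : max t 0 - max s 0 ≤ t - s := by
    rcases le_total s 0 with h3 | h3 <;> rcases le_total t 0 with h4 | h4 <;>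
      simp [h3, h4] <;> linarith
  have h3 : (travelTime q α ξ - max s 0) * M ≤ (t - s) * M :=
    mul_le_mul_of_nonneg_right (by linarith [hξ.2]) hM.le
  linarith

theorem IsDeparture.abs_stoppedFlow_sub_le (h : IsDeparture q α β) {s t M : ℝ} (hM : 0 < M)
    (hq : ∀ ξ ∈ uIcc (stoppedFlow q α β s) (stoppedFlow q α β t), q ξ ≤ M ^ 2) :
    |stoppedFlow q α β t - stoppedFlow q α β s| ≤ M * |t - s| := by
  rcases le_total s t with hst | hst
  · rw [abs_of_nonneg (sub_nonneg.2 hst), abs_of_nonneg (sub_nonneg.2 (h.monotone_stoppedFlow hst))]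
    exact h.stoppedFlow_sub_le hst hM fun ξ hξ => hq ξ (Icc_subset_uIcc (Ioo_subset_Icc_self hξ))
  · rw [abs_sub_comm, abs_sub_comm t, abs_of_nonneg (sub_nonneg.2 hst),
      abs_of_nonneg (sub_nonneg.2 (h.monotone_stoppedFlow hst))]
    exact h.stoppedFlow_sub_le hst hM fun ξ hξ => hq ξ (Icc_subset_uIcc' (Ioo_subset_Icc_self hξ))

theorem IsDeparture.continuous_stoppedFlow (h : IsDeparture q α β) :
    Continuous (stoppedFlow q α β) := by
  obtain ⟨K, hK⟩ := isCompact_Icc.exists_bound_of_continuousOn (s := Icc α β)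
    h.continuous.continuousOn
  have hM : 0 < |K| + 1 := by positivity
  have hlip : LipschitzWith (|K| + 1).toNNReal (stoppedFlow q α β) := by
    refine LipschitzWith.of_dist_le_mul fun s t => ?_
    rw [Real.dist_eq, Real.dist_eq, Real.coe_toNNReal _ hM.le]
    refine h.abs_stoppedFlow_sub_le hM fun ξ hξ => ?_
    have h1 := hK ξ (uIcc_subset_Icc ⟨h.le_stoppedFlow t, h.stoppedFlow_le t⟩
      ⟨h.le_stoppedFlow s, h.stoppedFlow_le s⟩ hξ)
    rw [Real.norm_eq_abs] at h1
    nlinarith [le_abs_self (q ξ), le_abs_self K, abs_nonneg K]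
  exact hlip.continuous

/-- Near such a time the speed is below every `c > 0`. This covers the waiting time at `α`, the
departure itself and any stop at `β`. -/
theorem IsDeparture.hasDerivAt_stoppedFlow_of_zero (h : IsDeparture q α β) {t : ℝ}
    (ht : q (stoppedFlow q α β t) = 0) : HasDerivAt (stoppedFlow q α β) 0 t := by
  rw [hasDerivAt_iff_isLittleO, Asymptotics.isLittleO_iff]
  intro c hc
  have h1 : ∀ᶠ ξ in 𝓝 (stoppedFlow q α β t), q ξ < c ^ 2 :=
    h.continuous.continuousAt.eventually_lt_const (by rw [ht]; positivity)
  obtain ⟨ε, hε, hball⟩ := Metric.eventually_nhds_iff_ball.1 h1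
  filter_upwards [h.continuous_stoppedFlow.continuousAt.eventually (Metric.ball_mem_nhds _ hε)]
    with s hs
  change stoppedFlow q α β s ∈ Metric.ball _ ε at hs
  rw [smul_zero, sub_zero, Real.norm_eq_abs, Real.norm_eq_abs]
  refine h.abs_stoppedFlow_sub_le hc fun ξ hξ => (hball ξ ?_).le
  rw [Real.ball_eq_Ioo] at hs ⊢
  exact ordConnected_Ioo.uIcc_subset (by constructor <;> linarith) hs hξ

theorem IsDeparture.hasDerivAt_stoppedFlow (h : IsDeparture q α β) (t : ℝ) :
    HasDerivAt (stoppedFlow q α β) (√(q (stoppedFlow q α β t))) t := by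
  rcases eq_or_lt_of_le (h.le_stoppedFlow t) with h1 | h1
  · have h0 : q (stoppedFlow q α β t) = 0 := by rw [← h1, h.left_eq_zero]
    rw [h0, Real.sqrt_zero]
    exact h.hasDerivAt_stoppedFlow_of_zero h0
  rcases eq_or_lt_of_le (h.stoppedFlow_le t) with h2 | h2
  · have h0 : q (stoppedFlow q α β t) = 0 := by rw [h2, h.right_eq_zero]
    rw [h0, Real.sqrt_zero]
    exact h.hasDerivAt_stoppedFlow_of_zero h0
  have hqpos := h.pos _ ⟨h1, h2⟩
  have hsq := Real.sqrt_pos.2 hqpos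
  have ht : 0 < t := by
    have h3 := h.travelTime_pos ⟨h1, h2⟩
    rw [h.travelTime_stoppedFlow h2] at h3
    exact (lt_max_iff.1 h3).resolve_right (lt_irrefl 0)
  have hG : HasDerivAt (travelTime q α) (1 / √(q (stoppedFlow q α β t))) (stoppedFlow q α β t) := by
    refine intervalIntegral.integral_hasDerivAt_right (h.integrable _ ⟨h1.le, h2⟩) ?_ ?_
    · exact (measurable_const.div h.continuous.sqrt.measurable).stronglyMeasurable
        |>.stronglyMeasurableAtFilter
    · exact continuousAt_const.div h.continuous.sqrt.continuousAt hsq.ne'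
  -- Between `α` and `β` the flow is a local inverse of the travel time, whose derivative is `1/√q ≠
  -- 0`.
  have h4 := hG.of_local_left_inverse h.continuous_stoppedFlow.continuousAt
    (one_div_pos.2 hsq).ne' (by
      filter_upwards [lt_mem_nhds ht, h.continuous_stoppedFlow.continuousAt.eventually_lt_const h2]
        with s hs hs2
      rw [h.travelTime_stoppedFlow hs2, max_eq_left (le_of_lt hs)])
  rwa [one_div, inv_inv] at h4

theorem IsDeparture.isSpeedMotion (h : IsDeparture q α β) :
    IsSpeedMotion q (stoppedFlow q α β) := by
  have hd : deriv (stoppedFlow q α β) = fun t => √(q (stoppedFlow q α β t)) :=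
    funext fun t => (h.hasDerivAt_stoppedFlow t).deriv
  refine ⟨contDiff_one_iff_deriv.2 ⟨fun t => (h.hasDerivAt_stoppedFlow t).differentiableAt, ?_⟩,
    fun t => ?_⟩
  · rw [hd]
    exact (h.continuous.comp h.continuous_stoppedFlow).sqrt
  · rw [hd]
    refine Real.sq_sqrt ?_
    rcases eq_or_lt_of_le (h.le_stoppedFlow t) with h1 | h1
    · rw [← h1, h.left_eq_zero]
    · rcases eq_or_lt_of_le (h.stoppedFlow_le t) with h2 | h2
      · rw [h2, h.right_eq_zero]
      · exact (h.pos _ ⟨h1, h2⟩).le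

theorem IsDeparture.stoppedFlow_zero (h : IsDeparture q α β) : stoppedFlow q α β 0 = α := by
  refine le_antisymm (csSup_le ⟨α, h.mem_zero 0⟩ fun ξ hξ => ?_) (h.le_stoppedFlow 0)
  by_contra! hlt
  have h1 := h.travelTime_pos ⟨hlt, hξ.1.2⟩
  rw [max_self] at hξ
  exact absurd hξ.2 (not_le.2 h1)

/-- The reversed flow arrives at `α` exactly at time 0, so a pause can be inserted there with `T =
0`. -/
theorem IsDeparture.hasPauses (h : IsDeparture q α β) : HasPauses q α 0 α := by
  have hm := h.isSpeedMotion
  have h0 := h.stoppedFlow_zero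
  have hd : deriv (stoppedFlow q α β) 0 = 0 :=
    hm.deriv_eq_zero_iff.2 (by rw [h0, h.left_eq_zero])
  have hr := hm.comp_const_sub 0
  have h1 := hr.hasPauses le_rfl (by rw [deriv_const_sub_comp, sub_zero, hd, neg_zero]) (by
    filter_upwards [self_mem_nhdsWithin] with t ht heq
    rw [mem_Iio] at ht
    rw [sub_zero, h0] at heq
    have h2 := h.travelTime_stoppedFlow (t := 0 - t) (by rw [heq]; exact h.lt)
    rw [heq, travelTime, intervalIntegral.integral_same, max_eq_left (by linarith)] at h2
    linarith)
  rw [deriv_const_sub_comp, sub_zero, hd, neg_zero, h0] at h1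
  exact h1

end StoppedFlow

/-! ### Departures from a position of rest -/

section Leaving

variable {q θ : ℝ → ℝ} {c : ℝ}

/-- A motion that leaves its initial position of rest to the right does so in a finite time. -/
theorem IsSpeedMotion.exists_integrable_right (h : IsSpeedMotion q θ) (hc : θ 0 < c)
    (hq : ∀ ξ ∈ Ioo (θ 0) c, q ξ ≠ 0) {t : ℝ} (ht : θ 0 < θ t) :
    ∃ η ∈ Ioo (θ 0) c, IntervalIntegrable (fun ξ => 1 / √(q ξ)) volume (θ 0) η := by
  wlog htpos : 0 < t generalizing θ t
  · have hne : t ≠ 0 := by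
      rintro rfl
      exact lt_irrefl _ ht
    have h1 := this (h.comp_const_sub 0) (by simpa using hc) (by simpa using hq) (t := -t)
      (by simpa using ht) (by have := lt_of_le_of_ne (not_lt.1 htpos) hne; linarith)
    simpa using h1
  obtain ⟨η, hη1, hη2⟩ := exists_between (lt_min hc ht)
  have hηc : η < c := hη2.trans_le (min_le_left _ _)
  have hηt : η < θ t := hη2.trans_le (min_le_right _ _)
  refine ⟨η, ⟨hη1, hηc⟩, ?_⟩
  obtain ⟨T₀, hT₀, hT₀η⟩ := intermediate_value_Ioo htpos.le h.continuous.continuousOn ⟨hη1, hηt⟩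
  have hfc : Continuous fun t => θ t - η := h.continuous.sub continuous_const
  -- `T` is the first time at the level `η`, and `T - S` below is the last time before it at the
  -- initial level. In between the motion stays where `q ≠ 0`, hence is monotone, and the change of
  -- variable applies.
  obtain ⟨T, hT, hTz, hTne⟩ := exists_first_zero hfc ⟨T₀, hT₀.1, by rw [hT₀η, sub_self]⟩
    ((hfc.continuousAt.eventually_ne (sub_neg.2 hη1).ne).filter_mono nhdsWithin_le_nhds)
  have hTη : θ T = η := sub_eq_zero.1 hTz
  have hlt : ∀ s ∈ Ico 0 T, θ s < η := by
    rcases pos_or_neg_of_ne_zero isPreconnected_Ico hfc.continuousOn (s := Ico 0 T)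
      (fun s hs => by
        rcases eq_or_lt_of_le hs.1 with rfl | hs0
        · exact (sub_neg.2 hη1).ne
        · exact hTne s ⟨hs0, hs.2⟩) with hp | hn
    · exact absurd (hp 0 ⟨le_rfl, hT⟩) (not_lt.2 (sub_neg.2 hη1).le)
    · exact fun s hs => sub_neg.1 (hn s hs)
  have hgc : Continuous fun s => θ (T - s) - θ 0 :=
    (h.continuous.comp (continuous_const.sub continuous_id)).sub continuous_const
  have hg0 : θ (T - 0) - θ 0 ≠ 0 := by
    rw [sub_zero, hTη]
    exact (sub_pos.2 hη1).ne'
  obtain ⟨S, hS, hSz, hSne⟩ := exists_first_zero hgc ⟨T, hT, by rw [sub_self, sub_self]⟩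
    ((hgc.continuousAt.eventually_ne hg0).filter_mono nhdsWithin_le_nhds)
  have hST : S ≤ T := by
    by_contra! hlt
    exact hSne T ⟨hT, hlt⟩ (by rw [sub_self, sub_self])
  have hS0 : θ (T - S) = θ 0 := sub_eq_zero.1 hSz
  have hgt : ∀ s ∈ Ioo (T - S) T, θ 0 < θ s := by
    rcases pos_or_neg_of_ne_zero isPreconnected_Ico hgc.continuousOn (s := Ico 0 S)
      (fun s hs => by
        rcases eq_or_lt_of_le hs.1 with rfl | hs0
        · exact hg0
        · exact hSne s ⟨hs0, hs.2⟩) with hp | hn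
    · intro s hs
      have := hp (T - s) ⟨by linarith [hs.2], by linarith [hs.1]⟩
      rw [sub_sub_cancel] at this
      exact sub_pos.1 this
    · have := hn 0 ⟨le_rfl, hS⟩
      rw [sub_zero, hTη] at this
      linarith
  have hdne : ∀ s ∈ Ioo (T - S) T, deriv θ s ≠ 0 := fun s hs =>
    h.deriv_eq_zero_iff.not.2 (hq _ ⟨hgt s hs,
      (hlt s ⟨by linarith [hs.1], hs.2⟩).trans hηc⟩)
  obtain ⟨σ, hσ, hpos⟩ : ∃ σ : ℝ, (σ = 1 ∨ σ = -1) ∧ ∀ s ∈ Ioo (T - S) T, 0 < σ * deriv θ s := by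
    rcases pos_or_neg_of_ne_zero isPreconnected_Ioo h.continuous_deriv.continuousOn hdne
      with hp | hn
    · exact ⟨1, Or.inl rfl, fun s hs => by linarith [hp s hs]⟩
    · exact ⟨-1, Or.inr rfl, fun s hs => by linarith [hn s hs]⟩
  have h2 := (integral_inv_sqrt_of_motion hσ (by linarith [show 0 < S from hS]) h.contDiff
    h.deriv_sq hpos).1
  rwa [hS0, hTη] at h2

/-- A motion that passes through the interior of an interval of positions of rest is constant. -/
theorem IsSpeedMotion.eq_of_mem_Ioo (h : IsSpeedMotion q θ) {a b : ℝ}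
    (hq : ∀ ξ ∈ Ioo a b, q ξ = 0) {s : ℝ} (hs : θ s ∈ Ioo a b) (t : ℝ) : θ t = θ s := by
  have hcl : IsClosed {t | θ t = θ s} := isClosed_eq h.continuous continuous_const
  -- Near a time in this set the motion stays among positions of rest, so its velocity vanishes; the
  -- set is open and closed.
  have hop : IsOpen {t | θ t = θ s} := by
    rw [Metric.isOpen_iff]
    intro t ht
    have hev : ∀ᶠ τ in 𝓝 t, θ τ ∈ Ioo a b :=
      h.continuous.continuousAt.eventually_mem (isOpen_Ioo.mem_nhds (by
        rw [mem_ofPred_eq] at ht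
        rwa [ht]))
    obtain ⟨ε, hε, hball⟩ := Metric.eventually_nhds_iff_ball.1 hev
    refine ⟨ε, hε, fun τ hτ => ?_⟩
    have h1 : ∀ x ∈ Metric.ball t ε, fderivWithin ℝ θ (Metric.ball t ε) x = 0 := fun x hx => by
      rw [fderivWithin_of_isOpen Metric.isOpen_ball hx]
      ext
      simpa using h.deriv_eq_zero_iff.2 (hq _ (hball x hx))
    have h2 := (convex_ball t ε).is_const_of_fderivWithin_eq_zero (𝕜 := ℝ)
      (h.contDiff.differentiable one_ne_zero).differentiableOn h1 hτ (Metric.mem_ball_self hε)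
    exact h2.trans ht
  have huniv := IsClopen.eq_univ ⟨hcl, hop⟩ ⟨s, rfl⟩
  exact (huniv ▸ mem_univ t : t ∈ {t | θ t = θ s})

end Leaving

/-! ### The highest points of the polar curve -/

section TopSegment

variable {F : Seminorm ℝ (ℝ × ℝ)} {s : ℝ}

/-- The highest face of a convex figure contains the segment joining two of its points. With angles
less than `π` apart, `sin(β-α)e(ξ)` is a positive combination of `e(α)` and `e(β)`; subadditivity
gives `|h₂(ξ)| ≥ |s|`, and `|s|` is the maximal height. -/
theorem polarH2_eq_of_mem_Ioo (hF : ∀ w, F w = 0 → w = 0) (hs : |s| = F (0, 1)) {α β : ℝ}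
    (hβ : β < α + Real.pi) (h₁ : polarH2 F α = s) (h₂ : polarH2 F β = s) {ξ : ℝ}
    (hξ : ξ ∈ Ioo α β) : polarH2 F ξ = s := by
  set N : ℝ → ℝ := fun ξ => supportNorm F (Real.cos ξ, Real.sin ξ) with hN
  have hNpos : ∀ ξ, 0 < N ξ := supportNorm_cos_sin_pos hF
  have hm := seminorm_vertical_pos hF
  have hsin : ∀ ξ, Real.sin ξ = polarH2 F ξ * N ξ := fun ξ => by
    rw [polarH2, polarRadius, mul_assoc, mul_comm (Real.sin ξ), inv_mul_cancel_left₀ (hNpos ξ).ne']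
  have p1 : 0 < Real.sin (β - ξ) := Real.sin_pos_of_pos_of_lt_pi (by linarith [hξ.2])
    (by linarith [hξ.1])
  have p2 : 0 < Real.sin (ξ - α) := Real.sin_pos_of_pos_of_lt_pi (by linarith [hξ.1])
    (by linarith [hξ.2])
  have p3 : 0 < Real.sin (β - α) := Real.sin_pos_of_pos_of_lt_pi (by linarith [hξ.1, hξ.2])
    (by linarith)
  have hconv : Real.sin (β - α) * N ξ ≤ Real.sin (β - ξ) * N α + Real.sin (ξ - α) * N β := by
    rw [hN]
    simp only
    rw [← supportNorm_smul hF p1.le, ← supportNorm_smul hF p2.le, ← supportNorm_smul hF p3.le]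
    refine le_of_eq_of_le (congrArg _ ?_) (supportNorm_add_le hF _ _)
    ext
    · simp only [Prod.smul_fst, Prod.fst_add, smul_eq_mul, Real.sin_sub]
      ring
    · simp only [Prod.smul_snd, Prod.snd_add, smul_eq_mul, Real.sin_sub]
      ring
  have hid : Real.sin (β - α) * Real.sin ξ =
      s * (Real.sin (β - ξ) * N α + Real.sin (ξ - α) * N β) := by
    have e1 := hsin α
    have e2 := hsin β
    rw [h₁] at e1
    rw [h₂] at e2
    calc Real.sin (β - α) * Real.sin ξ =
        Real.sin (β - ξ) * Real.sin α + Real.sin (ξ - α) * Real.sin β := by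
          simp only [Real.sin_sub]
          ring
      _ = _ := by rw [e1, e2]; ring
  set κ := (Real.sin (β - ξ) * N α + Real.sin (ξ - α) * N β) / (Real.sin (β - α) * N ξ) with hκ
  have hD : 0 < Real.sin (β - α) * N ξ := mul_pos p3 (hNpos ξ)
  have hκ1 : 1 ≤ κ := (one_le_div hD).2 hconv
  have hval : polarH2 F ξ = s * κ := by
    rw [hκ, ← mul_div_assoc, ← hid, hsin ξ, mul_div_mul_left _ _ p3.ne',
      mul_div_cancel_right₀ _ (hNpos ξ).ne']
  have hle := abs_polarH2_le hF ξ
  rw [hval, abs_mul, hs, abs_of_pos (by linarith : 0 < κ)] at hle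
  have hκ2 : κ ≤ 1 := by
    by_contra! hlt
    nlinarith
  rw [hval, le_antisymm hκ2 hκ1, mul_one]

theorem polarH2_eq_of_mem_Icc (hF : ∀ w, F w = 0 → w = 0) (hs : |s| = F (0, 1)) {α β : ℝ}
    (hβ : β < α + Real.pi) (h₁ : polarH2 F α = s) (h₂ : polarH2 F β = s) {ξ : ℝ}
    (hξ : ξ ∈ Icc α β) : polarH2 F ξ = s := by
  rcases eq_or_lt_of_le hξ.1 with rfl | h3
  · exact h₁
  · rcases eq_or_lt_of_le hξ.2 with rfl | h4
    · exact h₂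
    · exact polarH2_eq_of_mem_Ioo hF hs hβ h₁ h₂ ⟨h3, h4⟩

/-- The angles of the highest points form a segment in every period. -/
theorem exists_top_segment (hF : ∀ w, F w = 0 → w = 0) (hs : |s| = F (0, 1)) {c : ℝ}
    (hc : polarH2 F c = s) :
    ∃ θ₁ θ₂, c ∈ Icc θ₁ θ₂ ∧ θ₂ < θ₁ + 2 * Real.pi ∧ (∀ η ∈ Icc θ₁ θ₂, polarH2 F η = s) ∧
      ∀ η ∈ Ioo θ₂ (θ₁ + 2 * Real.pi), polarH2 F η ≠ s := by
  have hs0 : s ≠ 0 := abs_pos.1 (hs ▸ seminorm_vertical_pos hF)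
  have hπ := Real.pi_pos
  have hcl : IsClosed {ξ | polarH2 F ξ = s} :=
    isClosed_eq (continuous_polarH2 hF) continuous_const
  -- It suffices to search half a turn on each side: `h₂` changes its sign under the shift by `π`,
  -- so the extreme angles found are strictly closer to `c`.
  obtain ⟨θ₂, ⟨h2, h2I⟩, h2max⟩ := (isCompact_Icc.inter_left hcl).exists_isGreatest
    (s := {ξ | polarH2 F ξ = s} ∩ Icc c (c + Real.pi)) ⟨c, hc, le_rfl, by linarith⟩
  obtain ⟨θ₁, ⟨h1, h1I⟩, h1min⟩ := (isCompact_Icc.inter_left hcl).exists_isLeast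
    (s := {ξ | polarH2 F ξ = s} ∩ Icc (c - Real.pi) c) ⟨c, hc, by linarith, le_rfl⟩
  rw [mem_ofPred_eq] at h1 h2
  have h2lt : θ₂ < c + Real.pi := lt_of_le_of_ne h2I.2 fun h => by
    rw [h, polarH2_add_pi hF, hc] at h2
    exact hs0 (by linarith)
  have h1lt : c - Real.pi < θ₁ := lt_of_le_of_ne h1I.1 fun h => by
    have h3 := polarH2_add_pi hF θ₁
    rw [← h, sub_add_cancel, hc, h, h1] at h3
    exact hs0 (by linarith)
  refine ⟨θ₁, θ₂, ⟨h1I.2, h2I.1⟩, by linarith, fun η hη => ?_, fun η hη he => ?_⟩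
  · rcases le_total η c with h | h
    · exact polarH2_eq_of_mem_Icc hF hs (by linarith) h1 hc ⟨hη.1, h⟩
    · exact polarH2_eq_of_mem_Icc hF hs (by linarith) hc h2 ⟨h, hη.2⟩
  · rcases le_or_gt η (c + Real.pi) with h | h
    · exact absurd (h2max ⟨he, by linarith [hη.1, h2I.1], h⟩) (not_le.2 hη.1)
    · have h3 : polarH2 F (η - 2 * Real.pi) = s := by
        rw [(polarH2_periodic F).sub_eq, he]
      have := h1min ⟨h3, by linarith, by linarith [hη.2, h1I.2]⟩
      linarith [hη.2]

end TopSegment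

/-! ### The highest energy without initial velocity -/

section RestAtTop

theorem isDeparture_of_integrable {q : ℝ → ℝ} {α β : ℝ} (hq : Continuous q)
    (hpos : ∀ ξ ∈ Ioo α β, 0 < q ξ) (hα : q α = 0) (hβ : q β = 0)
    (hint : ∃ η ∈ Ioo α β, IntervalIntegrable (fun ζ => 1 / √(q ζ)) volume α η) :
    IsDeparture q α β := by
  obtain ⟨η, hη, hint⟩ := hint
  refine ⟨hq, hη.1.trans hη.2, hpos, hα, hβ, fun ξ hξ => ?_⟩
  rcases eq_or_lt_of_le hξ.1 with rfl | hαξ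
  · exact IntervalIntegrable.refl
  refine hint.trans (ContinuousOn.intervalIntegrable (continuousOn_const.div
    hq.sqrt.continuousOn fun ζ hζ => (Real.sqrt_pos.2 (hpos ζ ?_)).ne'))
  exact ordConnected_Ioo.uIcc_subset hη ⟨hαξ, hξ.2⟩ hζ

variable {F : Seminorm ℝ (ℝ × ℝ)} {φ₁ φ₂ φ₃ φ₄ : ℝ} {g : ℝ → Fin 4 → ℝ} {θ ρ : ℝ → ℝ}

theorem IsGivenBy.constancyFormulasZero (hF : ∀ w, F w = 0 → w = 0) (hφ₄ : φ₄ ≠ 0)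
    (hE : casimirEnergy φ₂ 0 φ₄ = energyMax F φ₄) (h : IsGivenBy F φ₁ φ₂ 0 φ₄ g θ ρ) :
    ConstancyFormulasZero φ₂ φ₄ g θ := by
  intro a b hab hc t₀ ht₀ t ht
  obtain ⟨h1, h2, h3, h4⟩ := h.constancyFormulas hF hφ₄ hE a b hab hc t₀ ht₀ t ht
  obtain ⟨h5, -⟩ := h.constancyFormulas hF hφ₄ hE a b hab hc t₀ ht₀ t₀ ht₀
  have hφ₂ : φ₂ ≠ 0 := abs_pos.1 (abs_eq_of_energyMax hF hφ₄ hE ▸ seminorm_vertical_pos hF)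
  refine ⟨by rw [h1]; simp, ?_, by rw [h3]; simp, by rw [h4]; simp, ?_⟩
  · rw [h2]
    field_simp
    ring
  · rw [h.v_eq, h5]
    ring

/-- A motion that starts at rest at an end of a segment of positions of rest, or inside of it,
does not leave this segment to the right when it cannot do so in a finite time. -/
theorem IsSpeedMotion.le_of_not_integrable {q : ℝ → ℝ} (h : IsSpeedMotion q θ) {a b c : ℝ}
    (hab : θ 0 ∈ Icc a b) (hbc : b < c) (hz : ∀ ξ ∈ Icc a b, q ξ = 0)
    (hne : ∀ ξ ∈ Ioo b c, q ξ ≠ 0)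
    (hb : θ 0 = b → ∀ η ∈ Ioo b c,
      ¬ IntervalIntegrable (fun ξ => 1 / √(q ξ)) volume (θ 0) η) (t : ℝ) : θ t ≤ θ 0 := by
  by_contra! hlt
  rcases eq_or_lt_of_le hab.2 with h0 | h0
  · rw [← h0] at hbc hne
    obtain ⟨η, hη, hint⟩ := h.exists_integrable_right hbc hne hlt
    exact hb h0 η (by rwa [← h0]) hint
  · obtain ⟨v, hv1, hv2⟩ := exists_between (lt_min h0 hlt)
    obtain ⟨s, hs⟩ := mem_range_of_exists_le_of_exists_ge h.continuous ⟨0, hv1.le⟩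
      ⟨t, (hv2.trans_le (min_le_right _ _)).le⟩
    have h1 := h.eq_of_mem_Ioo (a := a) (b := b) (fun ξ hξ => hz ξ (Ioo_subset_Icc_self hξ))
      (s := s) (by rw [hs]; exact ⟨hab.1.trans_lt hv1, hv2.trans_le (min_le_left _ _)⟩) 0
    rw [hs] at h1
    exact hv1.ne h1

theorem IsSpeedMotion.ge_of_not_integrable {q : ℝ → ℝ} (h : IsSpeedMotion q θ) {a b c : ℝ}
    (hab : θ 0 ∈ Icc a b) (hca : c < a) (hz : ∀ ξ ∈ Icc a b, q ξ = 0)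
    (hne : ∀ ξ ∈ Ioo c a, q ξ ≠ 0)
    (ha : θ 0 = a → ∀ η ∈ Ioo c a,
      ¬ IntervalIntegrable (fun ξ => 1 / √(q ξ)) volume (θ 0) η) (t : ℝ) : θ 0 ≤ θ t := by
  have h1 := h.neg.le_of_not_integrable (a := -b) (b := -a) (c := -c)
    ⟨neg_le_neg hab.2, neg_le_neg hab.1⟩ (neg_lt_neg hca)
    (fun ξ hξ => hz _ ⟨by linarith [hξ.2], by linarith [hξ.1]⟩)
    (fun ξ hξ => hne _ ⟨by linarith [hξ.2], by linarith [hξ.1]⟩)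
    (fun h0 η hη hint => ha (neg_injective h0) (-η) ⟨by linarith [hη.2], by linarith [hη.1]⟩ (by
      have h1 := intervalIntegrable_inv_sqrt_comp_neg (q := fun ξ => q (-ξ)) hint
      simpa using h1)) t
  exact neg_le_neg_iff.1 h1

theorem IsGivenBy.highest_energy_at_rest (hF : ∀ w, F w = 0 → w = 0) (hφ₄ : φ₄ ≠ 0)
    (hE : casimirEnergy φ₂ 0 φ₄ = energyMax F φ₄) (h : IsGivenBy F φ₁ φ₂ 0 φ₄ g θ ρ) :
    ∃ θ₁ θ₂ : ℝ, θ 0 ∈ Icc θ₁ θ₂ ∧ (∀ η ∈ Icc θ₁ θ₂, polarH2 F η = φ₂) ∧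
      (∀ a b : ℝ, θ 0 ∈ Icc a b → (∀ η ∈ Icc a b, polarH2 F η = φ₂) →
        Icc a b ⊆ Icc θ₁ θ₂) ∧
      (((θ₁ = θ 0 ∧ θ 0 = θ₂ ∧
            (∀ η ∈ Ioo (θ₂ - 2 * Real.pi) (θ 0), ¬ TimeZeroFinite F φ₂ φ₄ (θ 0) η) ∧
            (∀ η ∈ Ioo (θ 0) (θ₁ + 2 * Real.pi), ¬ TimeZeroFinite F φ₂ φ₄ (θ 0) η)) ∨
          (θ₁ < θ 0 ∧ θ 0 < θ₂) ∨
          (θ 0 = θ₁ ∧ θ₁ < θ₂ ∧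
            (∀ η ∈ Ioo (θ₂ - 2 * Real.pi) (θ 0), ¬ TimeZeroFinite F φ₂ φ₄ (θ 0) η)) ∨
          (θ 0 = θ₂ ∧ θ₁ < θ₂ ∧
            (∀ η ∈ Ioo (θ 0) (θ₁ + 2 * Real.pi), ¬ TimeZeroFinite F φ₂ φ₄ (θ 0) η))) →
        (∀ t, θ t = θ 0) ∧ IsVerticalMetricLine F g) ∧
      (¬ ((θ₁ = θ 0 ∧ θ 0 = θ₂ ∧
            (∀ η ∈ Ioo (θ₂ - 2 * Real.pi) (θ 0), ¬ TimeZeroFinite F φ₂ φ₄ (θ 0) η) ∧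
            (∀ η ∈ Ioo (θ 0) (θ₁ + 2 * Real.pi), ¬ TimeZeroFinite F φ₂ φ₄ (θ 0) η)) ∨
          (θ₁ < θ 0 ∧ θ 0 < θ₂) ∨
          (θ 0 = θ₁ ∧ θ₁ < θ₂ ∧
            (∀ η ∈ Ioo (θ₂ - 2 * Real.pi) (θ 0), ¬ TimeZeroFinite F φ₂ φ₄ (θ 0) η)) ∨
          (θ 0 = θ₂ ∧ θ₁ < θ₂ ∧
            (∀ η ∈ Ioo (θ 0) (θ₁ + 2 * Real.pi), ¬ TimeZeroFinite F φ₂ φ₄ (θ 0) η))) →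
        AngleNotUnique F φ₁ φ₂ 0 φ₄ (θ 0) ∧
        HasConstancyIntervals F φ₁ φ₂ 0 φ₄ (θ 0) (θ 0)) ∧
      ConstancyFormulasZero φ₂ φ₄ g θ := by
  have hE' := hE.trans (energyMax_eq hF φ₄)
  have hφ₂ := abs_eq_of_energyMax hF hφ₄ hE
  have hs := h.isSpeedMotion
  obtain ⟨θ₁, θ₂, hmem, hlt, htop, hne⟩ := exists_top_segment hF hφ₂ h.initial₂
  have hq : ∀ ξ, energySpeedSq F φ₄ (casimirEnergy φ₂ 0 φ₄) ξ = 0 ↔ polarH2 F ξ = φ₂ := fun ξ => by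
    rw [energySpeedSq_eq_zero_iff hF, casimirEnergy]
    constructor
    · intro h1
      exact mul_left_cancel₀ hφ₄ (by linarith)
    · intro h1
      rw [h1]
      ring
  have hqc := continuous_energySpeedSq hF φ₄ (casimirEnergy φ₂ 0 φ₄)
  have hz : ∀ ξ ∈ Icc θ₁ θ₂, energySpeedSq F φ₄ (casimirEnergy φ₂ 0 φ₄) ξ = 0 := fun ξ hξ =>
    (hq ξ).2 (htop ξ hξ)
  have hne' : ∀ ξ ∈ Ioo (θ₂ - 2 * Real.pi) θ₁, polarH2 F ξ ≠ φ₂ := fun ξ hξ => by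
    have := hne (ξ + 2 * Real.pi) ⟨by linarith [hξ.1], by linarith [hξ.2]⟩
    rwa [polarH2_periodic F] at this
  have hzr : energySpeedSq F φ₄ (casimirEnergy φ₂ 0 φ₄) (θ₁ + 2 * Real.pi) = 0 := by
    rw [energySpeedSq_periodic]
    exact hz _ ⟨le_rfl, hmem.1.trans hmem.2⟩
  have hzl : energySpeedSq F φ₄ (casimirEnergy φ₂ 0 φ₄) (θ₂ - 2 * Real.pi) = 0 := by
    rw [(energySpeedSq_periodic F φ₄ _).sub_eq]
    exact hz _ ⟨hmem.1.trans hmem.2, le_rfl⟩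
  have hpos : ∀ ξ, polarH2 F ξ ≠ φ₂ → 0 < energySpeedSq F φ₄ (casimirEnergy φ₂ 0 φ₄) ξ :=
    fun ξ hξ => lt_of_le_of_ne (energySpeedSq_nonneg hF hE' ξ) fun h1 => hξ ((hq ξ).1 h1.symm)
  have hd0 : deriv θ 0 = 0 := hs.deriv_eq_zero_iff.2 (hz _ hmem)
  have hright : (θ 0 = θ₂ → ∀ η ∈ Ioo (θ 0) (θ₁ + 2 * Real.pi),
      ¬ TimeZeroFinite F φ₂ φ₄ (θ 0) η) → ∀ t, θ t ≤ θ 0 := fun hb =>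
    hs.le_of_not_integrable hmem hlt hz (fun ξ hξ => (hq ξ).not.2 (hne ξ hξ))
      fun h0 η hη => (timeZeroFinite_iff hF).not.1 (hb h0 η (by rwa [h0]))
  have hleft : (θ 0 = θ₁ → ∀ η ∈ Ioo (θ₂ - 2 * Real.pi) (θ 0),
      ¬ TimeZeroFinite F φ₂ φ₄ (θ 0) η) → ∀ t, θ 0 ≤ θ t := fun ha =>
    hs.ge_of_not_integrable hmem (by linarith) hz (fun ξ hξ => (hq ξ).not.2 (hne' ξ hξ))
      fun h0 η hη => (timeZeroFinite_iff hF).not.1 (ha h0 η (by rwa [h0]))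
  have hline : (∀ t, θ t = θ 0) → (∀ t, θ t = θ 0) ∧ IsVerticalMetricLine F g := fun hc =>
    ⟨hc, h.isVerticalMetricLine hF hφ₄ hc hφ₂⟩
  refine ⟨θ₁, θ₂, hmem, htop, fun a b hab hL ξ hξ => ?_, fun hP => hline fun t => ?_,
    fun hP => h.of_hasPauses hF hφ₄ hE ?_, h.constancyFormulasZero hF hφ₄ hE⟩
  · constructor
    · by_contra! h1
      obtain ⟨ζ, h2, h3⟩ := exists_between (max_lt h1 (show θ₂ - 2 * Real.pi < θ₁ by linarith))
      exact hne' ζ ⟨(le_max_right _ _).trans_lt h2, h3⟩ (hL ζ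
        ⟨hξ.1.trans ((le_max_left _ _).trans_lt h2).le, h3.le.trans (hmem.1.trans hab.2)⟩)
    · by_contra! h1
      obtain ⟨ζ, h2, h3⟩ := exists_between (lt_min h1 hlt)
      exact hne ζ ⟨h2, h3.trans_le (min_le_right _ _)⟩ (hL ζ
        ⟨(hab.1.trans hmem.2).trans h2.le, (h3.trans_le (min_le_left _ _)).le.trans hξ.2⟩)
  · rcases hP with ⟨-, -, hl, hr⟩ | ⟨hl, hr⟩ | ⟨h0, h12, hl⟩ | ⟨h0, h12, hr⟩
    · exact le_antisymm (hright (fun _ => hr) t) (hleft (fun _ => hl) t)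
    · exact le_antisymm (hright (fun h1 => absurd h1 hr.ne) t)
        (hleft (fun h1 => absurd h1 hl.ne') t)
    · exact le_antisymm (hright (fun h1 => absurd (h0.symm.trans h1) h12.ne) t)
        (hleft (fun _ => hl) t)
    · exact le_antisymm (hright (fun _ => hr) t)
        (hleft (fun h1 => absurd (h1.symm.trans h0) h12.ne) t)
  · rw [hd0]
    -- A finite time of departure to the right, or by reflection to the left, yields a motion
    -- leaving `θ(0)` and hence pauses; if neither exists, one of the four listed situations holds.
    by_cases hr : θ 0 = θ₂ ∧ ∃ η ∈ Ioo (θ 0) (θ₁ + 2 * Real.pi), TimeZeroFinite F φ₂ φ₄ (θ 0) η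
    · obtain ⟨h0, η, hη, hfin⟩ := hr
      exact (isDeparture_of_integrable hqc (fun ξ hξ => hpos ξ (hne ξ (by rwa [← h0])))
        (hz _ hmem) hzr ⟨η, hη, (timeZeroFinite_iff hF).1 hfin⟩).hasPauses
    by_cases hl : θ 0 = θ₁ ∧ ∃ η ∈ Ioo (θ₂ - 2 * Real.pi) (θ 0), TimeZeroFinite F φ₂ φ₄ (θ 0) η
    · obtain ⟨h0, η, hη, hfin⟩ := hl
      have h1 := (isDeparture_of_integrable (hqc.comp continuous_neg)
        (α := -θ 0) (β := -(θ₂ - 2 * Real.pi))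
        (fun ξ hξ => hpos (-ξ) (hne' (-ξ) ⟨by linarith [hξ.2], by linarith [hξ.1]⟩))
        (by simpa using hz _ hmem) (by simpa using hzl) ⟨-η, ⟨neg_lt_neg hη.2, neg_lt_neg hη.1⟩,
          intervalIntegrable_inv_sqrt_comp_neg ((timeZeroFinite_iff hF).1 hfin)⟩).hasPauses.comp_neg
      rwa [neg_neg, neg_zero] at h1
    refine absurd ?_ hP
    push Not at hr hl
    rcases eq_or_lt_of_le hmem.1 with h1 | h1 <;> rcases eq_or_lt_of_le hmem.2 with h2 | h2
    · exact Or.inl ⟨h1, h2, hl h1.symm, hr h2⟩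
    · exact Or.inr (Or.inr (Or.inl ⟨h1.symm, by linarith, hl h1.symm⟩))
    · exact Or.inr (Or.inr (Or.inr ⟨h2, by linarith, hr h2⟩))
    · exact Or.inr (Or.inl ⟨h1, h2⟩)

end RestAtTop
-- Assembly of the theorem.
theorem mainTheorem1 (F : Seminorm ℝ (ℝ × ℝ)) (hF : ∀ w, F w = 0 → w = 0)
    (φ₁ φ₂ φ₃ φ₄ : ℝ) (hφ₄ : φ₄ ≠ 0) :
    -- every normal extremal has a polar angle
    (∀ (u : ℝ → ℝ × ℝ) (g ψ : ℝ → Fin 4 → ℝ) (M : ℝ), IsExtremal F u g ψ M → 0 < M →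
      g 0 = 0 → ψ 0 = M • ![φ₁, φ₂, φ₃, φ₄] → ∃ θ, IsPolarAngle F g ψ M θ) ∧
    -- explicit description of the extremals
    (∀ (g : ℝ → Fin 4 → ℝ) (θ : ℝ → ℝ), IsNormalExtremal F φ₁ φ₂ φ₃ φ₄ g θ ↔
      ∃ ρ, IsGivenBy F φ₁ φ₂ φ₃ φ₄ g θ ρ) ∧
    -- behaviour of the angle
    (∀ (g : ℝ → Fin 4 → ℝ) (θ : ℝ → ℝ), IsNormalExtremal F φ₁ φ₂ φ₃ φ₄ g θ →
      -- the cases are exhaustive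
      ((φ₃ ≠ 0 ∧ energyMax F φ₄ < casimirEnergy φ₂ φ₃ φ₄) ∨
        (φ₃ = 0 ∧ casimirEnergy φ₂ φ₃ φ₄ = energyMin F φ₄) ∨
        (energyMin F φ₄ < casimirEnergy φ₂ φ₃ φ₄ ∧ casimirEnergy φ₂ φ₃ φ₄ < energyMax F φ₄) ∨
        (φ₃ ≠ 0 ∧ casimirEnergy φ₂ φ₃ φ₄ = energyMax F φ₄) ∨
        (φ₃ = 0 ∧ casimirEnergy φ₂ φ₃ φ₄ = energyMax F φ₄)) ∧
      -- case 1
      (φ₃ ≠ 0 → energyMax F φ₄ < casimirEnergy φ₂ φ₃ φ₄ →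
        polarH2 F (θ 0) = φ₂ ∧
        (∀ η, TimeFinite F φ₂ φ₃ φ₄ (θ 0) η) ∧
        (∀ t, timeOf F φ₂ φ₃ φ₄ (θ 0) (θ t) = t) ∧
        (∀ η, θ (timeOf F φ₂ φ₃ φ₄ (θ 0) η) = η)) ∧
      -- case 2
      (φ₃ = 0 → casimirEnergy φ₂ φ₃ φ₄ = energyMin F φ₄ →
        (∀ t, θ t = θ 0) ∧ IsVerticalMetricLine F g) ∧
      -- case 3
      (energyMin F φ₄ < casimirEnergy φ₂ φ₃ φ₄ → casimirEnergy φ₂ φ₃ φ₄ < energyMax F φ₄ →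
        (∃ t₁ t₂ : ℝ, t₁ ≠ t₂ ∧ IsReflectionPeriodic θ t₁ t₂) ∧
        -- case 3.1
        (φ₃ ≠ 0 → ∃ θ₁ θ₂ : ℝ, φ₃ * (θ₁ - θ 0) < 0 ∧ 0 < φ₃ * (θ₂ - θ 0) ∧
          angularSpeedSq F φ₂ φ₃ φ₄ θ₁ = 0 ∧ angularSpeedSq F φ₂ φ₃ φ₄ θ₂ = 0 ∧
          (∀ ξ ∈ Ioo (min θ₁ θ₂) (max θ₁ θ₂), angularSpeedSq F φ₂ φ₃ φ₄ ξ ≠ 0) ∧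
          polarH2 F (θ 0) = φ₂ ∧
          TimeFinite F φ₂ φ₃ φ₄ (θ 0) θ₁ ∧ TimeFinite F φ₂ φ₃ φ₄ (θ 0) θ₂ ∧
          timeOf F φ₂ φ₃ φ₄ (θ 0) θ₁ ≠ timeOf F φ₂ φ₃ φ₄ (θ 0) θ₂ ∧
          (∀ η ∈ uIcc θ₁ θ₂, θ (timeOf F φ₂ φ₃ φ₄ (θ 0) η) = η) ∧
          IsReflectionPeriodic θ (timeOf F φ₂ φ₃ φ₄ (θ 0) θ₁)
            (timeOf F φ₂ φ₃ φ₄ (θ 0) θ₂)) ∧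
        -- case 3.2
        (φ₃ = 0 → ∃ θ₂ : ℝ, θ₂ ≠ θ 0 ∧ polarH2 F (θ 0) = polarH2 F θ₂ ∧
          (∀ ξ ∈ Ioo (min (θ 0) θ₂) (max (θ 0) θ₂),
            0 < φ₄ * (polarH2 F ξ - polarH2 F (θ 0))) ∧
          polarH2 F (θ 0) = φ₂ ∧
          TimeZeroFinite F φ₂ φ₄ (θ 0) θ₂ ∧
          Real.sign (φ₄ * (θ₂ - θ 0)) * timeOfZero F φ₂ φ₄ (θ 0) θ₂ ≠ 0 ∧
          (∀ η ∈ uIcc (θ 0) θ₂,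
            θ (Real.sign (φ₄ * (θ₂ - θ 0)) * timeOfZero F φ₂ φ₄ (θ 0) η) = η) ∧
          IsReflectionPeriodic θ 0
            (Real.sign (φ₄ * (θ₂ - θ 0)) * timeOfZero F φ₂ φ₄ (θ 0) θ₂))) ∧
      -- case 4
      (φ₃ ≠ 0 → casimirEnergy φ₂ φ₃ φ₄ = energyMax F φ₄ →
        ∃ θ₁ θ₂ : ℝ, θ₁ < θ 0 ∧ θ 0 < θ₂ ∧
          angularSpeedSq F φ₂ φ₃ φ₄ θ₁ = 0 ∧ angularSpeedSq F φ₂ φ₃ φ₄ θ₂ = 0 ∧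
          (∀ ξ ∈ Ioo θ₁ θ₂, angularSpeedSq F φ₂ φ₃ φ₄ ξ ≠ 0) ∧
          (¬ TimeFinite F φ₂ φ₃ φ₄ (θ 0) θ₁ → ¬ TimeFinite F φ₂ φ₃ φ₄ (θ 0) θ₂ →
            (∀ t, θ t ∈ Ioo θ₁ θ₂) ∧
            (∀ η ∈ Ioo θ₁ θ₂, TimeFinite F φ₂ φ₃ φ₄ (θ 0) η) ∧
            (∀ t, timeOf F φ₂ φ₃ φ₄ (θ 0) (θ t) = t) ∧
            (∀ η ∈ Ioo θ₁ θ₂, θ (timeOf F φ₂ φ₃ φ₄ (θ 0) η) = η)) ∧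
          (TimeFinite F φ₂ φ₃ φ₄ (θ 0) θ₁ ∨ TimeFinite F φ₂ φ₃ φ₄ (θ 0) θ₂ →
            AngleNotUnique F φ₁ φ₂ φ₃ φ₄ (θ 0)) ∧
          (TimeFinite F φ₂ φ₃ φ₄ (θ 0) θ₁ →
            HasConstancyIntervals F φ₁ φ₂ φ₃ φ₄ (θ 0) θ₁) ∧
          (TimeFinite F φ₂ φ₃ φ₄ (θ 0) θ₂ →
            HasConstancyIntervals F φ₁ φ₂ φ₃ φ₄ (θ 0) θ₂) ∧
          ConstancyFormulas φ₂ φ₃ φ₄ g θ) ∧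
      -- case 5
      (φ₃ = 0 → casimirEnergy φ₂ φ₃ φ₄ = energyMax F φ₄ →
        ∃ θ₁ θ₂ : ℝ, θ 0 ∈ Icc θ₁ θ₂ ∧ (∀ η ∈ Icc θ₁ θ₂, polarH2 F η = φ₂) ∧
          (∀ a b : ℝ, θ 0 ∈ Icc a b → (∀ η ∈ Icc a b, polarH2 F η = φ₂) →
            Icc a b ⊆ Icc θ₁ θ₂) ∧
          -- the cases 5.1, 5.2, 5.3, 5.4
          (((θ₁ = θ 0 ∧ θ 0 = θ₂ ∧
                (∀ η ∈ Ioo (θ₂ - 2 * Real.pi) (θ 0), ¬ TimeZeroFinite F φ₂ φ₄ (θ 0) η) ∧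
                (∀ η ∈ Ioo (θ 0) (θ₁ + 2 * Real.pi), ¬ TimeZeroFinite F φ₂ φ₄ (θ 0) η)) ∨
              (θ₁ < θ 0 ∧ θ 0 < θ₂) ∨
              (θ 0 = θ₁ ∧ θ₁ < θ₂ ∧
                (∀ η ∈ Ioo (θ₂ - 2 * Real.pi) (θ 0), ¬ TimeZeroFinite F φ₂ φ₄ (θ 0) η)) ∨
              (θ 0 = θ₂ ∧ θ₁ < θ₂ ∧
                (∀ η ∈ Ioo (θ 0) (θ₁ + 2 * Real.pi), ¬ TimeZeroFinite F φ₂ φ₄ (θ 0) η))) →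
            (∀ t, θ t = θ 0) ∧ IsVerticalMetricLine F g) ∧
          -- all other cases
          (¬ ((θ₁ = θ 0 ∧ θ 0 = θ₂ ∧
                (∀ η ∈ Ioo (θ₂ - 2 * Real.pi) (θ 0), ¬ TimeZeroFinite F φ₂ φ₄ (θ 0) η) ∧
                (∀ η ∈ Ioo (θ 0) (θ₁ + 2 * Real.pi), ¬ TimeZeroFinite F φ₂ φ₄ (θ 0) η)) ∨
              (θ₁ < θ 0 ∧ θ 0 < θ₂) ∨
              (θ 0 = θ₁ ∧ θ₁ < θ₂ ∧
                (∀ η ∈ Ioo (θ₂ - 2 * Real.pi) (θ 0), ¬ TimeZeroFinite F φ₂ φ₄ (θ 0) η)) ∨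
              (θ 0 = θ₂ ∧ θ₁ < θ₂ ∧
                (∀ η ∈ Ioo (θ 0) (θ₁ + 2 * Real.pi), ¬ TimeZeroFinite F φ₂ φ₄ (θ 0) η))) →
            AngleNotUnique F φ₁ φ₂ φ₃ φ₄ (θ 0) ∧
            HasConstancyIntervals F φ₁ φ₂ φ₃ φ₄ (θ 0) (θ 0)) ∧
          ConstancyFormulasZero φ₂ φ₄ g θ)) := by
  refine ⟨fun u g ψ M h hM hg hψ => h.exists_isPolarAngle hF hM hg hψ,
    fun g θ => isNormalExtremal_iff hF hφ₄, fun g θ hn => ?_⟩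
  obtain ⟨ρ, h⟩ := hn.exists_isGivenBy hF hφ₄
  refine ⟨h.energy_cases hF, fun h3 hE => ⟨h.initial₂, h.inverse_of_energyMax_lt hF h3 hE⟩, ?_,
    fun h1 h2 => ?_, fun h3 hE => h.highest_energy hF hφ₄ h3 hE, ?_⟩
  · rintro rfl hE
    exact h.const_of_energyMin hF hφ₄ hE
  · have hE := abs_casimirEnergy_lt hF h1 h2
    refine ⟨(h.isAngularMotion hF).exists_isReflectionPeriodic hF hE,
      fun h3 => h.oscillation hF h3 hE, ?_⟩
    rintro rfl
    exact h.oscillation_from_rest hF hE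
  · rintro rfl hE
    exact h.highest_energy_at_rest hF hφ₄ hE
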